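/- Let $p$ be an odd prime satisfying Vandiver's conjecture, i.e. $p$ does not divide the class number $h^+$ of $\mathbb{Q}(\zeta+\zeta^{-1})$, where $\zeta$ is a primitive $p$-th root of unity. Let $r=(p-1)/2$ and $K=\mathbb{Q}(\zeta)$, let $L$ be the splitting field of $1-(1-x^p)^p$ over $K$, let $E$ be the maximal elementary abelian $p$-extension of $L$ ramified only above $p$, and put $Q=\mathrm{Gal}(L/K)$, $G=\mathrm{Gal}(E/K)$, $N=\mathrm{Gal}(E/L)$. Put $t_0=\zeta$ and $t_i=1-\zeta^{-i}$ for $1\le i\le r$. Let $w$ be a $p$-th root of $\zeta$, and for $1\le I\le r$ let $$F_I=K\bigl(\sqrt[p]{\zeta^{-I}},\sqrt[p]{1-\zeta^{-I}}\bigr),\qquad \gamma_I=\prod_{j=1}^{p-1}(1-\zeta^j w^{-I})^j,\qquad R_I=F_I\bigl(\sqrt[p]{\gamma_I}\bigr),$$ $\tilde R_I=L R_I$ and $N_I=\mathrm{Gal}(\tilde R_I/L)$. Let $\tilde R$ be the compositum of the fields $\tilde R_I$, $1\le I\le r$, and let $\bar N_H=\mathrm{Gal}(\tilde R/L)$. Then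 $\tilde R\subseteq E$, each $N_I$ is isomorphic to $\mathbb{Z}/p\mathbb{Z}$, and the restriction maps give an isomorphism $$\bar N_H\;\cong\;\prod_{I=1}^r N_I\;\cong\;(\mathbb{Z}/p\mathbb{Z})^r .$$ Moreover, there are elements $\tau_0,\dots,\tau_r\in Q$ with $\tau_i(\sqrt[p]{t_i})=\zeta\sqrt[p]{t_i}$ and $\tau_i(\sqrt[p]{t_j})=\sqrt[p]{t_j}$ for $j\ne i$. For these $\tau_i$ and any set-theoretic section $s:Q\to G$ of the restriction map $G\to Q$, the elements $a_i=s(\tau_i)^p$ ($0\le i\le r$) and $c_{j,k}=s(\tau_k)s(\tau_j)s(\tau_k)^{-1}s(\tau_j)^{-1}$ ($0\le j<k\le r$) lie in $N$. Their images $\bar a_i,\bar c_{j,k}$ in $\bar N_H$ under restriction satisfy the following: $\{\bar c_{0,k}\mid 1\le k\le r\}$ is a basis of the $\mathbb{F}_p$-vector space $\bar N_H$, and 1. $\bar a_i$ is trivial for $0\le i\le r$; 2. $\bar c_{j,k}$ is trivial for $1\le j<k\le r$; 3. for $1\le k,I\le r$, the image of $\bar c_{0,k}$ in $N_I$ is non-trivial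 if and only if $k=I$. -/

import Mathlib

open scoped NumberField

namespace FermatHeis

/-- `ρ ∈ Gal(A/L)` is the restriction of `σ ∈ Gal(B/L)`, for subextensions `A ≤ B` of `Ω / L`. -/
def RestrictsTo {L Ω : Type*} [Field L] [Field Ω] [Algebra L Ω] {A B : IntermediateField L Ω}
    (h : A ≤ B) (σ : Gal(B/L)) (ρ : Gal(A/L)) : Prop :=
  ∀ x : A, ((ρ x : A) : Ω) = (σ (IntermediateField.inclusion h x) : B)

/-! Throughout, `Ω` is an algebraically closed field of characteristic zero in which all number
fields are taken, `ζ ∈ Ω` is a primitive `p`-th root of unity, and `w ∈ Ω` satisfies `w ^ p = ζ`. -/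

section

variable {Ω : Type*} [Field Ω] [CharZero Ω]

/-- The number `r = (p - 1) / 2`. -/
def halfRank (p : ℕ) : ℕ := (p - 1) / 2

/-- The order `h⁺` of the class group of `ℚ(ζ + ζ⁻¹)`. -/
noncomputable def hPlus (ζ : Ω) : ℕ :=
  Nat.card (ClassGroup (𝓞 (IntermediateField.adjoin ℚ {ζ + ζ⁻¹})))

/-- The cyclotomic field `K = ℚ(ζ)`. -/
def fieldK (ζ : Ω) : IntermediateField ℚ Ω := IntermediateField.adjoin ℚ {ζ}

/-- The splitting field `L` of `1 - (1 - x ^ p) ^ p`, as an extension of `K`. -/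
def fieldL (p : ℕ) (ζ : Ω) : IntermediateField (fieldK ζ) Ω :=
  IntermediateField.adjoin (fieldK ζ) {x : Ω | 1 - (1 - x ^ p) ^ p = 0}

/-- The Kummer generators `t₀ = ζ` and `tᵢ = 1 - ζ⁻ⁱ` for `i ≥ 1`. -/
def kummerGen (ζ : Ω) (i : ℕ) : Ω := if i = 0 then ζ else 1 - (ζ ^ i)⁻¹

/-- A finite Galois extension `F / L` whose Galois group is an elementary abelian `p`-group and
which is unramified at all primes not above `p`.  Infinite places play no role for the field `L`
above, which is totally complex. -/
structure IsElemAbUnramifiedOutside (p : ℕ) {L : Type*} [Field L] {F : Type*} [Field F]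
    [Algebra L F] : Prop where
  finite : FiniteDimensional L F
  galois : IsGalois L F
  comm : ∀ σ τ : F ≃ₐ[L] F, σ * τ = τ * σ
  pow_eq_one : ∀ σ : F ≃ₐ[L] F, σ ^ p = 1
  unramified : ∀ (P : Ideal (𝓞 F)) [P.IsPrime], (p : 𝓞 F) ∉ P → Algebra.IsUnramifiedAt (𝓞 L) P

/-- The maximal elementary abelian `p`-extension `E` of `L` ramified only above `p`: the compositum
inside `Ω` of all finite elementary abelian `p`-extensions of `L` unramified outside `p`. -/
def fieldE (p : ℕ) (ζ : Ω) : IntermediateField (fieldL p ζ) Ω :=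
  sSup {F : IntermediateField (fieldL p ζ) Ω |
    IsElemAbUnramifiedOutside p (L := fieldL p ζ) (F := F)}

/-- `γ_I = ∏_{j=1}^{p-1} (1 - ζ ^ j w ^ (-I)) ^ j`. -/
def gam (p : ℕ) (ζ w : Ω) (I : ℕ) : Ω :=
  ∏ j ∈ Finset.Icc 1 (p - 1), (1 - ζ ^ j * (w ^ I)⁻¹) ^ j

/-- `F_I`, obtained from `K` by adjoining the `p`-th roots of `ζ ^ (-I)` and `1 - ζ ^ (-I)`. -/
def fieldF (p : ℕ) (ζ : Ω) (I : ℕ) : IntermediateField (fieldK ζ) Ω :=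
  IntermediateField.adjoin (fieldK ζ) {x : Ω | x ^ p = (ζ ^ I)⁻¹ ∨ x ^ p = 1 - (ζ ^ I)⁻¹}

/-- The Heisenberg extension `R_I` of `K`, obtained from `F_I` by adjoining the `p`-th roots
of `γ_I`. -/
def fieldR (p : ℕ) (ζ w : Ω) (I : ℕ) : IntermediateField (fieldK ζ) Ω :=
  fieldF p ζ I ⊔ IntermediateField.adjoin (fieldK ζ) {y : Ω | y ^ p = gam p ζ w I}

/-- The compositum `L · R_I`, as an extension of `L`. -/
def fieldLR (p : ℕ) (ζ w : Ω) (I : ℕ) : IntermediateField (fieldL p ζ) Ω :=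
  IntermediateField.adjoin (fieldL p ζ) (fieldR p ζ w I : Set Ω)

/-- The compositum `R̃` of the fields `L · R_I` for `1 ≤ I ≤ r`; the index `I : Fin r`
stands for the number `I + 1`. -/
def fieldRt (p : ℕ) (ζ w : Ω) : IntermediateField (fieldL p ζ) Ω :=
  ⨆ I : Fin (halfRank p), fieldLR p ζ w (I + 1)

/-- `τ₀, …, τᵣ ∈ Gal(L/K)` with `τᵢ(ᵖ√tᵢ) = ζ ᵖ√tᵢ` and `τᵢ(ᵖ√tⱼ) = ᵖ√tⱼ` for `j ≠ i`. -/
def IsKummerDual (p : ℕ) (ζ : Ω)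
    (τ : Fin (halfRank p + 1) → Gal((fieldL p ζ)/(fieldK ζ))) : Prop :=
  ∀ (i j : Fin (halfRank p + 1)) (x : fieldL p ζ), (x : Ω) ^ p = kummerGen ζ j →
    ((τ i x : fieldL p ζ) : Ω) = if j = i then ζ * x else x

/-- `s : Gal(L/K) → Gal(E/K)` is a set-theoretic section of the restriction map. -/
def IsGalSection (p : ℕ) (ζ : Ω)
    (s : Gal((fieldL p ζ)/(fieldK ζ)) → Gal((fieldE p ζ)/(fieldK ζ))) : Prop :=
  ∀ (q : Gal((fieldL p ζ)/(fieldK ζ))) (x : fieldL p ζ),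
    s q (algebraMap (fieldL p ζ) (fieldE p ζ) x) = algebraMap (fieldL p ζ) (fieldE p ζ) (q x)

end

end FermatHeis

/-! The proof is Kummer theory over `K` and then over `L`, with one arithmetic input: `t₀, …, tᵣ`
are independent modulo `p`-th powers of `K`. Taking norms reduces a relation between them to one
between roots of unity and the cyclotomic units `(1 - ηⁱ) / (1 - η)`, where `η = ζ⁻¹`. Together with
the torsion, these generate a subgroup of some index `m` in the units of `K`, and `(h⁺ Q)² = m² d`
with `Q ∈ {1, 2}` the Hasse unit index and `d` an integer; so `p ∤ h⁺` gives `p ∤ m`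
(`not_dvd_index_cyclotomicUnits`), and the exponents in a relation are divisible by `p`
(`dvd_of_prod_eq_pow`). The index is found by computing the residue at 1 of the zeta function of the
real subfield twice: by the analytic class number formula, and as the product of the values `L(1,
χ)` over the nontrivial even characters. Each of these is a sum of logarithms that also occurs in
the regulator determinant of the cyclotomic units.

Hence `Gal(L/K)` is elementary abelian of rank `r + 1` and the `τᵢ` exist. Let `u = w⁻ᴵ`, `yᵖ = γ_I`
and `vᵖ = 1 - uᵖ = t_I`. A lift of `τₖ` with `k ≥ 1` fixes `u`, so it multiplies `y` by a root of
unity. A lift of `τ₀` sends `u` to `ζ⁻ᴵ u`, which multiplies `γ_I` by `(vᴵ / θ)ᵖ` for an explicit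
product `θ` in `L` (`gamProd_inv_pow_mul`), so `y` goes to a root of unity times `(vᴵ / θ) y`. Only
the factor `v` obstructs commutation: the commutator of lifts of `τ₀` and `τₖ` multiplies `y` by
`ζᴵ` if `k = I` and fixes it otherwise, and the commutators with `1 ≤ j < k` fix it. The `p`-th
power of a lift of `τ₀` fixes `y` because the conjugates of `θ` multiply to `(1 - uᵖ)ᴵ = vᵖᴵ`
(`prod_theta`).

The same commutators show that the `γ_I` are independent modulo `p`-th powers of `L`
(`dvd_of_prod_gam_eq_pow`). So `Gal(R̃/L)` is `(ℤ/p)ʳ` with one coordinate for each `I`, and `c₀ₖ`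
is `k` times the `k`-th basis vector. Finally `γ_I` divides a power of `p` in the integers of `L`,
so its `p`-th root generates an extension unramified outside `p`, and `R̃ ⊆ E`. -/

set_option linter.unusedSectionVars false

/-! ### The value at 1 of the exponential zeta function -/

section ExpZeta

open Complex Set Filter Topology MeasureTheory HurwitzZeta

/-- The generating function `∑ zⁿ e^{-nt}` over `n ≥ 1`. -/
noncomputable def geomExp (z : ℂ) (t : ℝ) : ℂ := z * cexp (-t) / (1 - z * cexp (-t))

/-- Keeps the argument in the right half-plane, off the branch cut, so that the principal logarithm
is differentiable along the whole half-line. -/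
lemma re_one_sub_mul_exp_pos {z : ℂ} (hz : ‖z‖ = 1) (hz1 : z ≠ 1) {t : ℝ} (ht : 0 ≤ t) :
    0 < (1 - z * cexp (-t)).re := by
  have hre : z.re < 1 := by
    refine lt_of_le_of_ne (hz ▸ re_le_norm z) fun h ↦ hz1 ?_
    have h2 : z.re ^ 2 + z.im ^ 2 = 1 := by
      have := Complex.sq_norm z
      rw [hz, normSq_apply] at this
      nlinarith
    apply Complex.ext
    · simpa using h
    · have : z.im ^ 2 = 0 := by rw [h] at h2; linarith
      simpa using this
  have : cexp (-t) = ((Real.exp (-t) : ℝ) : ℂ) := by push_cast; rfl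
  rw [this, sub_re, one_re, re_mul_ofReal]
  have h1 : Real.exp (-t) ≤ 1 := by simpa using ht
  have h0 := Real.exp_pos (-t)
  nlinarith

lemma one_sub_mul_exp_ne_zero {z : ℂ} (hz : ‖z‖ = 1) (hz1 : z ≠ 1) {t : ℝ} (ht : 0 ≤ t) :
    1 - z * cexp (-t) ≠ 0 := fun h ↦ by
  have := re_one_sub_mul_exp_pos hz hz1 ht
  simp [h] at this

lemma continuousAt_geomExp {z : ℂ} (hz : ‖z‖ = 1) (hz1 : z ≠ 1) {t : ℝ} (ht : 0 ≤ t) :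
    ContinuousAt (geomExp z) t := by
  unfold geomExp
  refine ContinuousAt.div (by fun_prop) (by fun_prop) (one_sub_mul_exp_ne_zero hz hz1 ht)

lemma locallyIntegrableOn_geomExp {z : ℂ} (hz : ‖z‖ = 1) (hz1 : z ≠ 1) :
    LocallyIntegrableOn (geomExp z) (Ioi 0) := by
  refine ContinuousOn.locallyIntegrableOn (fun t ht ↦ ?_) measurableSet_Ioi
  exact (continuousAt_geomExp hz hz1 (le_of_lt ht)).continuousWithinAt

lemma tendsto_cexp_neg_atTop : Tendsto (fun t : ℝ ↦ cexp (-t)) atTop (𝓝 0) := by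
  have : (fun t : ℝ ↦ cexp (-t)) = fun t : ℝ ↦ ((Real.exp (-t) : ℝ) : ℂ) := by
    ext; push_cast; rfl
  rw [this, ← ofReal_zero]
  exact (continuous_ofReal.tendsto _).comp (Real.tendsto_exp_neg_atTop_nhds_zero)

lemma geomExp_isBigO_top (z : ℂ) :
    geomExp z =O[atTop] fun t : ℝ ↦ Real.exp (-1 * t) := by
  have h : Tendsto (fun t : ℝ ↦ z / (1 - z * cexp (-t))) atTop (𝓝 (z / (1 - z * 0))) :=
    tendsto_const_nhds.div (tendsto_const_nhds.sub (tendsto_const_nhds.mul tendsto_cexp_neg_atTop))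
      (by simp)
  have h2 : geomExp z = fun t : ℝ ↦ z / (1 - z * cexp (-t)) * ((Real.exp (-1 * t) : ℝ) : ℂ) := by
    ext t
    simp only [geomExp, neg_mul, one_mul]
    push_cast
    ring
  rw [h2]
  have h3 : (fun t : ℝ ↦ ((Real.exp (-1 * t) : ℝ) : ℂ)) =O[atTop]
      fun t : ℝ ↦ Real.exp (-1 * t) :=
    Asymptotics.IsBigO.of_norm_le fun t ↦ by rw [norm_real, Real.norm_eq_abs, Real.abs_exp]
  simpa only [one_mul] using (h.isBigO_one ℝ).mul h3

lemma geomExp_isBigO_zero {z : ℂ} (hz : ‖z‖ = 1) (hz1 : z ≠ 1) :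
    geomExp z =O[𝓝[>] 0] fun t : ℝ ↦ t ^ (-0 : ℝ) := by
  simp only [neg_zero, Real.rpow_zero]
  exact ((continuousAt_geomExp hz hz1 le_rfl).tendsto.isBigO_one ℝ).mono nhdsWithin_le_nhds

/-- At `s = 1` the Mellin weight is trivial, and `geomExp z` is the derivative of `log (1 - z * exp
(-t))`, which tends to 0 at infinity. -/
lemma mellin_geomExp_one {z : ℂ} (hz : ‖z‖ = 1) (hz1 : z ≠ 1) :
    mellin (geomExp z) 1 = -log (1 - z) := by
  have hint : IntegrableOn (geomExp z) (Ioi 0) := by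
    have := mellinConvergent_of_isBigO_rpow_exp (s := 1) one_pos
      (locallyIntegrableOn_geomExp hz hz1) (geomExp_isBigO_top z) (geomExp_isBigO_zero hz hz1)
      (by simp)
    simpa [MellinConvergent] using this
  have hder : ∀ x : ℝ, 0 ≤ x →
      HasDerivAt (fun t : ℝ ↦ log (1 - z * cexp (-t))) (geomExp z x) x := by
    intro x hx
    have h1 : HasDerivAt (fun t : ℝ ↦ 1 - z * cexp (-t)) (z * cexp (-x)) x := by
      have h0 : HasDerivAt (fun t : ℝ ↦ (-(t : ℂ))) (-1) x := (hasDerivAt_id x).ofReal_comp.neg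
      have := ((h0.cexp).const_mul z).const_sub 1
      convert! this using 1
      ring
    exact h1.clog_real (Or.inl (re_one_sub_mul_exp_pos hz hz1 hx))
  have hlim : Tendsto (fun t : ℝ ↦ log (1 - z * cexp (-t))) atTop (𝓝 0) := by
    have h1 : Tendsto (fun t : ℝ ↦ 1 - z * cexp (-t)) atTop (𝓝 (1 - z * 0)) :=
      tendsto_const_nhds.sub (tendsto_const_nhds.mul tendsto_cexp_neg_atTop)
    have h2 := h1.clog (by simp)
    simpa using h2
  have := integral_Ioi_of_hasDerivAt_of_tendsto (hder 0 le_rfl).continuousAt.continuousWithinAt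
    (fun x hx ↦ hder x (le_of_lt hx)) hint hlim
  simpa [mellin] using this

/-- The series is only available for `1 < re s`, where `Gamma s * expZeta x s` is a Mellin
transform. Both sides are continuous at 1, so the identity passes to the limit from the right. -/
theorem expZeta_one {x : ℝ} (hx : (x : UnitAddCircle) ≠ 0) :
    expZeta x 1 = -log (1 - cexp (2 * Real.pi * I * x)) := by
  set z := cexp (2 * Real.pi * I * x) with hzdef
  have hz : ‖z‖ = 1 := by
    rw [hzdef, show 2 * (Real.pi : ℂ) * I * x = ((2 * Real.pi * x : ℝ) : ℂ) * I by push_cast; ring]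
    exact norm_exp_ofReal_mul_I _
  have hz1 : z ≠ 1 := by
    intro h
    obtain ⟨n, hn⟩ := exp_eq_one_iff.mp h
    apply hx
    have hn' : (x : ℂ) = n := by
      have : (2 * Real.pi * I : ℂ) ≠ 0 := two_pi_I_ne_zero
      apply mul_left_cancel₀ this
      rw [hn]; ring
    have : x = n := by exact_mod_cast hn'
    rw [this]
    exact (AddCircle.coe_eq_zero_iff 1).mpr ⟨n, by simp⟩
  have key : ∀ s : ℂ, 1 < s.re → Gamma s * expZeta x s = mellin (geomExp z) s := by
    intro s hs
    have hs0 : s ≠ 0 := fun h ↦ by simp [h] at hs; linarith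
    have h1 := (hasSum_expZeta_of_one_lt_re x hs).mul_left (Gamma s)
    refine h1.unique ?_
    -- The coefficient at 0 vanishes because the series starts at `n = 1` while the Mellin lemma
    -- sums over all of `ℕ`.
    let a : ℕ → ℂ := fun n ↦ if n = 0 then 0 else z ^ n
    have ha : ∀ n, ‖a n‖ ≤ 1 := fun n ↦ by
      simp only [a]; split_ifs <;> simp [hz]
    have h2 := hasSum_mellin (a := a) (p := fun n : ℕ ↦ (n : ℝ)) (F := geomExp z) (s := s)
      (fun n ↦ by rcases Nat.eq_zero_or_pos n with h | h <;> simp [a, h]) (by linarith)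
      (fun t ht ↦ ?_) ?_
    · convert! h2 using 1
      ext n
      rcases Nat.eq_zero_or_pos n with h | h
      · simp [h, a, hs0]
      · simp only [a, h.ne', if_false, hzdef, ← Complex.exp_nat_mul, ofReal_natCast]
        rw [mul_div_assoc]; congr 3; ring
    · have hlt : ‖z * cexp (-t)‖ < 1 := by
        rw [norm_mul, hz, one_mul, ← ofReal_neg, norm_exp_ofReal, Real.exp_lt_one_iff]
        simpa using ht
      have h3 := hasSum_geometric_of_norm_lt_one hlt
      have h4 := (h3.mul_left (z * cexp (-t)))
      have h5 : HasSum (fun n : ℕ ↦ a (n + 1) * (Real.exp (-(n + 1 : ℕ) * t) : ℂ)) (geomExp z t) := by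
        convert! h4 using 1
        ext n
        simp only [a, Nat.succ_ne_zero, if_false]
        have he : ((Real.exp (-(n + 1 : ℕ) * t) : ℝ) : ℂ) = cexp (-t) * cexp (-t) ^ n := by
          rw [← Complex.exp_nat_mul, ← Complex.exp_add]
          push_cast; ring_nf
        rw [he, pow_succ', mul_pow]
        ring
      have := (hasSum_nat_add_iff (f := fun n : ℕ ↦ a n * (Real.exp (-(n : ℝ) * t) : ℂ)) 1).mp
        (by simpa using h5)
      simpa [a] using this
    · refine Summable.of_nonneg_of_le (fun n ↦ by positivity) (fun n ↦ ?_)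
        (Real.summable_nat_rpow_inv.mpr hs)
      rw [div_eq_mul_inv]
      exact mul_le_of_le_one_left (by positivity) (ha n)
  have hc1 : ContinuousAt (fun s ↦ Gamma s * expZeta x s) 1 :=
    (differentiableAt_Gamma_one.continuousAt).mul
      (differentiable_expZeta_of_ne_zero hx 1).continuousAt
  have hc2 : ContinuousAt (mellin (geomExp z)) 1 :=
    (mellin_differentiableAt_of_isBigO_rpow_exp one_pos (locallyIntegrableOn_geomExp hz hz1)
      (geomExp_isBigO_top z) (geomExp_isBigO_zero hz hz1) (by simp)).continuousAt
  have hlim : Tendsto (fun s : ℝ ↦ (s : ℂ)) (𝓝[>] 1) (𝓝 1) :=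
    (continuous_ofReal.tendsto' 1 1 (by simp)).mono_left nhdsWithin_le_nhds
  have e1 := hc1.tendsto.comp hlim
  have e2 := hc2.tendsto.comp hlim
  have e3 : (fun s : ℝ ↦ Gamma s * expZeta x s) =ᶠ[𝓝[>] 1] fun s : ℝ ↦ mellin (geomExp z) s := by
    filter_upwards [self_mem_nhdsWithin] with s hs
    exact key s (by simpa using hs)
  have := tendsto_nhds_unique (e1.congr' e3) e2
  rw [Gamma_one, one_mul] at this
  rw [this, mellin_geomExp_one hz hz1]

end ExpZeta

/-! ### `L(1, χ)` for even characters modulo a prime -/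

section DirichletLOne

open Complex HurwitzZeta ZMod

variable {p : ℕ} [hp : Fact p.Prime]

lemma isPrimitive_of_prime {χ : DirichletCharacter ℂ p} (hχ : χ ≠ 1) : χ.IsPrimitive := by
  rw [DirichletCharacter.isPrimitive_def]
  rcases (Nat.dvd_prime hp.out).mp χ.conductor_dvd_level with h | h
  · exact absurd ((DirichletCharacter.eq_one_iff_conductor_eq_one).mpr h) hχ
  · exact h

lemma star_gaussSum {χ : DirichletCharacter ℂ p} :
    (starRingEnd ℂ) (gaussSum χ stdAddChar) = gaussSum χ⁻¹ (stdAddChar (N := p))⁻¹ := by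
  simp only [gaussSum, map_sum, map_mul]
  refine Finset.sum_congr rfl fun a _ ↦ ?_
  congr 1
  · exact (MulChar.star_apply' χ a)
  · rw [AddChar.inv_apply, AddChar.map_neg_eq_conj]

lemma norm_gaussSum_sq {χ : DirichletCharacter ℂ p} (hχ : χ ≠ 1) :
    ‖gaussSum χ stdAddChar‖ ^ 2 = p := by
  have h := gaussSum_mul_gaussSum_eq_card hχ (isPrimitive_stdAddChar p)
  rw [← star_gaussSum, Complex.mul_conj, ZMod.card] at h
  rw [Complex.sq_norm]
  exact_mod_cast h

lemma stdAddChar_ne_one {j : ZMod p} (hj : j ≠ 0) : stdAddChar j ≠ 1 := by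
  intro h
  exact hj (injective_stdAddChar (by simpa using h))

lemma norm_stdAddChar (j : ZMod p) : ‖stdAddChar j‖ = 1 := by
  rw [stdAddChar_apply]; exact Circle.norm_coe _

lemma expZeta_toAddCircle_one {j : ZMod p} (hj : j ≠ 0) :
    expZeta (toAddCircle j) 1 = -log (1 - stdAddChar j) := by
  have h0 : toAddCircle j ≠ 0 := by simpa using hj
  rw [toAddCircle_apply] at h0 ⊢
  rw [expZeta_one h0]
  congr 3
  rw [stdAddChar_apply, toCircle_apply]
  congr 1; push_cast; ring

/-- The two arguments are complex conjugates off the branch cut, so the imaginary parts of the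
logarithms cancel. -/
lemma log_one_sub_stdAddChar_add {j : ZMod p} (hj : j ≠ 0) :
    log (1 - stdAddChar (-j)) + log (1 - stdAddChar j) =
      2 * (Real.log ‖1 - stdAddChar j‖ : ℝ) := by
  have h1 : (1 - stdAddChar (-j) : ℂ) = (starRingEnd ℂ) (1 - stdAddChar j) := by
    rw [map_sub, map_one, AddChar.map_neg_eq_conj]
  have hre := re_one_sub_mul_exp_pos (norm_stdAddChar j) (stdAddChar_ne_one hj) le_rfl
  simp only [ofReal_zero, neg_zero, exp_zero, mul_one] at hre
  have harg : (1 - stdAddChar j : ℂ).arg ≠ Real.pi := fun h ↦ by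
    rw [arg_eq_pi_iff] at h; linarith [h.1]
  rw [h1, log_conj _ harg, add_comm, add_conj, log_re]
  push_cast; ring

/-- The value at `1` of the `L`-function of an even Dirichlet character modulo a prime. -/
theorem norm_LFunction_one_of_even {χ : DirichletCharacter ℂ p} (hχ : χ ≠ 1) (he : χ.Even) :
    ‖χ⁻¹.LFunction 1‖ * √p = ‖∑ j, χ j * (Real.log ‖1 - stdAddChar j‖ : ℝ)‖ := by
  have hchi0 : χ 0 = 0 := χ.map_nonunit not_isUnit_zero
  -- The `L`-function of the Fourier transform of `χ` is a sum of values `χ j * expZeta (-j / p)`,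
  -- and the transform is a Gauss sum times `χ⁻¹` since `χ` is even and primitive.
  have h := LFunction_dft (N := p) χ (s := 1) (Or.inl hchi0)
  have hneg : ∀ j, χ (-j) = χ j := he.eval_neg
  have hF : (𝓕 χ : ZMod p → ℂ) = fun k ↦ gaussSum χ stdAddChar * χ⁻¹ k := by
    ext k
    rw [(isPrimitive_of_prime hχ).fourierTransform_eq_inv_mul_gaussSum, MulChar.inv_apply',
      MulChar.inv_apply', inv_neg, hneg, mul_comm]
  have hL : LFunction (𝓕 χ : ZMod p → ℂ) 1 = gaussSum χ stdAddChar * χ⁻¹.LFunction 1 := by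
    rw [hF, DirichletCharacter.LFunction]
    simp only [LFunction, Finset.mul_sum]
    refine Finset.sum_congr rfl fun i _ ↦ by ring
  rw [hL] at h
  have e1 : ∑ j, χ j * expZeta (toAddCircle (-j)) 1 = ∑ j, χ j * -log (1 - stdAddChar (-j)) := by
    refine Finset.sum_congr rfl fun j _ ↦ ?_
    by_cases hj : j = 0
    · simp [hj, hchi0]
    · rw [expZeta_toAddCircle_one (neg_ne_zero.mpr hj)]
  have e2 : ∑ j, χ j * -log (1 - stdAddChar (-j)) = ∑ j, χ j * -log (1 - stdAddChar j) := by
    refine Fintype.sum_equiv (Equiv.neg _) _ _ fun j ↦ ?_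
    simp [hneg]
  -- Evenness allows the terms at `j` and `-j` to be paired, which replaces the complex logarithms
  -- by logarithms of absolute values.
  have e3 : 2 * ∑ j, χ j * -log (1 - stdAddChar (-j)) =
      2 * -∑ j, χ j * (Real.log ‖1 - stdAddChar j‖ : ℝ) := by
    nth_rewrite 1 [two_mul]
    nth_rewrite 2 [e2]
    rw [← Finset.sum_add_distrib, ← Finset.sum_neg_distrib, Finset.mul_sum]
    refine Finset.sum_congr rfl fun j _ ↦ ?_
    by_cases hj : j = 0
    · simp [hj, hchi0]
    · have := log_one_sub_stdAddChar_add hj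
      linear_combination (-χ j) * this
  have e4 := mul_left_cancel₀ two_ne_zero e3
  rw [e1, e4] at h
  rw [← norm_neg (∑ j, _), ← h, norm_mul, mul_comm]
  congr 1
  rw [Real.sqrt_eq_iff_mul_self_eq (by positivity) (by positivity), ← sq, norm_gaussSum_sq hχ]

end DirichletLOne

/-! ### Counting ideals of given norm -/

section IdealCount

open Ideal

/-- The number of integral ideals of norm `n`. -/
noncomputable def idealCount (F : Type*) [Field F] [NumberField F] (n : ℕ) : ℕ :=
  Nat.card {I : Ideal (𝓞 F) // absNorm I = n}

variable (F : Type*) [Field F] [NumberField F]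

omit [NumberField F] in
variable {F} in
lemma Ideal.sup_span_eq_top_of_coprime {J : Ideal (𝓞 F)} {m n : ℕ} (h : Nat.Coprime m n)
    (hJ : (n : 𝓞 F) ∈ J) : J ⊔ span {(m : 𝓞 F)} = ⊤ := by
  rw [eq_top_iff_one]
  have hb : (m : ℤ) * m.gcdA n + n * m.gcdB n = 1 := by
    rw [← Nat.gcd_eq_gcd_ab, h.gcd_eq_one]; rfl
  have hb' : (n : 𝓞 F) * (m.gcdB n : ℤ) + (m : 𝓞 F) * (m.gcdA n : ℤ) = 1 := by
    have := congrArg (Int.cast : ℤ → 𝓞 F) hb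
    push_cast at this
    linear_combination this
  rw [← hb']
  exact Submodule.add_mem_sup (J.mul_mem_right _ hJ)
    (Ideal.mul_mem_right _ _ (mem_span_singleton_self _))

omit [NumberField F] in
variable {F} in
-- Recovers one factor of a product as its gcd with `m`; this gives uniqueness of the splitting into
-- coprime parts.
lemma Ideal.eq_mul_sup_span {J J' : Ideal (𝓞 F)} {m n : ℕ} (h : Nat.Coprime m n)
    (hJ : (m : 𝓞 F) ∈ J) (hJ' : (n : 𝓞 F) ∈ J') : J * J' ⊔ span {(m : 𝓞 F)} = J := by
  apply le_antisymm
  · exact sup_le Ideal.mul_le_left (by rwa [span_singleton_le_iff_mem])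
  · calc J = J * (J' ⊔ span {(m : 𝓞 F)}) := by rw [sup_span_eq_top_of_coprime h hJ', mul_top]
      _ = J * J' ⊔ J * span {(m : 𝓞 F)} := Ideal.mul_sup _ _ _
      _ ≤ _ := sup_le_sup_left Ideal.mul_le_right _

variable {F} in
lemma Ideal.absNorm_sup_span_coprime (I : Ideal (𝓞 F)) {m n : ℕ} (h : Nat.Coprime m n) :
    (absNorm (I ⊔ span {(m : 𝓞 F)})).Coprime n := by
  have h1 : absNorm (I ⊔ span {(m : 𝓞 F)}) ∣ absNorm (span {(m : 𝓞 F)}) :=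
    absNorm_dvd_absNorm_of_le le_sup_right
  rw [absNorm_span_natCast] at h1
  exact Nat.Coprime.coprime_dvd_left h1 (h.pow_left _)

/-- Multiplication of ideals is a bijection from pairs of norms `(m, n)`; its inverse takes `I` to
its gcds with `m` and with `n`. -/
theorem idealCount_mul {m n : ℕ} (h : Nat.Coprime m n) (hm : m ≠ 0) (hn : n ≠ 0) :
    idealCount F (m * n) = idealCount F m * idealCount F n := by
  rw [idealCount, idealCount, idealCount, ← Nat.card_prod]
  symm
  refine Nat.card_eq_of_bijective (fun x ↦ ⟨x.1.1 * x.2.1, by rw [map_mul, x.1.2, x.2.2]⟩) ⟨?_, ?_⟩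
  · rintro ⟨⟨J, hJ⟩, ⟨J', hJ'⟩⟩ ⟨⟨L, hL⟩, ⟨L', hL'⟩⟩ he
    simp only [Subtype.mk.injEq] at he
    have mJ : (m : 𝓞 F) ∈ J := hJ ▸ absNorm_mem J
    have mL : (m : 𝓞 F) ∈ L := hL ▸ absNorm_mem L
    have nJ : (n : 𝓞 F) ∈ J' := hJ' ▸ absNorm_mem J'
    have nL : (n : 𝓞 F) ∈ L' := hL' ▸ absNorm_mem L'
    have e1 : J = L := by rw [← eq_mul_sup_span h mJ nJ, he, eq_mul_sup_span h mL nL]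
    have e2 : J' = L' := by
      rw [← eq_mul_sup_span h.symm nJ mJ, mul_comm, he, mul_comm, eq_mul_sup_span h.symm nL mL]
    subst e1; subst e2; rfl
  · rintro ⟨I, hI⟩
    have hmn : ((m * n : ℕ) : 𝓞 F) ∈ I := hI ▸ absNorm_mem I
    have hIe : (I ⊔ span {(m : 𝓞 F)}) * (I ⊔ span {(n : 𝓞 F)}) = I := by
      apply le_antisymm
      · rw [Ideal.sup_mul, Ideal.mul_sup, Ideal.mul_sup]
        refine sup_le (sup_le Ideal.mul_le_left Ideal.mul_le_left) (sup_le Ideal.mul_le_right ?_)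
        rw [span_singleton_mul_span_singleton, span_singleton_le_iff_mem]
        exact_mod_cast hmn
      · have htop : span {(m : 𝓞 F)} ⊔ span {(n : 𝓞 F)} = ⊤ :=
          sup_span_eq_top_of_coprime h.symm (mem_span_singleton_self _)
        calc I = I * (span {(m : 𝓞 F)} ⊔ span {(n : 𝓞 F)}) := by rw [htop, mul_top]
          _ = I * span {(m : 𝓞 F)} ⊔ I * span {(n : 𝓞 F)} := Ideal.mul_sup _ _ _
          _ ≤ _ := sup_le ?_ ?_
        · rw [mul_comm]; exact mul_mono le_sup_right le_sup_left
        · exact mul_mono le_sup_left le_sup_right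
    -- The two norms multiply to `m * n`, the first is prime to `n` and the second to `m`; this
    -- forces them to be `m` and `n`.
    have hN : absNorm (I ⊔ span {(m : 𝓞 F)}) * absNorm (I ⊔ span {(n : 𝓞 F)}) = m * n := by
      rw [← map_mul, hIe, hI]
    have c1 := absNorm_sup_span_coprime I h
    have c2 := absNorm_sup_span_coprime I h.symm
    have d1 : absNorm (I ⊔ span {(m : 𝓞 F)}) ∣ m :=
      c1.dvd_of_dvd_mul_right (hN ▸ dvd_mul_right _ _)
    have d2 : absNorm (I ⊔ span {(n : 𝓞 F)}) ∣ n :=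
      c2.dvd_of_dvd_mul_left (hN ▸ dvd_mul_left _ _)
    have l1 := Nat.le_of_dvd (Nat.pos_of_ne_zero hm) d1
    have l2 := Nat.le_of_dvd (Nat.pos_of_ne_zero hn) d2
    have hm' := Nat.pos_of_ne_zero hm
    have hn' := Nat.pos_of_ne_zero hn
    have e1 : absNorm (I ⊔ span {(m : 𝓞 F)}) = m := by
      refine le_antisymm l1 (Nat.le_of_mul_le_mul_right ?_ hn')
      rw [← hN]; exact Nat.mul_le_mul_left _ l2
    have e2 : absNorm (I ⊔ span {(n : 𝓞 F)}) = n := by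
      rw [e1] at hN; exact Nat.eq_of_mul_eq_mul_left hm' hN
    exact ⟨⟨⟨_, e1⟩, ⟨_, e2⟩⟩, Subtype.ext hIe⟩

lemma idealCount_one : idealCount F 1 = 1 := by
  rw [idealCount]
  simp only [absNorm_eq_one_iff]
  simp

section PrimePow

variable {F} {ℓ f : ℕ} (hℓ : ℓ.Prime)
  (hP : ∀ P ∈ primesOver (span {(ℓ : ℤ)}) (𝓞 F), absNorm P = ℓ ^ f)

include hP in
lemma absNorm_prod_primesOver (s : Multiset (primesOver (span {(ℓ : ℤ)}) (𝓞 F))) :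
    absNorm (s.map Subtype.val).prod = ℓ ^ (f * s.card) := by
  rw [map_multiset_prod, Multiset.map_map, Multiset.map_congr rfl (g := fun _ ↦ ℓ ^ f)
    (fun P _ ↦ hP P.1 P.2), Multiset.map_const', Multiset.prod_replicate, pow_mul]

include hℓ in
lemma exists_multiset_primesOver {I : Ideal (𝓞 F)} {e : ℕ} (hI : absNorm I = ℓ ^ e) :
    ∃ s : Multiset (primesOver (span {(ℓ : ℤ)}) (𝓞 F)), (s.map Subtype.val).prod = I := by
  have hI0 : I ≠ ⊥ := by
    rintro rfl
    rw [absNorm_bot] at hI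
    exact (pow_ne_zero e hℓ.ne_zero) hI.symm
  have hmem : ∀ P ∈ UniqueFactorizationMonoid.normalizedFactors I,
      P ∈ primesOver (span {(ℓ : ℤ)}) (𝓞 F) := by
    intro P hPI
    have hprime : Prime P := UniqueFactorizationMonoid.prime_of_normalized_factor P hPI
    have hPp : P.IsPrime := isPrime_of_prime hprime
    refine ⟨hPp, ?_⟩
    have hd := UniqueFactorizationMonoid.dvd_of_mem_normalizedFactors hPI
    have hle : I ≤ P := le_of_dvd hd
    have h1 : ((ℓ ^ e : ℕ) : 𝓞 F) ∈ P := hle (hI ▸ absNorm_mem I)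
    have h2 : (ℓ : 𝓞 F) ∈ P := by
      rw [Nat.cast_pow] at h1
      exact hPp.mem_of_pow_mem e h1
    have hmax : (span {(ℓ : ℤ)}).IsMaximal :=
      PrincipalIdealRing.isMaximal_of_irreducible (Nat.prime_iff_prime_int.mp hℓ).irreducible
    refine ⟨hmax.eq_of_le (comap_ne_top _ hPp.ne_top) ?_⟩
    rw [span_singleton_le_iff_mem, mem_comap]
    simpa using h2
  refine ⟨(UniqueFactorizationMonoid.normalizedFactors I).pmap Subtype.mk hmem, ?_⟩
  rw [Multiset.map_pmap, Multiset.pmap_eq_map, Multiset.map_id']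
  exact associated_iff_eq.mp (UniqueFactorizationMonoid.prod_normalizedFactors hI0)

include hP in
lemma primesOver_prime (hℓ : ℓ.Prime) {P : Ideal (𝓞 F)}
    (h : P ∈ primesOver (span {(ℓ : ℤ)}) (𝓞 F)) : Prime P := by
  refine prime_of_isPrime ?_ h.1
  rintro rfl
  have := hP _ h
  rw [absNorm_bot] at this
  exact (pow_ne_zero f hℓ.ne_zero) this.symm

include hP hℓ in
-- By unique factorisation, an ideal of norm `ℓ ^ (f * k)` is a multiset of `k` primes above `ℓ`,
-- each of norm `ℓ ^ f`.
lemma idealCount_prime_pow_mul (hf : f ≠ 0) (k : ℕ) :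
    idealCount F (ℓ ^ (f * k)) = Nat.card (Sym (primesOver (span {(ℓ : ℤ)}) (𝓞 F)) k) := by
  symm
  refine Nat.card_eq_of_bijective (fun s ↦ ⟨(s.1.map Subtype.val).prod, by
    rw [absNorm_prod_primesOver hP s.1, s.2]⟩) ⟨?_, ?_⟩
  · intro s t hst
    simp only [Subtype.mk.injEq] at hst
    have key : ∀ s : Multiset (primesOver (span {(ℓ : ℤ)}) (𝓞 F)),
        UniqueFactorizationMonoid.normalizedFactors (s.map Subtype.val).prod =
          s.map Subtype.val := fun s ↦ by
      apply UniqueFactorizationMonoid.normalizedFactors_prod_of_prime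
      intro P hPs
      obtain ⟨Q, -, rfl⟩ := Multiset.mem_map.mp hPs
      exact primesOver_prime hP hℓ Q.2
    have h1 := key s.1
    rw [show (s.1.map Subtype.val).prod = (t.1.map Subtype.val).prod from hst, key t.1] at h1
    exact Subtype.ext (Multiset.map_injective Subtype.val_injective h1.symm)
  · rintro ⟨I, hI⟩
    obtain ⟨s, rfl⟩ := exists_multiset_primesOver hℓ hI
    rw [absNorm_prod_primesOver hP] at hI
    have := Nat.pow_right_injective hℓ.two_le hI
    exact ⟨⟨s, Nat.eq_of_mul_eq_mul_left (Nat.pos_of_ne_zero hf) this⟩, rfl⟩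

include hP hℓ in
lemma idealCount_prime_pow_eq_zero {e : ℕ} (he : ¬ f ∣ e) : idealCount F (ℓ ^ e) = 0 := by
  rw [idealCount]
  have : IsEmpty {I : Ideal (𝓞 F) // absNorm I = ℓ ^ e} := by
    refine ⟨fun ⟨I, hI⟩ ↦ he ?_⟩
    obtain ⟨s, rfl⟩ := exists_multiset_primesOver hℓ hI
    rw [absNorm_prod_primesOver hP] at hI
    exact ⟨_, (Nat.pow_right_injective hℓ.two_le hI).symm⟩
  exact Nat.card_of_isEmpty

include hP hℓ in
/-- The local factor at `ℓ` of the Dedekind zeta function when all residue degrees are equal. -/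
theorem hasSum_idealCount_prime_pow (hf : f ≠ 0) {g : ℕ} (hg0 : g ≠ 0)
    (hg : (primesOver (span {(ℓ : ℤ)}) (𝓞 F)).ncard = g) {x : ℂ} (hx : ‖x‖ < 1) :
    HasSum (fun e : ℕ ↦ (idealCount F (ℓ ^ e) : ℂ) * x ^ e) ((1 - x ^ f) ^ g)⁻¹ := by
  have hfin : Finite (primesOver (span {(ℓ : ℤ)}) (𝓞 F)) :=
    Set.finite_of_ncard_ne_zero (hg ▸ hg0)
  have : Fintype (primesOver (span {(ℓ : ℤ)}) (𝓞 F)) := Fintype.ofFinite _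
  have hcard : Fintype.card (primesOver (span {(ℓ : ℤ)}) (𝓞 F)) = g := by
    rw [← hg, ← Nat.card_coe_set_eq, Nat.card_eq_fintype_card]
  have hinj : Function.Injective (fun k ↦ f * k) :=
    fun a b h ↦ Nat.eq_of_mul_eq_mul_left (Nat.pos_of_ne_zero hf) h
  rw [← hinj.hasSum_iff]
  · obtain ⟨d, rfl⟩ := Nat.exists_eq_succ_of_ne_zero hg0
    have hxf : ‖x ^ f‖ < 1 := by
      rw [norm_pow]; exact pow_lt_one₀ (norm_nonneg _) hx hf
    -- The number of multisets of size `k` from `d + 1` primes is the coefficient of the `k`-th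
    -- power in the binomial series of exponent `-(d + 1)`.
    convert! hasSum_choose_mul_geometric_of_norm_lt_one d hxf using 1
    · ext k
      classical
      simp only [Function.comp]
      rw [idealCount_prime_pow_mul hℓ hP hf, Nat.card_eq_fintype_card, Sym.card_sym_eq_choose,
        hcard, pow_mul]
      congr 2
      rw [show d.succ + k - 1 = k + d by omega, Nat.choose_symm_add]
    · rw [one_div]
  · intro e he
    have : ¬ f ∣ e := fun ⟨k, hk⟩ ↦ he ⟨k, hk.symm⟩
    rw [idealCount_prime_pow_eq_zero hℓ hP this]; simp

end PrimePow

end IdealCount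

/-! ### Products over the values of a homomorphism to `ℂˣ` -/

section CharacterProduct

variable {X : Type*} [CommGroup X] [Finite X]

omit [Finite X] in
lemma hom_pow_orderOf (φ : X →* ℂˣ) (χ : X) : (φ χ : ℂ) ^ orderOf φ = 1 := by
  have h := DFunLike.congr_fun (pow_orderOf_eq_one φ) χ
  rw [MonoidHom.pow_apply, MonoidHom.one_apply] at h
  rw [← Units.val_pow_eq_pow_val, h, Units.val_one]

lemma finite_range_hom (φ : X →* ℂˣ) : Finite φ.range :=
  inferInstanceAs (Finite (Set.range φ))

/-- The image is a finite subgroup of `ℂˣ`, hence cyclic, so its order is the order of one value of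
`φ`. -/
lemma card_range_eq_orderOf (φ : X →* ℂˣ) : Nat.card φ.range = orderOf φ := by
  have hfin : Finite φ.range := finite_range_hom φ
  apply Nat.dvd_antisymm
  · have hcyc : IsCyclic φ.range := inferInstance
    obtain ⟨⟨g, χ, rfl⟩, hg⟩ := hcyc.exists_generator
    have h1 : Nat.card φ.range = orderOf (⟨φ χ, ⟨χ, rfl⟩⟩ : φ.range) :=
      (orderOf_eq_card_of_forall_mem_zpowers hg).symm
    rw [h1, orderOf_dvd_iff_pow_eq_one]
    ext
    simpa using hom_pow_orderOf φ χ
  · rw [orderOf_dvd_iff_pow_eq_one]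
    ext χ
    have := pow_card_eq_one' (x := (⟨φ χ, ⟨χ, rfl⟩⟩ : φ.range))
    simpa using congrArg (fun z : φ.range ↦ ((z : ℂˣ) : ℂ)) this

lemma orderOf_hom_pos (φ : X →* ℂˣ) : 0 < orderOf φ := by
  have hfin : Finite φ.range := finite_range_hom φ
  rw [← card_range_eq_orderOf]; exact Nat.card_pos

lemma card_fiber_mul_orderOf [Fintype X] (φ : X →* ℂˣ) {z : ℂˣ} (hz : z ∈ Set.range φ)
    [DecidableEq ℂˣ] : (Finset.univ.filter fun χ ↦ φ χ = z).card * orderOf φ = Nat.card X := by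
  classical
  rw [← card_range_eq_orderOf, Nat.card_eq_fintype_card (α := X), ← Finset.card_univ,
    Finset.card_eq_sum_card_image φ Finset.univ, Finset.sum_const_nat
    (m := (Finset.univ.filter fun χ ↦ φ χ = z).card)]
  · rw [mul_comm]
    congr 1
    have : (φ.range : Set ℂˣ) = (Finset.univ.image φ : Finset ℂˣ) := by simp
    rw [← SetLike.coe_sort_coe, this, Nat.card_coe_set_eq, Set.ncard_coe_finset]
  · intro y hy
    obtain ⟨χ, -, rfl⟩ := Finset.mem_image.mp hy
    exact MonoidHom.card_fiber_eq_of_mem_range φ ⟨χ, rfl⟩ hz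

/-- With `f = orderOf φ`, every `f`-th root of unity is taken by `φ` equally often, and the product
of `1 - z * x` over these roots is `1 - x ^ f`. -/
lemma prod_one_sub_char [Fintype X] (φ : X →* ℂˣ) (x : ℂ) :
    ∏ χ, (1 - (φ χ : ℂ) * x) = (1 - x ^ orderOf φ) ^ (Nat.card X / orderOf φ) := by
  classical
  have hpos := orderOf_hom_pos φ
  have hprim := Complex.isPrimitiveRoot_exp _ hpos.ne'
  have h1 := hprim.pow_sub_pow_eq_prod_sub_mul 1 x hpos
  rw [one_pow] at h1
  have himg : Finset.univ.image (fun χ ↦ (φ χ : ℂ)) = Polynomial.nthRootsFinset (orderOf φ) 1 := by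
    apply Finset.eq_of_subset_of_card_le
    · intro z hz
      obtain ⟨χ, -, rfl⟩ := Finset.mem_image.mp hz
      rw [Polynomial.mem_nthRootsFinset hpos]
      exact hom_pow_orderOf φ χ
    · rw [hprim.card_nthRootsFinset, ← card_range_eq_orderOf]
      have : Nat.card φ.range = (Finset.univ.image φ).card := by
        have : (φ.range : Set ℂˣ) = (Finset.univ.image φ : Finset ℂˣ) := by simp
        rw [← SetLike.coe_sort_coe, this, Nat.card_coe_set_eq, Set.ncard_coe_finset]
      rw [this, ← Finset.card_image_of_injective (Finset.univ.image φ) Units.val_injective,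
        Finset.image_image]
      rfl
  rw [h1, ← himg, ← Finset.prod_pow, Finset.prod_comp (fun z ↦ 1 - z * x) (fun χ ↦ (φ χ : ℂ))]
  refine Finset.prod_congr rfl fun z hz ↦ ?_
  congr 1
  obtain ⟨χ, -, rfl⟩ := Finset.mem_image.mp hz
  symm
  apply Nat.div_eq_of_eq_mul_left hpos
  rw [← card_fiber_mul_orderOf φ ⟨χ, rfl⟩]
  simp [Units.val_inj]

end CharacterProduct

/-! ### Splitting of primes in subfields of the `p`-th cyclotomic field -/

section AbelianLocal

open Ideal IsCyclotomicExtension.Rat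
open scoped Pointwise

variable {p : ℕ} [hp : Fact p.Prime] {K : Type*} [Field K] [NumberField K]
  [IsCyclotomicExtension {p} ℚ K] [IsAbelianGalois ℚ K] (F : IntermediateField ℚ K)

variable (p) in
/-- The group of Dirichlet characters modulo `p` cutting out the subfield `F`. -/
noncomputable abbrev fieldChars : Subgroup (DirichletCharacter ℂ p) :=
  intermediateFieldEquivSubgroupChar p K ℂ F

/-- Evaluation of the characters of `F` at a unit. -/
noncomputable def evalChar (u : (ZMod p)ˣ) : fieldChars p F →* ℂˣ where
  toFun χ := MulChar.mulEquivToUnitHom χ.1 u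
  map_one' := by rw [OneMemClass.coe_one, map_one]; rfl
  map_mul' χ ψ := by rw [Subgroup.coe_mul, map_mul]; rfl

lemma coe_evalChar (u : (ZMod p)ˣ) (χ : fieldChars p F) : (evalChar F u χ : ℂ) = χ.1 u := by
  rfl

lemma evalChar_pow (u : (ZMod p)ˣ) (k : ℕ) : evalChar F u ^ k = evalChar F (u ^ k) := by
  ext χ
  simp [coe_evalChar]

lemma mem_fixingSubgroup_iff_chars (σ : Gal(K/ℚ)) :
    σ ∈ F.fixingSubgroup ↔ ∀ χ ∈ fieldChars p F, χ (galEquivZMod p K σ) = 1 := by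
  have h := mem_subgroupGalEquivSubgroupChar_symm_iff p K ℂ σ (fieldChars p F)
  rw [← h, fieldChars, intermediateFieldEquivSubgroupChar]
  simp

lemma evalChar_eq_one_iff (u : (ZMod p)ˣ) :
    evalChar F u = 1 ↔ (galEquivZMod p K).symm u ∈ F.fixingSubgroup := by
  rw [mem_fixingSubgroup_iff_chars (p := p), MulEquiv.apply_symm_apply, MonoidHom.ext_iff]
  constructor
  · intro h χ hχ
    simpa [coe_evalChar] using congrArg Units.val (h ⟨χ, hχ⟩)
  · intro h χ
    ext
    simpa [coe_evalChar] using h χ.1 χ.2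

variable {ℓ : ℕ} [hℓ : Fact ℓ.Prime]

/-- The decomposition group over `ℚ` is cyclic, generated by the Frobenius `σ`. Its intersection
with `Gal(K/F)` is generated by the first power of `σ` fixing `F`, whose exponent is the order of
evaluation at `ℓ` on the characters of `F`. -/
lemma card_stabilizer_relative (hn : ℓ.Coprime p) (P : Ideal (𝓞 K)) [P.IsMaximal]
    [P.LiesOver (span {(ℓ : ℤ)})] :
    Nat.card (MulAction.stabilizer Gal(K/F) P) * orderOf (evalChar F (ZMod.unitOfCoprime ℓ hn)) =
      orderOf (ZMod.unitOfCoprime ℓ hn) := by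
  set u := ZMod.unitOfCoprime ℓ hn with hu
  set σ := (galEquivZMod p K).symm u with hσ
  have hD : MulAction.stabilizer Gal(K/ℚ) P = Subgroup.zpowers σ := by
    have := galEquivZMod_stabilizer p K ℓ P hn
    rw [← hu] at this
    apply_fun (galEquivZMod p K).mapSubgroup
    rw [this, MulEquiv.coe_mapSubgroup, MonoidHom.map_zpowers]
    change _ = Subgroup.zpowers (galEquivZMod p K ((galEquivZMod p K).symm u))
    rw [MulEquiv.apply_symm_apply]
  have hσo : orderOf σ = orderOf u := by
    rw [hσ]; exact orderOf_injective (galEquivZMod p K).symm.toMonoidHom (MulEquiv.injective _) u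
  have hpow : ∀ k : ℕ, σ ^ k ∈ F.fixingSubgroup ↔ orderOf (evalChar F u) ∣ k := by
    intro k
    rw [orderOf_dvd_iff_pow_eq_one, evalChar_pow, evalChar_eq_one_iff, map_pow]
  have hinf : MulAction.stabilizer Gal(K/ℚ) P ⊓ F.fixingSubgroup =
      Subgroup.zpowers (σ ^ orderOf (evalChar F u)) := by
    rw [hD]
    apply le_antisymm
    · rintro τ ⟨hτ1, hτ2⟩
      obtain ⟨k, rfl⟩ := (mem_powers_iff_mem_zpowers.mpr hτ1)
      obtain ⟨m, rfl⟩ := (hpow k).mp hτ2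
      exact ⟨m, by simp [pow_mul]⟩
    · rw [Subgroup.zpowers_le]
      exact ⟨⟨orderOf (evalChar F u), by simp⟩, (hpow _).mpr dvd_rfl⟩
  have hcard : Nat.card (MulAction.stabilizer Gal(K/F) P) =
      Nat.card (MulAction.stabilizer Gal(K/ℚ) P ⊓ F.fixingSubgroup : Subgroup Gal(K/ℚ)) := by
    symm
    refine Nat.card_congr ⟨fun τ ↦ ⟨F.fixingSubgroupEquiv ⟨τ.1, τ.2.2⟩, ?_⟩,
      fun τ ↦ ⟨(F.fixingSubgroupEquiv.symm τ.1).1, ?_, (F.fixingSubgroupEquiv.symm τ.1).2⟩,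
      fun τ ↦ ?_, fun τ ↦ ?_⟩
    · exact τ.2.1
    · exact τ.2
    · ext; simp
    · ext; simp
  rw [hcard, hinf, Nat.card_zpowers, ← hσo]
  have hdvd : orderOf (evalChar F u) ∣ orderOf σ := by
    rw [orderOf_dvd_iff_pow_eq_one, evalChar_pow, hσo, pow_orderOf_eq_one, evalChar_eq_one_iff,
      map_one]
    exact one_mem _
  have hpos : 0 < orderOf σ := orderOf_pos σ
  rw [orderOf_pow, Nat.gcd_eq_right hdvd, Nat.div_mul_cancel hdvd]

/-- Residue degrees multiply in `ℚ ⊆ F ⊆ K`. The total degree is the order of `ℓ` modulo `p`, and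
the degree over `F` is the order of the relative decomposition group, as `ℓ` is unramified. -/
theorem inertiaDeg_subfield (hn : ℓ.Coprime p) (P : Ideal (𝓞 F)) [P.IsPrime]
    [P.LiesOver (span {(ℓ : ℤ)})] :
    P.inertiaDeg ℤ = orderOf (evalChar F (ZMod.unitOfCoprime ℓ hn)) ∧ P.ramificationIdx ℤ = 1 := by
  have hndvd : ¬ ℓ ∣ p := (Nat.Prime.coprime_iff_not_dvd hℓ.out).mp hn
  obtain ⟨⟨Q, hQ1, hQ2⟩⟩ := P.nonempty_primesOver (S := 𝓞 K)
  have hQℓ : Q.LiesOver (span {(ℓ : ℤ)}) := LiesOver.trans Q P _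
  have hℓmax : (span {(ℓ : ℤ)}).IsMaximal := Int.ideal_span_isMaximal_of_prime ℓ
  have hQmax : Q.IsMaximal := .of_liesOver_isMaximal Q (span {(ℓ : ℤ)})
  have hPmax : P.IsMaximal := .of_liesOver_isMaximal P (span {(ℓ : ℤ)})
  have e1 := inertiaDeg_tower (R := ℤ) P Q
  have e2 := ramificationIdx_tower (R := ℤ) P Q
  rw [ramificationIdx_eq_of_not_dvd ℓ K Q hndvd] at e2
  have e4 := Nat.eq_one_of_mul_eq_one_left e2.symm
  have e3 := Nat.eq_one_of_mul_eq_one_right e2.symm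
  refine ⟨?_, e3⟩
  rw [inertiaDeg_eq_of_not_dvd ℓ K Q hndvd] at e1
  have hPbot : P ≠ ⊥ := Ideal.ne_bot_of_liesOver_of_ne_bot (p := span {(ℓ : ℤ)})
    (by simpa using hℓ.out.ne_zero) P
  have : Finite (𝓞 F ⧸ P) := Ring.HasFiniteQuotients.finiteQuotient hPbot
  have hcs := card_stabilizer_eq (G := Gal(K/F)) P Q
  rw [ramificationIdxIn_eq_ramificationIdx P Q Gal(K/F), inertiaDegIn_eq_inertiaDeg P Q Gal(K/F),
    e4, one_mul] at hcs
  have h3 := card_stabilizer_relative F hn Q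
  have h4 : orderOf (ℓ : ZMod p) = orderOf (ZMod.unitOfCoprime ℓ hn) := by
    rw [← orderOf_injective _ Units.coeHom_injective]; simp
  rw [h4, ← h3, hcs, mul_comm] at e1
  exact (Nat.eq_of_mul_eq_mul_right (inertiaDeg_pos Q (𝓞 F)) e1).symm

omit [IsAbelianGalois ℚ K] in
variable (p) in
theorem totallyRamified_subfield (P : Ideal (𝓞 F)) [P.IsPrime] [P.LiesOver (span {(p : ℤ)})] :
    P.inertiaDeg ℤ = 1 := by
  obtain ⟨⟨Q, hQ1, hQ2⟩⟩ := P.nonempty_primesOver (S := 𝓞 K)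
  have hQℓ : Q.LiesOver (span {(p : ℤ)}) := LiesOver.trans Q P _
  have e1 := inertiaDeg_tower (R := ℤ) P Q
  rw [inertiaDeg_eq_of_prime p K Q] at e1
  exact Nat.eq_one_of_mul_eq_one_right e1.symm

variable (p) in
theorem ncard_primesOver_subfield : (primesOver (span {(p : ℤ)}) (𝓞 F)).ncard = 1 := by
  have hA : IsAbelianGalois ℚ F := .of_algHom F.val
  have hG : IsGalois ℚ F := hA.toIsGalois
  obtain ⟨⟨P, hP1, hP2⟩⟩ := (span {(p : ℤ)}).nonempty_primesOver (S := 𝓞 F)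
  have := ncard_primesOver_mul_ncard_primesOver (p := span {(p : ℤ)}) P Gal(F/ℚ) (𝓞 K) Gal(K/ℚ)
  rw [ncard_primesOver_of_prime p K] at this
  exact Nat.eq_one_of_mul_eq_one_right this

variable (p) in
theorem ramificationIdx_subfield (P : Ideal (𝓞 F)) [P.IsPrime] [P.LiesOver (span {(p : ℤ)})] :
    P.ramificationIdx ℤ = Module.finrank ℚ F := by
  have hA : IsAbelianGalois ℚ F := .of_algHom F.val
  have hG : IsGalois ℚ F := hA.toIsGalois
  have h := ncard_primesOver_mul_ramificationIdxIn_mul_inertiaDegIn (span {(p : ℤ)}) (𝓞 F) Gal(F/ℚ)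
  rw [ncard_primesOver_subfield, ramificationIdxIn_eq_ramificationIdx _ P Gal(F/ℚ),
    inertiaDegIn_eq_inertiaDeg _ P Gal(F/ℚ), totallyRamified_subfield p, one_mul, mul_one,
    IsGalois.card_aut_eq_finrank] at h
  exact h

theorem ncard_primesOver_mul_subfield (hn : ℓ.Coprime p) :
    (primesOver (span {(ℓ : ℤ)}) (𝓞 F)).ncard * orderOf (evalChar F (ZMod.unitOfCoprime ℓ hn)) =
      Nat.card (fieldChars p F) := by
  have hA : IsAbelianGalois ℚ F := .of_algHom F.val
  have hG : IsGalois ℚ F := hA.toIsGalois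
  obtain ⟨⟨P, hP1, hP2⟩⟩ := (span {(ℓ : ℤ)}).nonempty_primesOver (S := 𝓞 F)
  have h := ncard_primesOver_mul_ramificationIdxIn_mul_inertiaDegIn (span {(ℓ : ℤ)}) (𝓞 F) Gal(F/ℚ)
  rw [ramificationIdxIn_eq_ramificationIdx _ P Gal(F/ℚ),
    inertiaDegIn_eq_inertiaDeg _ P Gal(F/ℚ), (inertiaDeg_subfield F hn P).1,
    (inertiaDeg_subfield F hn P).2, one_mul, IsGalois.card_aut_eq_finrank] at h
  rw [h, card_intermediateFieldEquivSubgroupChar]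

/-- With `g` primes of degree `f` above `ℓ`, the product `g * f` is the number of characters of `F`,
so `(1 - x ^ f) ^ g` factors over them. -/
theorem hasSum_idealCount_subfield [Fintype (fieldChars p F)] (hn : ℓ.Coprime p) {x : ℂ}
    (hx : ‖x‖ < 1) :
    HasSum (fun e : ℕ ↦ (idealCount F (ℓ ^ e) : ℂ) * x ^ e)
      (∏ χ : fieldChars p F, (1 - χ.1 ℓ * x))⁻¹ := by
  set u := ZMod.unitOfCoprime ℓ hn with hu
  have h1 : ∏ χ : fieldChars p F, (1 - χ.1 ℓ * x) = ∏ χ, (1 - (evalChar F u χ : ℂ) * x) := by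
    simp [coe_evalChar, hu]
  have hmul := ncard_primesOver_mul_subfield F hn
  rw [h1, prod_one_sub_char, ← hmul, Nat.mul_div_cancel _ (orderOf_hom_pos _)]
  refine hasSum_idealCount_prime_pow hℓ.out (fun P hP ↦ ?_) (orderOf_hom_pos _).ne' (fun h ↦ ?_)
    rfl hx
  · have := hP.1
    have := hP.2
    rw [← pow_inertiaDeg ℓ P, (inertiaDeg_subfield F hn P).1]
  · rw [h, zero_mul] at hmul
    exact Nat.card_pos.ne hmul

variable (p) in
theorem hasSum_idealCount_ramified {x : ℂ} (hx : ‖x‖ < 1) :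
    HasSum (fun e : ℕ ↦ (idealCount F (p ^ e) : ℂ) * x ^ e) (1 - x)⁻¹ := by
  have := hasSum_idealCount_prime_pow (F := F) (ℓ := p) (f := 1) hp.out (fun P hP ↦ ?_) one_ne_zero
    one_ne_zero (ncard_primesOver_subfield p F) hx
  · simpa using this
  · have := hP.1
    have := hP.2
    rw [← pow_inertiaDeg p P, totallyRamified_subfield p]

end AbelianLocal

/-! ### Euler product of the Dedekind zeta function -/

section EulerProduct

open NumberField Filter Topology

variable (F : Type*) [Field F] [NumberField F]

theorem tendsto_sum_idealCount_div :
    Tendsto (fun n : ℕ ↦ (∑ k ∈ Finset.Icc 1 n, (idealCount F k : ℝ)) / n) atTop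
      (𝓝 (dedekindZeta_residue F)) := by
  refine ((Ideal.tendsto_norm_le_div_atTop₀ F).comp tendsto_natCast_atTop_atTop).congr fun n ↦ ?_
  simp only [Function.comp_apply, Nat.cast_le, ← Nat.cast_sum]
  congr
  -- The density theorem counts nonzero ideals; adding the zero ideal, the only one of norm 0, to
  -- both sides turns the count into a sum over the norms `0, …, n`.
  rw [← add_left_inj 1, ← Ideal.card_norm_le_eq_card_norm_le_add_one,
    show Finset.Icc 1 n = Finset.Ioc 0 n from Finset.Icc_succ_left_eq_Ioc _ _,
    show 1 = idealCount F 0 by simp [idealCount, Ideal.absNorm_eq_zero_iff],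
    Finset.sum_Ioc_add_eq_sum_Icc (n.zero_le)]
  unfold idealCount
  rw [← Finset.card_preimage_eq_sum_card_image_eq
    (fun k _ ↦ Ideal.finite_setOfPred_absNorm_eq k)]
  simp [Set.coe_eq_subtype]

theorem lseriesSummable_idealCount {s : ℂ} (hs : 1 < s.re) :
    LSeriesSummable (fun n ↦ (idealCount F n : ℂ)) s := by
  have h : (fun n : ℕ ↦ ∑ k ∈ Finset.Icc 1 n, (idealCount F k : ℝ)) =O[atTop]
      fun n ↦ (n : ℝ) ^ (1 : ℝ) := by
    have h1 := (tendsto_sum_idealCount_div F).isBigO_one ℝ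
    have h2 := h1.mul (Asymptotics.isBigO_refl (fun n : ℕ ↦ (n : ℝ)) atTop)
    refine (h2.congr' ?_ ?_)
    · filter_upwards [eventually_ne_atTop 0] with n hn
      field_simp
    · filter_upwards with n
      simp
  exact_mod_cast LSeriesSummable_of_sum_norm_bigO_and_nonneg h (fun n ↦ Nat.cast_nonneg _)
    zero_le_one hs

theorem dedekindZeta_hasProd {s : ℂ} (hs : 1 < s.re) :
    HasProd (fun ℓ : Nat.Primes ↦ ∑' e : ℕ, (idealCount F (ℓ ^ e) : ℂ) * ((ℓ : ℂ) ^ (-s)) ^ e)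
      (dedekindZeta F s) := by
  have hs0 : s ≠ 0 := fun h ↦ by simp [h] at hs; linarith
  have hsum := lseriesSummable_idealCount F hs
  have key := EulerProduct.eulerProduct_hasProd
    (f := LSeries.term (fun n ↦ (idealCount F n : ℂ)) s) (by simp [idealCount_one]) ?_
    hsum.norm (by simp)
  · have hterm : ∀ (ℓ : Nat.Primes) (e : ℕ), LSeries.term (fun n ↦ (idealCount F n : ℂ)) s (ℓ ^ e) =
        (idealCount F (ℓ ^ e) : ℂ) * ((ℓ : ℂ) ^ (-s)) ^ e := by
      intro ℓ e
      rw [LSeries.term_of_ne_zero (pow_ne_zero _ ℓ.2.ne_zero), Complex.cpow_neg, inv_pow,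
        div_eq_mul_inv, Nat.cast_pow, ← Complex.natCast_cpow_natCast_mul, Complex.cpow_nat_mul]
    simp only [hterm] at key
    exact key
  · intro m n hmn
    rcases eq_or_ne m 0 with rfl | hm
    · simp at hmn; simp [hmn]
    rcases eq_or_ne n 0 with rfl | hn
    · simp at hmn; simp [hmn]
    rw [LSeries.term_of_ne_zero hm, LSeries.term_of_ne_zero hn,
      LSeries.term_of_ne_zero (mul_ne_zero hm hn), idealCount_mul F hmn hm hn, Nat.cast_mul,
      Nat.cast_mul, Complex.natCast_mul_natCast_cpow]
    rw [mul_div_mul_comm]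

end EulerProduct

/-! ### The residue as a product of values `L(1, χ)` -/

section ResidueFormula

open NumberField Filter Topology

variable (p : ℕ) [hp : Fact p.Prime] {K : Type*} [Field K] [NumberField K]
  [IsCyclotomicExtension {p} ℚ K] [IsAbelianGalois ℚ K] (F : IntermediateField ℚ K)

open scoped Classical in
-- The Euler factors agree prime by prime. The trivial character contributes the full Riemann zeta
-- function, factor at `p` included, because a single prime of degree one lies above `p`; there all
-- Dirichlet characters vanish.
theorem dedekindZeta_eq_prod [Fintype (fieldChars p F)] {s : ℂ} (hs : 1 < s.re) :
    dedekindZeta F s = riemannZeta s *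
      ∏ χ ∈ Finset.univ.erase (1 : fieldChars p F), DirichletCharacter.LFunction χ.1 s := by
  have h1 := dedekindZeta_hasProd F hs
  have h2 : HasProd (fun ℓ : Nat.Primes ↦ (1 - (ℓ : ℂ) ^ (-s))⁻¹ *
      ∏ χ ∈ Finset.univ.erase (1 : fieldChars p F), (1 - χ.1 ℓ * (ℓ : ℂ) ^ (-s))⁻¹)
      (riemannZeta s *
      ∏ χ ∈ Finset.univ.erase (1 : fieldChars p F), DirichletCharacter.LFunction χ.1 s) := by
    refine (riemannZeta_eulerProduct_hasProd hs).mul (hasProd_prod fun χ _ ↦ ?_)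
    rw [DirichletCharacter.LFunction_eq_LSeries _ hs]
    exact DirichletCharacter.LSeries_eulerProduct_hasProd χ.1 hs
  refine h1.unique ?_
  convert! h2 using 1
  ext ℓ
  have hℓ : Fact (ℓ : ℕ).Prime := ⟨ℓ.2⟩
  have hx : ‖((ℓ : ℕ) : ℂ) ^ (-s)‖ < 1 := by
    rw [Complex.norm_natCast_cpow_of_pos ℓ.2.pos, Complex.neg_re]
    exact Real.rpow_lt_one_of_one_lt_of_neg (by exact_mod_cast ℓ.2.one_lt) (by linarith)
  by_cases hpl : (ℓ : ℕ) = p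
  · rw [hpl] at hx ⊢
    rw [(hasSum_idealCount_ramified p F hx).tsum_eq]
    have h0 : ∀ χ : fieldChars p F, χ.1 ((p : ℕ) : ZMod p) = 0 := fun χ ↦ by
      rw [ZMod.natCast_self]; exact χ.1.map_nonunit not_isUnit_zero
    simp only [h0, zero_mul, sub_zero, inv_one, Finset.prod_const_one, mul_one]
  · have hn : (ℓ : ℕ).Coprime p := (Nat.coprime_primes ℓ.2 hp.out).mpr hpl
    rw [(hasSum_idealCount_subfield F hn hx).tsum_eq, ← Finset.prod_inv_distrib,
      ← Finset.mul_prod_erase _ _ (Finset.mem_univ (1 : fieldChars p F))]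
    congr 3
    have : IsUnit (((ℓ : ℕ) : ZMod p)) := (ZMod.isUnit_iff_coprime _ _).mpr hn
    rw [OneMemClass.coe_one, MulChar.one_apply this, one_mul]

open scoped Classical in
theorem dedekindZeta_residue_eq_prod [Fintype (fieldChars p F)] :
    (dedekindZeta_residue F : ℂ) =
      ∏ χ ∈ Finset.univ.erase (1 : fieldChars p F), DirichletCharacter.LFunction χ.1 1 := by
  have h1 := tendsto_sub_one_mul_dedekindZeta_nhdsGT F
  have hlim : Tendsto (fun s : ℝ ↦ (s : ℂ)) (𝓝[>] 1) (𝓝[≠] 1) := by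
    refine tendsto_nhdsWithin_of_tendsto_nhds_of_eventually_within _ ?_ ?_
    · exact (Complex.continuous_ofReal.tendsto' 1 1 (by simp)).mono_left nhdsWithin_le_nhds
    · filter_upwards [self_mem_nhdsWithin] with s hs
      have : (s : ℝ) ≠ 1 := ne_of_gt hs
      simpa using this
  have h2 : Tendsto (fun s : ℝ ↦ ((s : ℂ) - 1) * riemannZeta s *
      ∏ χ ∈ Finset.univ.erase (1 : fieldChars p F), DirichletCharacter.LFunction χ.1 s) (𝓝[>] 1)
      (𝓝 (1 * ∏ χ ∈ Finset.univ.erase (1 : fieldChars p F),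
        DirichletCharacter.LFunction χ.1 1)) := by
    refine (riemannZeta_residue_one.comp hlim).mul (tendsto_finsetProd _ fun χ hχ ↦ ?_)
    have hne : χ.1 ≠ 1 := fun h ↦ (Finset.ne_of_mem_erase hχ) (Subtype.ext h)
    exact ((DirichletCharacter.differentiable_LFunction hne).continuous.tendsto 1).comp
      (hlim.mono_right nhdsWithin_le_nhds)
  rw [one_mul] at h2
  refine tendsto_nhds_unique h1 (h2.congr' ?_)
  filter_upwards [self_mem_nhdsWithin] with s hs
  rw [dedekindZeta_eq_prod p F (by simpa using hs), mul_assoc]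

end ResidueFormula

/-! ### The power of `p` in the discriminant -/

section Discriminant

open Ideal NumberField

variable (p : ℕ) [hp : Fact p.Prime] {K : Type*} [Field K] [NumberField K]
  [IsCyclotomicExtension {p} ℚ K] [IsAbelianGalois ℚ K] (F : IntermediateField ℚ K)

/-- As `p` is totally ramified, the prime above it divides the different to the power `n - 1`; then
take norms. Divisibility suffices, since the index argument tolerates an unknown cofactor. -/
theorem pow_dvd_discr_subfield : p ^ (Module.finrank ℚ F - 1) ∣ (discr F).natAbs := by
  have hpmax : (span {(p : ℤ)}).IsMaximal := Int.ideal_span_isMaximal_of_prime p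
  have hp0 : span {(p : ℤ)} ≠ ⊥ := by simpa using hp.out.ne_zero
  obtain ⟨⟨P, hP1, hP2⟩⟩ := (span {(p : ℤ)}).nonempty_primesOver (S := 𝓞 F)
  have hle := le_pow_ramificationIdx' (p := span {(p : ℤ)}) (P := P)
  have hram : ramificationIdx' (span {(p : ℤ)}) P = Module.finrank ℚ F := by
    rw [ramificationIdx'_eq_ramificationIdx _ _ hp0, ramificationIdx_subfield p]
  rw [hram] at hle
  have h1 := pow_sub_one_dvd_differentIdeal ℤ P (Module.finrank ℚ F) hp0 (dvd_iff_le.mpr hle)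
  have h2 := absNorm_dvd_absNorm_of_le (dvd_iff_le.mp h1)
  rwa [absNorm_differentIdeal F, map_pow, ← pow_inertiaDeg p P, totallyRamified_subfield p,
    pow_one] at h2

end Discriminant

/-! ### Roots of unity in totally real fields -/

section TorsionOrder

open NumberField NumberField.Units

theorem torsionOrder_eq_two_of_isTotallyReal (F : Type*) [Field F] [NumberField F]
    [IsTotallyReal F] : torsionOrder F = 2 := by
  have key : ∀ x : torsion F, (x : (𝓞 F)ˣ) = 1 ∨ (x : (𝓞 F)ˣ) = -1 := by
    intro x
    by_cases! hc : 2 < orderOf (x : (𝓞 F)ˣ)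
    · have h0 : IsPrimitiveRoot (((x : (𝓞 F)ˣ) : 𝓞 F) : F) (orderOf (x : (𝓞 F)ˣ)) :=
        (IsPrimitiveRoot.coe_units_iff.mpr (IsPrimitiveRoot.orderOf _)).map_of_injective
          (FaithfulSMul.algebraMap_injective (𝓞 F) F)
      have h1 := InfinitePlace.IsPrimitiveRoot.nrRealPlaces_eq_zero_of_two_lt hc h0
      have h2 := IsTotallyReal.finrank F
      rw [h1] at h2
      exact absurd h2 (Module.finrank_pos).ne'
    · interval_cases hi : orderOf (x : (𝓞 F)ˣ)
      · linarith [orderOf_pos_iff.2 ((CommGroup.mem_torsion x.1).1 x.2)]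
      · exact Or.intro_left _ (orderOf_eq_one_iff.1 hi)
      · rw [← orderOf_units, CharP.orderOf_eq_two_iff 0 (by decide)] at hi
        simp [← Units.val_inj, Units.val_neg, Units.val_one, hi]
  apply le_antisymm
  · classical
    let := Fintype.ofFinite (torsion F)
    rw [torsionOrder, Nat.card_eq_fintype_card, ← Finset.card_univ]
    refine (Finset.card_le_card (t := {1, ⟨-1, neg_one_mem_torsion⟩}) fun x _ ↦ ?_).trans
      Finset.card_le_two
    rw [Finset.mem_insert, Finset.mem_singleton, ← Subtype.val_inj, ← Subtype.val_inj]
    exact key x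
  · exact Nat.le_of_dvd (torsionOrder_pos F) (even_torsionOrder F).two_dvd

end TorsionOrder

/-! ### The maximal real subfield and its characters -/

section RealSubfield

open NumberField IsCyclotomicExtension.Rat IntermediateField

variable {p : ℕ} [hp : Fact p.Prime] {K : Type*} [Field K] [NumberField K]
  [IsCyclotomicExtension {p} ℚ K] [IsAbelianGalois ℚ K] {ζ : K} (hζ : IsPrimitiveRoot ζ p)

include hζ

lemma galEquivZMod_symm_apply_zeta (u : (ZMod p)ˣ) :
    (galEquivZMod p K).symm u ζ = ζ ^ (u : ZMod p).val := by
  rw [galEquivZMod_apply_of_pow_eq p K _ hζ.pow_eq_one, MulEquiv.apply_symm_apply]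

lemma mem_fixingSubgroup_real_iff (σ : Gal(K/ℚ)) :
    σ ∈ (ℚ⟮ζ + ζ⁻¹⟯).fixingSubgroup ↔ galEquivZMod p K σ = 1 ∨ galEquivZMod p K σ = -1 := by
  have hζ0 : ζ ≠ 0 := hζ.ne_zero hp.out.ne_zero
  have hσζ0 : σ ζ ≠ 0 := by simpa using hζ0
  have hinj : ∀ u v : (ZMod p)ˣ, (galEquivZMod p K).symm u ζ = (galEquivZMod p K).symm v ζ →
      u = v := by
    intro u v h
    rw [galEquivZMod_symm_apply_zeta hζ, galEquivZMod_symm_apply_zeta hζ] at h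
    have := hζ.pow_inj (ZMod.val_lt _) (ZMod.val_lt _) h
    exact Units.ext (ZMod.val_injective p this)
  have hneg : (galEquivZMod p K).symm (-1) ζ = ζ⁻¹ := by
    rw [galEquivZMod_symm_apply_zeta hζ]
    apply eq_inv_of_mul_eq_one_left
    rw [← pow_succ, hζ.pow_eq_one_iff_dvd, ← ZMod.natCast_eq_zero_iff]
    simp
  have h1 : σ ∈ (ℚ⟮ζ + ζ⁻¹⟯).fixingSubgroup ↔ σ (ζ + ζ⁻¹) = ζ + ζ⁻¹ := by
    constructor
    · intro h
      exact (mem_fixingSubgroup_iff _ _).mp h _ (mem_adjoin_simple_self ℚ _)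
    · intro h
      rw [← Subgroup.zpowers_le, ← IntermediateField.le_iff_le, adjoin_simple_le_iff]
      rintro ⟨τ, n, rfl⟩
      have : ∀ n : ℤ, (σ ^ n) • (ζ + ζ⁻¹) = ζ + ζ⁻¹ := fun n ↦
        (MulAction.mem_stabilizer_iff).mp (Subgroup.zpow_mem _
          (MulAction.mem_stabilizer_iff.mpr h : σ ∈ MulAction.stabilizer _ (ζ + ζ⁻¹)) n)
      exact this n
  have hσ : (galEquivZMod p K).symm (galEquivZMod p K σ) = σ := MulEquiv.symm_apply_apply _ _
  rw [h1, map_add, map_inv₀]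
  constructor
  · intro h
    -- A number and its inverse are determined, up to exchange, by their sum.
    have h2 : (σ ζ - ζ) * (σ ζ - ζ⁻¹) = 0 := by
      field_simp at h
      have : (σ ζ - ζ) * (σ ζ * ζ - 1) = 0 := by linear_combination h
      field_simp
      simpa using this
    rcases mul_eq_zero.mp h2 with h3 | h3
    · left
      apply hinj
      rw [hσ, map_one, sub_eq_zero.mp h3]; rfl
    · right
      apply hinj
      rw [hσ, hneg, sub_eq_zero.mp h3]
  · rintro (h | h)
    · rw [h, map_one] at hσ
      rw [← hσ]; rfl
    · rw [h] at hσ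
      rw [← hσ, hneg, inv_inv, add_comm]

theorem mem_fieldChars_real_iff (χ : DirichletCharacter ℂ p) :
    χ ∈ fieldChars p (ℚ⟮ζ + ζ⁻¹⟯) ↔ χ.Even := by
  rw [fieldChars, mem_intermediateFieldEquivSubgroupChar_iff]
  constructor
  · intro h
    have := h ((galEquivZMod p K).symm (-1))
      ((mem_fixingSubgroup_real_iff hζ _).mpr (Or.inr (by simp only [MulEquiv.apply_symm_apply])))
    rw [MulEquiv.apply_symm_apply] at this
    exact (by simpa using this : χ (-1) = 1)
  · intro h σ hσ
    have h' : χ (-1) = 1 := h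
    rcases (mem_fixingSubgroup_real_iff hζ σ).mp hσ with h1 | h1
    · rw [h1]; simp
    · rw [h1]; simpa using h'

theorem finrank_real_top (hp2 : p ≠ 2) : Module.finrank (ℚ⟮ζ + ζ⁻¹⟯) K = 2 := by
  have hG : IsGalois ℚ K := IsAbelianGalois.toIsGalois
  rw [← IsGalois.card_fixingSubgroup_eq_finrank]
  have h1 : ((ℚ⟮ζ + ζ⁻¹⟯).fixingSubgroup : Set Gal(K/ℚ)) =
      {(galEquivZMod p K).symm 1, (galEquivZMod p K).symm (-1)} := by
    ext σ
    rw [SetLike.mem_coe, mem_fixingSubgroup_real_iff hζ]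
    simp only [Set.mem_insert_iff, Set.mem_singleton_iff, MulEquiv.eq_symm_apply]
  rw [← SetLike.coe_sort_coe, h1, Nat.card_coe_set_eq, Set.ncard_pair]
  intro h
  have h2 := (galEquivZMod p K).symm.injective h
  have : Fact (2 < p) := ⟨lt_of_le_of_ne hp.out.two_le (Ne.symm hp2)⟩
  exact ZMod.neg_one_ne_one (congrArg Units.val h2).symm

theorem finrank_real (hp2 : p ≠ 2) : Module.finrank ℚ (ℚ⟮ζ + ζ⁻¹⟯) = (p - 1) / 2 := by
  have h1 := Module.finrank_mul_finrank ℚ (ℚ⟮ζ + ζ⁻¹⟯) K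
  rw [finrank_real_top hζ hp2, IsCyclotomicExtension.Rat.finrank p K, Nat.totient_prime hp.out] at h1
  omega

omit [IsAbelianGalois ℚ K] in
theorem real_le_maximalRealSubfield : (ℚ⟮ζ + ζ⁻¹⟯).toSubfield ≤ maximalRealSubfield K := by
  let M : IntermediateField ℚ K := (maximalRealSubfield K).toIntermediateField fun q ↦ by
    intro φ; simp
  suffices ℚ⟮ζ + ζ⁻¹⟯ ≤ M from this
  rw [adjoin_simple_le_iff]
  intro φ
  have h : star (φ ζ) = (φ ζ)⁻¹ := by
    have hn : ‖φ ζ‖ = 1 := (hζ.map_of_injective φ.injective).norm'_eq_one hp.out.ne_zero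
    exact (Complex.inv_eq_conj hn).symm
  rw [map_add, map_inv₀, star_add, star_inv₀, h, inv_inv, add_comm]

theorem real_eq_maximalRealSubfield [IsCMField K] (hp2 : p ≠ 2) :
    (ℚ⟮ζ + ζ⁻¹⟯).toSubfield = maximalRealSubfield K := by
  let M : IntermediateField ℚ K := (maximalRealSubfield K).toIntermediateField fun q ↦ by
    intro φ; simp
  have hle : ℚ⟮ζ + ζ⁻¹⟯ ≤ M := real_le_maximalRealSubfield hζ
  have h2 : Module.finrank M K = 2 := Algebra.IsQuadraticExtension.finrank_eq_two
    (maximalRealSubfield K) K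
  have : ℚ⟮ζ + ζ⁻¹⟯ = M := eq_of_le_of_finrank_le' hle (by rw [h2, finrank_real_top hζ hp2])
  rw [this]; rfl

omit hζ in
lemma regulator_eq_of_subfield_eq {E E' : Subfield K} (h : E = E') :
    Units.regulator E = Units.regulator E' := by
  subst h; rfl

omit hζ in
lemma isTotallyReal_of_subfield_eq {E E' : Subfield K} (h : E = E') [IsTotallyReal E'] :
    IsTotallyReal E := by
  subst h; assumption

theorem regulator_real [IsCMField K] (hp2 : p ≠ 2) :
    Units.regulator (ℚ⟮ζ + ζ⁻¹⟯) = Units.regulator (maximalRealSubfield K) :=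
  regulator_eq_of_subfield_eq (real_eq_maximalRealSubfield hζ hp2)

theorem isTotallyReal_real [IsCMField K] (hp2 : p ≠ 2) : IsTotallyReal (ℚ⟮ζ + ζ⁻¹⟯) :=
  isTotallyReal_of_subfield_eq (real_eq_maximalRealSubfield hζ hp2)

end RealSubfield

/-! ### A determinant over a half-system of residues -/

section GroupDeterminant

open Matrix

/-- If the rows of `X` are orthogonal of the same nonzero length and `A` maps each row of `X` to a
multiple of its complex conjugate, then `det A` is, up to a common phase, the product of the
multipliers. -/
theorem exists_phase_det_eq_prod {ι E : Type*} [Fintype ι] [DecidableEq ι] [Fintype E]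
    [DecidableEq E] (e : ι ≃ E) (X : Matrix E ι ℂ) {c : ℂ} (hc : c ≠ 0)
    (hX : ∀ χ ψ, ∑ i, X χ i * star (X ψ i) = if χ = ψ then c else 0) :
    ∃ κ : ℂ, ‖κ‖ = 1 ∧ ∀ (A : Matrix ι ι ℂ) (T : E → ℂ),
      (∀ χ j, ∑ i, X χ i * A i j = T χ * star (X χ j)) → A.det = κ * ∏ χ, T χ := by
  set Y : Matrix ι ι ℂ := X.submatrix e id with hY
  have hYY : Y * Yᴴ = c • (1 : Matrix ι ι ℂ) := by
    ext i j
    simp only [mul_apply, conjTranspose_apply, hY, submatrix_apply, id, Matrix.smul_apply, smul_eq_mul,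
      hX, Matrix.one_apply, EmbeddingLike.apply_eq_iff_eq]
    split_ifs <;> simp
  have hdet : Y.det ≠ 0 := by
    intro h
    have := congrArg det hYY
    rw [det_mul, h, zero_mul, det_smul, det_one, mul_one] at this
    exact pow_ne_zero _ hc this.symm
  refine ⟨star Y.det / Y.det, by rw [norm_div, norm_star, div_self (norm_ne_zero_iff.mpr hdet)],
    fun A T h ↦ ?_⟩
  have h1 : Y * A = diagonal (T ∘ e) * Yᴴᵀ := by
    ext i j
    rw [diagonal_mul, mul_apply]
    exact h (e i) j
  have h2 := congrArg det h1
  rw [det_mul, det_mul, det_diagonal, det_transpose, det_conjTranspose] at h2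
  rw [← Equiv.prod_comp e]
  field_simp
  simp only [Function.comp_apply] at h2
  linear_combination h2

theorem ZMod.sum_eq_two_mul_sum_half {p : ℕ} [NeZero p] {r : ℕ} (hr : p = 2 * r + 1) {M : Type*}
    [CommRing M] (g : ZMod p → M) (h0 : g 0 = 0) (hg : ∀ a, g (-a) = g a) :
    ∑ a, g a = 2 * ∑ i : Fin r, g ((i : ℕ) + 1) := by
  have h1 : ∑ a, g a = ∑ k ∈ Finset.range p, g k := by
    refine Finset.sum_bij' (fun a _ ↦ a.val) (fun k _ ↦ (k : ZMod p)) ?_ ?_ ?_ ?_ ?_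
    · intro a _; exact Finset.mem_range.mpr (ZMod.val_lt a)
    · intros; exact Finset.mem_univ _
    · intro a _; simp
    · intro k hk; exact ZMod.val_cast_of_lt (Finset.mem_range.mp hk)
    · intro a _; simp
  -- The index on the left is `p - (x + 1)`: the upper half of the residues is the reflection of the
  -- lower half.
  have h2 : ∀ x ∈ Finset.range r, g (((r + (r - 1 - x) : ℕ) + 1 : ℕ) : ZMod p) =
      g ((x + 1 : ℕ) : ZMod p) := by
    intro x hx
    have hx' := Finset.mem_range.mp hx
    rw [← hg]
    congr 1
    rw [neg_eq_iff_add_eq_zero, ← Nat.cast_add, ZMod.natCast_eq_zero_iff]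
    exact ⟨1, by omega⟩
  rw [h1, show Finset.range p = Finset.range (r + r + 1) by rw [hr]; congr 1; omega,
    Finset.sum_range_succ', Nat.cast_zero, h0, add_zero, Finset.sum_range_add,
    ← Finset.sum_range_reflect (fun x ↦ g ((r + x + 1 : ℕ) : ZMod p)), Finset.sum_congr rfl h2,
    ← two_mul, ← Fin.sum_univ_eq_sum_range (fun x ↦ g ((x + 1 : ℕ) : ZMod p))]
  simp

variable {p : ℕ} [hp : Fact p.Prime] {r : ℕ} (hr : p = 2 * r + 1)

include hr

lemma half_ne_zero (i : Fin r) : ((i : ℕ) + 1 : ZMod p) ≠ 0 := by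
  have : (((i : ℕ) + 1 : ℕ) : ZMod p) ≠ 0 := by
    rw [Ne, ZMod.natCast_eq_zero_iff]
    exact Nat.not_dvd_of_pos_of_lt (by omega) (by omega)
  exact_mod_cast this

theorem ZMod.sum_half_mul {M : Type*} [Field M] [CharZero M] (g : ZMod p → M) (h0 : g 0 = 0)
    (hg : ∀ a, g (-a) = g a) {b : ZMod p} (hb : b ≠ 0) :
    ∑ i : Fin r, g (((i : ℕ) + 1) * b) = ∑ i : Fin r, g ((i : ℕ) + 1) := by
  have h1 := ZMod.sum_eq_two_mul_sum_half hr g h0 hg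
  have h2 := ZMod.sum_eq_two_mul_sum_half hr (fun a ↦ g (a * b)) (by simpa using h0)
    (fun a ↦ by rw [neg_mul, hg])
  rw [← Equiv.sum_comp (Equiv.mulRight₀ b hb)] at h1
  exact mul_left_cancel₀ two_ne_zero (h2.symm.trans h1)

/-- The sum of the values of an even Dirichlet character over a half-system. -/
theorem sum_half_even_char {χ : DirichletCharacter ℂ p} (he : χ.Even) :
    ∑ i : Fin r, χ ((i : ℕ) + 1) = if χ = 1 then (r : ℂ) else 0 := by
  split_ifs with h
  · subst h
    rw [Finset.sum_congr rfl fun i _ ↦ MulChar.one_apply (half_ne_zero hr i).isUnit]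
    simp
  · have h1 := ZMod.sum_eq_two_mul_sum_half hr χ (MulChar.map_zero χ) (fun a ↦ he.eval_neg χ a)
    rw [MulChar.sum_eq_zero_of_ne_one h] at h1
    exact (mul_eq_zero.mp h1.symm).resolve_left two_ne_zero

/-- The matrix with entries `f (a * b) + c` takes each even character to a multiple of its
conjugate, so its determinant is, up to a phase, the product of the multipliers. Only the multiplier
of the trivial character depends on `c`, growing by `r * c`. The determinant is thus affine in `c`,
and its slope is the determinant with a row of ones. -/
theorem det_half_system {E : Subgroup (DirichletCharacter ℂ p)} (hE : ∀ χ, χ ∈ E ↔ χ.Even)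
    [Fintype E] (hcard : Fintype.card E = r) (f : ZMod p → ℝ) (hf0 : f 0 = 0)
    (hf : ∀ a, f (-a) = f a) (hr0 : 0 < r) :
    open scoped Classical in
    |(Matrix.of fun i j : Fin r ↦ if (i : ℕ) = 0 then (1 : ℝ) else
      f (((i : ℕ) + 1) * ((j : ℕ) + 1)) - f ((j : ℕ) + 1)).det| =
      r * ∏ χ ∈ Finset.univ.erase (1 : E), ‖∑ i : Fin r, χ.1 ((i : ℕ) + 1) * f ((i : ℕ) + 1)‖ := by
  classical
  have : NeZero r := ⟨hr0.ne'⟩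
  have hrC : (r : ℂ) ≠ 0 := by exact_mod_cast hr0.ne'
  let e : Fin r ≃ E := Fintype.equivOfCardEq (by simp [hcard])
  let X : Matrix E (Fin r) ℂ := Matrix.of fun χ i ↦ χ.1 ((i : ℕ) + 1)
  let S : E → ℂ := fun χ ↦ ∑ i : Fin r, χ.1 ((i : ℕ) + 1) * f ((i : ℕ) + 1)
  have hX : ∀ χ ψ, ∑ i, X χ i * star (X ψ i) = if χ = ψ then (r : ℂ) else 0 := by
    intro χ ψ
    have h := sum_half_even_char hr ((hE _).mp (χ * ψ⁻¹).2)
    simp only [Subgroup.coe_mul, Subgroup.coe_inv, MulChar.mul_apply, ← MulChar.star_apply'] at h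
    have h2 : (χ.1 * (ψ.1)⁻¹ = 1) ↔ χ = ψ := by rw [mul_inv_eq_one, Subtype.coe_inj]
    simp only [X, Matrix.of_apply]
    rw [h]
    simp only [h2]
  obtain ⟨κ, hκ, hdet⟩ := exists_phase_det_eq_prod e X hrC hX
  let A : ℂ → Matrix (Fin r) (Fin r) ℂ := fun c ↦
    Matrix.of fun i j ↦ ((f (((i : ℕ) + 1) * ((j : ℕ) + 1)) : ℝ) : ℂ) + c
  have hA : ∀ c, (A c).det = κ * ∏ χ, (S χ + c * if χ = 1 then (r : ℂ) else 0) := by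
    intro c
    apply hdet
    intro χ j
    have hj := half_ne_zero hr j
    have heven := (hE _).mp χ.2
    have hunit : χ.1 ((j : ℕ) + 1) * star (χ.1 ((j : ℕ) + 1)) = 1 := by
      rw [MulChar.star_apply', ← MulChar.mul_apply, mul_inv_cancel, MulChar.one_apply hj.isUnit]
    have h1 := ZMod.sum_half_mul hr (fun a ↦ χ.1 a * (f a : ℂ)) (by simp [hf0])
      (fun a ↦ by rw [heven.eval_neg χ.1, hf]) hj
    simp only [map_mul] at h1
    simp only [X, A, Matrix.of_apply]
    rw [Finset.sum_congr rfl fun i _ ↦ mul_add _ _ _, Finset.sum_add_distrib, ← Finset.sum_mul,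
      sum_half_even_char hr heven, add_mul]
    congr 1
    · simp only [S]
      rw [← h1, Finset.sum_mul]
      refine Finset.sum_congr rfl fun i _ ↦ ?_
      generalize f (((i : ℕ) + 1) * ((j : ℕ) + 1)) = y
      linear_combination -(χ.1 ((i : ℕ) + 1)) * (y : ℂ) * hunit
    · have h2 : (χ.1 = 1) ↔ χ = 1 := by rw [← Subgroup.coe_one, Subtype.coe_inj]
      simp only [h2]
      split_ifs with h3
      · rw [h3, Subgroup.coe_one, MulChar.one_apply hj.isUnit]; simp; ring
      · simp
  let B : Matrix (Fin r) (Fin r) ℂ := Matrix.of fun i j ↦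
    ((f (((i : ℕ) + 1) * ((j : ℕ) + 1)) : ℝ) : ℂ) - f ((j : ℕ) + 1)
  -- Subtracting the row of index 0 from the others removes `c` from them.
  have hupd : ∀ c, (A c).det = (B.updateRow 0 fun j ↦ (f ((j : ℕ) + 1) : ℂ) + c).det := by
    intro c
    refine Matrix.det_eq_of_forall_row_eq_smul_add_const (fun i ↦ if i = 0 then 0 else 1) 0
      (by simp) fun i j ↦ ?_
    by_cases hi : i = 0
    · subst hi; simp [A]
    · simp [hi, A, B]
      ring_nf
  -- Linearity in the row of index 0: the rows for `c = 1` and `c = 0` differ by the row of ones.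
  have hsplit : (B.updateRow 0 fun _ ↦ (1 : ℂ)).det = (A 1).det - (A 0).det := by
    rw [hupd, hupd, eq_sub_iff_add_eq', ← Matrix.det_updateRow_add]
    simp only [add_zero]
    rfl
  have hM : ((Matrix.of fun i j : Fin r ↦ if (i : ℕ) = 0 then (1 : ℝ) else
      f (((i : ℕ) + 1) * ((j : ℕ) + 1)) - f ((j : ℕ) + 1)).map Complex.ofReal) =
      B.updateRow 0 fun _ ↦ (1 : ℂ) := by
    ext i j
    rw [Matrix.updateRow_apply]
    simp only [Matrix.map_apply, Matrix.of_apply, B, Fin.ext_iff, Fin.val_zero]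
    split_ifs <;> simp
  have hfin : (B.updateRow 0 fun _ ↦ (1 : ℂ)).det =
      κ * (r * ∏ χ ∈ Finset.univ.erase (1 : E), S χ) := by
    rw [hsplit, hA, hA, ← Finset.mul_prod_erase _ _ (Finset.mem_univ (1 : E)),
      ← Finset.mul_prod_erase _ _ (Finset.mem_univ (1 : E))]
    have h3 : ∀ c : ℂ, ∏ χ ∈ Finset.univ.erase (1 : E), (S χ + c * if χ = 1 then (r : ℂ) else 0) =
        ∏ χ ∈ Finset.univ.erase (1 : E), S χ := fun c ↦
      Finset.prod_congr rfl fun χ hχ ↦ by rw [if_neg (Finset.ne_of_mem_erase hχ)]; simp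
    rw [h3, h3]
    simp only [if_true]
    ring
  rw [← Real.norm_eq_abs, ← Complex.norm_real, ← Complex.ofRealHom_eq_coe, RingHom.map_det]
  change ‖((Matrix.of _).map Complex.ofReal).det‖ = _
  rw [hM, hfin, norm_mul, hκ, one_mul, norm_mul, norm_prod, Complex.norm_natCast]

end GroupDeterminant

/-! ### The regulator of the cyclotomic units -/

section CyclotomicUnits

open NumberField NumberField.Units InfinitePlace Module

variable {p : ℕ} [hp : Fact p.Prime] {r : ℕ} (hr : p = 2 * r + 1)
  {K : Type*} [Field K] [NumberField K] [IsCyclotomicExtension {p} ℚ K]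
  {η : K} (hη : IsPrimitiveRoot η p)

include hr hη

omit [IsCyclotomicExtension {p} ℚ K] in
theorem exists_cyclotomicUnits :
    ∃ v : Fin r → (𝓞 K)ˣ, ∀ i, (1 - η) * ((v i : 𝓞 K) : K) = 1 - η ^ ((i : ℕ) + 1) := by
  have h : ∀ i : Fin r, ∃ v : (𝓞 K)ˣ, (1 - η) * ((v : 𝓞 K) : K) = 1 - η ^ ((i : ℕ) + 1) := by
    intro i
    have hc : ((i : ℕ) + 1).Coprime p :=
      (Nat.coprime_of_lt_prime (by omega) (by omega) hp.out).symm
    refine ⟨(hη.toInteger_isPrimitiveRoot.geom_sum_isUnit hp.out.two_le hc).unit, ?_⟩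
    rw [IsUnit.unit_spec]
    change (1 - η) * algebraMap (𝓞 K) K _ = _
    rw [map_sum]
    simp only [map_pow]
    exact mul_neg_geom_sum η _
  exact ⟨fun i ↦ (h i).choose, fun i ↦ (h i).choose_spec⟩

omit hr in
theorem exists_embedding {a : ZMod p} (ha : a ≠ 0) :
    ∃ φ : K →+* ℂ, φ η = ZMod.stdAddChar a := by
  have hprim : IsPrimitiveRoot (ZMod.stdAddChar a : ℂ) p := by
    rw [IsPrimitiveRoot.iff_orderOf]
    refine orderOf_eq_prime (p := p) ?_ (stdAddChar_ne_one (p := p) ha)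
    rw [← AddChar.map_nsmul_eq_pow]
    simp
  let φ := (hη.embeddingsEquivPrimitiveRoots ℂ
    (Polynomial.cyclotomic.irreducible_rat hp.out.pos)).symm
      ⟨_, (mem_primitiveRoots hp.out.pos).mpr hprim⟩
  refine ⟨φ, ?_⟩
  have h1 := congrArg Subtype.val ((hη.embeddingsEquivPrimitiveRoots ℂ
    (Polynomial.cyclotomic.irreducible_rat hp.out.pos)).apply_symm_apply
      ⟨_, (mem_primitiveRoots hp.out.pos).mpr hprim⟩)
  rwa [IsPrimitiveRoot.embeddingsEquivPrimitiveRoots_apply_coe] at h1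

theorem card_infinitePlace_cyclotomic : Fintype.card (InfinitePlace K) = r := by
  have h2 := hp.out.two_le
  rw [card_eq_nrRealPlaces_add_nrComplexPlaces,
    IsCyclotomicExtension.Rat.nrRealPlaces_eq_zero K (n := p) (by omega),
    IsCyclotomicExtension.Rat.nrComplexPlaces_eq_totient_div_two p, Nat.totient_prime hp.out]
  omega

/-- The embeddings attached to the residues `a` and `-a` are conjugate, so the places are indexed by
`1, …, r`. Distinct indices give distinct places because the sum of two of them lies strictly
between 0 and `p`. -/
theorem exists_equiv_infinitePlace :
    ∃ W : Fin r ≃ InfinitePlace K, ∀ (i : Fin r) (k : ℕ),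
      W i (1 - η ^ k) = ‖1 - ZMod.stdAddChar (((i : ℕ) + 1) * k : ZMod p)‖ := by
  choose φ hφ using fun i : Fin r ↦ exists_embedding hη (half_ne_zero hr i)
  have hinj : Function.Injective fun i ↦ InfinitePlace.mk (φ i) := by
    intro i j hij
    have hcases : (ZMod.stdAddChar ((i : ℕ) + 1 : ZMod p)) = ZMod.stdAddChar ((j : ℕ) + 1 : ZMod p) ∨
        (ZMod.stdAddChar (-((i : ℕ) + 1) : ZMod p)) = ZMod.stdAddChar ((j : ℕ) + 1 : ZMod p) := by
      rcases mk_eq_iff.mp hij with h | h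
      · left
        rw [← hφ, ← hφ, h]
      · right
        rw [← hφ, ← h, ComplexEmbedding.conjugate_coe_eq, hφ, AddChar.map_neg_eq_inv,
          Complex.inv_eq_conj (norm_stdAddChar _)]
    rcases hcases with h | h
    · have h1 := ZMod.injective_stdAddChar h
      have h2 : (((i : ℕ) + 1 : ℕ) : ZMod p) = ((j : ℕ) + 1 : ℕ) := by exact_mod_cast h1
      rw [ZMod.natCast_eq_natCast_iff', Nat.mod_eq_of_lt (by omega), Nat.mod_eq_of_lt (by omega)] at h2
      exact Fin.ext (by omega)
    · have h1 := ZMod.injective_stdAddChar h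
      rw [neg_eq_iff_add_eq_zero] at h1
      have h2 : (((i : ℕ) + 1 + ((j : ℕ) + 1) : ℕ) : ZMod p) = 0 := by exact_mod_cast h1
      rw [ZMod.natCast_eq_zero_iff] at h2
      exact absurd h2 (Nat.not_dvd_of_pos_of_lt (by omega) (by omega))
  have hbij : Function.Bijective fun i ↦ InfinitePlace.mk (φ i) := by
    rw [Fintype.bijective_iff_injective_and_card]
    exact ⟨hinj, by rw [card_infinitePlace_cyclotomic hr hη, Fintype.card_fin]⟩
  refine ⟨Equiv.ofBijective _ hbij, fun i k ↦ ?_⟩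
  rw [Equiv.ofBijective_apply, InfinitePlace.apply, map_sub, map_one, map_pow, hφ,
    ← AddChar.map_nsmul_eq_pow, nsmul_eq_mul, mul_comm]

theorem regOfFamily_cyclotomicUnits {v : Fin r → (𝓞 K)ˣ}
    (hv : ∀ i, (1 - η) * ((v i : 𝓞 K) : K) = 1 - η ^ ((i : ℕ) + 1))
    (ι : Fin (rank K) ≃ {j : Fin r // (j : ℕ) ≠ 0})
    {E : Subgroup (DirichletCharacter ℂ p)} (hE : ∀ χ, χ ∈ E ↔ χ.Even)
    [Fintype E] (hcard : Fintype.card E = r) :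
    open scoped Classical in
    regOfFamily (fun k ↦ v (ι k)) = 2 ^ (r - 1) * ∏ χ ∈ Finset.univ.erase (1 : E),
      ‖∑ i : Fin r, χ.1 ((i : ℕ) + 1) * (Real.log ‖1 - ZMod.stdAddChar ((i : ℕ) + 1 : ZMod p)‖ : ℝ)‖ := by
  classical
  have h2 := hp.out.two_le
  have hr0 : 0 < r := by omega
  obtain ⟨W, hW⟩ := exists_equiv_infinitePlace hr hη
  have : NeZero r := ⟨hr0.ne'⟩
  -- The discarded unit `v 0 = 1` frees the row of index 0; the distinguished place `W 0` fills it
  -- with the constant multiplicity.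
  let w' := W 0
  let e : {w // w ≠ w'} ≃ Fin (rank K) :=
    (W.symm.subtypeEquiv fun w ↦ by
      rw [Ne, Ne, ← Fin.val_zero r, Fin.val_inj, Equiv.symm_apply_eq]).trans ι.symm
  have hdet := finrank_mul_regOfFamily_eq_det (fun k ↦ v (ι k)) w' e
  set f : ZMod p → ℝ := fun a ↦ Real.log ‖1 - ZMod.stdAddChar a‖ with hf
  have hfneg : ∀ a, f (-a) = f a := by
    intro a
    simp only [hf]
    rw [AddChar.map_neg_eq_inv, Complex.inv_eq_conj (norm_stdAddChar _), ← Complex.norm_conj, map_sub,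
      map_one, Complex.conj_conj]
  have hkey := det_half_system hr hE hcard f (by simp [hf]) hfneg hr0
  have hη1 : (1 : K) - η ≠ 0 := sub_ne_zero.mpr (hη.ne_one hp.out.one_lt).symm
  have hlog : ∀ (i j : Fin r), Real.log (W j (v i : 𝓞 K)) =
      f (((i : ℕ) + 1) * ((j : ℕ) + 1)) - f ((j : ℕ) + 1) := by
    intro i j
    have h1 := hW j ((i : ℕ) + 1)
    have h3 := hW j 1
    rw [← hv, map_mul] at h1
    rw [pow_one] at h3
    have h4 : Real.log (W j (1 - η)) = f ((j : ℕ) + 1) := by rw [h3]; simp [hf]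
    have h5 : W j (1 - η) ≠ 0 := by simpa using hη1
    have h6 : W j ((v i : 𝓞 K) : K) ≠ 0 := by simp
    have h7 := congrArg Real.log h1
    rw [Real.log_mul h5 h6, h4] at h7
    rw [eq_sub_iff_add_eq', h7]
    simp only [hf]
    push_cast
    rw [mul_comm]
  have hmult : ∀ w : InfinitePlace K, (w.mult : ℝ) = 2 := by
    intro w
    have := IsCyclotomicExtension.Rat.isTotallyComplex K (n := p) (by omega)
    simp [IsTotallyComplex.mult_eq]
  have hmat : (Matrix.of (fun i w : InfinitePlace K ↦ if h : i = w' then (w.mult : ℝ) else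
      w.mult * (w (v (ι (e ⟨i, h⟩)) : 𝓞 K)).log)) =
      ((2 : ℝ) • (Matrix.of fun i j : Fin r ↦ if (i : ℕ) = 0 then (1 : ℝ) else
        f (((i : ℕ) + 1) * ((j : ℕ) + 1)) - f ((j : ℕ) + 1))).submatrix W.symm W.symm := by
    ext i w
    obtain ⟨i, rfl⟩ := W.surjective i
    obtain ⟨j, rfl⟩ := W.surjective w
    simp only [Matrix.of_apply, Matrix.submatrix_apply, Matrix.smul_apply, Equiv.symm_apply_apply,
      smul_eq_mul, hmult]
    by_cases hi : i = 0
    · subst hi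
      simp [w']
    · have hi' : (i : ℕ) ≠ 0 := fun h ↦ hi (Fin.ext h)
      have hi2 : ¬ W i = w' := fun h ↦ hi (W.injective h)
      rw [dif_neg hi2, if_neg hi', ← hlog]
      simp [e]
  rw [hmat, Matrix.det_submatrix_equiv_self, Matrix.det_smul, abs_mul, hkey, Fintype.card_fin,
    IsCyclotomicExtension.Rat.finrank p K, Nat.totient_prime hp.out, abs_of_pos (by positivity)] at hdet
  -- The degree `2 * r` cancels the factor `r` of the determinant and one of the `r` factors 2 from
  -- scaling the matrix, leaving `2 ^ (r - 1)`.
  have h3 : ((p - 1 : ℕ) : ℝ) = 2 * r := by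
    rw [hr]; push_cast; simp
  rw [h3] at hdet
  have hrR : (2 * r : ℝ) ≠ 0 := by positivity
  refine mul_left_cancel₀ hrR (hdet.trans ?_)
  obtain ⟨s, rfl⟩ : ∃ s, r = s + 1 := ⟨r - 1, by omega⟩
  rw [Nat.add_sub_cancel, pow_succ]
  ring

end CyclotomicUnits

/-! ### The index of the cyclotomic units -/

section CyclotomicIndex

open NumberField NumberField.Units InfinitePlace Module IntermediateField

variable {p : ℕ} [hp : Fact p.Prime] {r : ℕ} (hr : p = 2 * r + 1)
  {K : Type*} [Field K] [NumberField K] [IsCyclotomicExtension {p} ℚ K] [IsAbelianGalois ℚ K]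
  {η : K} (hη : IsPrimitiveRoot η p)

include hr hη

theorem residue_real :
    dedekindZeta_residue (ℚ⟮η + η⁻¹⟯) * √|discr (ℚ⟮η + η⁻¹⟯)| =
      2 ^ (r - 1) * regulator (ℚ⟮η + η⁻¹⟯) * classNumber (ℚ⟮η + η⁻¹⟯) := by
  have h2 := hp.out.two_le
  have : IsCMField K := IsCyclotomicExtension.Rat.isCMField K (S := {p})
    ⟨p, rfl, by omega⟩
  have := isTotallyReal_real hη (by omega)
  have h3 : nrRealPlaces (ℚ⟮η + η⁻¹⟯) = r := by
    rw [← IsTotallyReal.finrank, finrank_real hη (by omega)]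
    omega
  rw [dedekindZeta_residue_def, IsTotallyReal.nrComplexPlaces_eq_zero, h3,
    torsionOrder_eq_two_of_isTotallyReal]
  have h4 : √|(discr (ℚ⟮η + η⁻¹⟯) : ℝ)| ≠ 0 := by
    have : (discr (ℚ⟮η + η⁻¹⟯) : ℝ) ≠ 0 := by exact_mod_cast discr_ne_zero _
    exact (Real.sqrt_pos.mpr (abs_pos.mpr this)).ne'
  obtain ⟨s, rfl⟩ : ∃ s, r = s + 1 := ⟨r - 1, by omega⟩
  rw [Nat.add_sub_cancel, pow_succ]
  push_cast
  field_simp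

/-- Each of the `r - 1` nontrivial even characters contributes one `√p` from its Gauss sum and one 2
from folding the residues onto a half-system. -/
theorem residue_real_eq_prod {E : Subgroup (DirichletCharacter ℂ p)}
    (hE : E = fieldChars p (ℚ⟮η + η⁻¹⟯)) [Fintype E] :
    open scoped Classical in
    dedekindZeta_residue (ℚ⟮η + η⁻¹⟯) * √p ^ (r - 1) =
      2 ^ (r - 1) * ∏ χ ∈ Finset.univ.erase (1 : E),
      ‖∑ i : Fin r, χ.1 ((i : ℕ) + 1) * (Real.log ‖1 - ZMod.stdAddChar ((i : ℕ) + 1 : ZMod p)‖ : ℝ)‖ := by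
  classical
  have h2 := hp.out.two_le
  subst hE
  have hcard : (Finset.univ.erase (1 : fieldChars p (ℚ⟮η + η⁻¹⟯))).card = r - 1 := by
    rw [Finset.card_erase_of_mem (Finset.mem_univ _), Finset.card_univ, ← Nat.card_eq_fintype_card,
      IsCyclotomicExtension.Rat.card_intermediateFieldEquivSubgroupChar,
      finrank_real hη (by omega)]
    omega
  have h1 := congrArg norm (dedekindZeta_residue_eq_prod p (ℚ⟮η + η⁻¹⟯))
  rw [Complex.norm_real, Real.norm_of_nonneg (dedekindZeta_residue_pos _).le, norm_prod] at h1
  -- The formula at 1 evaluates the `L`-function of `χ⁻¹`; inversion permutes the nontrivial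
  -- characters.
  have h3 : ∏ χ ∈ Finset.univ.erase (1 : fieldChars p (ℚ⟮η + η⁻¹⟯)),
      ‖DirichletCharacter.LFunction χ.1 1‖ =
      ∏ χ ∈ Finset.univ.erase (1 : fieldChars p (ℚ⟮η + η⁻¹⟯)),
        ‖DirichletCharacter.LFunction (χ.1)⁻¹ 1‖ := by
    refine Finset.prod_bij' (fun χ _ ↦ χ⁻¹) (fun χ _ ↦ χ⁻¹) ?_ ?_ ?_ ?_ ?_ <;> simp
  rw [h1, h3, ← hcard, ← Finset.prod_const, ← Finset.prod_const, ← Finset.prod_mul_distrib,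
    ← Finset.prod_mul_distrib]
  refine Finset.prod_congr rfl fun χ hχ ↦ ?_
  have heven : (χ.1).Even := (mem_fieldChars_real_iff hη _).mp χ.2
  have hne : χ.1 ≠ 1 := fun h ↦ (Finset.ne_of_mem_erase hχ) (Subtype.ext h)
  rw [norm_LFunction_one_of_even hne heven, ZMod.sum_eq_two_mul_sum_half hr
    (fun j ↦ χ.1 j * (Real.log ‖1 - ZMod.stdAddChar j‖ : ℝ)) (by simp), norm_mul]
  · simp
  · intro a
    rw [heven.eval_neg χ.1, AddChar.map_neg_eq_inv, Complex.inv_eq_conj (norm_stdAddChar _),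
      ← Complex.norm_conj, map_sub, map_one, Complex.conj_conj]

/-- The index of the group of cyclotomic units is prime to `p` when the class number of the maximal
real subfield is. -/
theorem not_dvd_index_cyclotomicUnits {v : Fin r → (𝓞 K)ˣ}
    (hv : ∀ i, (1 - η) * ((v i : 𝓞 K) : K) = 1 - η ^ ((i : ℕ) + 1))
    (ι : Fin (rank K) ≃ {j : Fin r // (j : ℕ) ≠ 0})
    (hclass : ¬ p ∣ classNumber (ℚ⟮η + η⁻¹⟯)) :
    ¬ p ∣ (Subgroup.closure (Set.range fun k ↦ v (ι k)) ⊔ torsion K).index := by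
  classical
  have h2 := hp.out.two_le
  have : IsCMField K := IsCyclotomicExtension.Rat.isCMField K (S := {p})
    ⟨p, rfl, by omega⟩
  have hrank : rank K = r - 1 := by rw [rank, card_infinitePlace_cyclotomic hr hη]
  let _ : Fintype (fieldChars p (ℚ⟮η + η⁻¹⟯)) := Fintype.ofFinite _
  have hcard : Fintype.card (fieldChars p (ℚ⟮η + η⁻¹⟯)) = r := by
    rw [← Nat.card_eq_fintype_card,
      IsCyclotomicExtension.Rat.card_intermediateFieldEquivSubgroupChar, finrank_real hη (by omega)]
    omega
  have h3 := regOfFamily_cyclotomicUnits hr hη hv ι (mem_fieldChars_real_iff hη) hcard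
  have h4 := residue_real_eq_prod hr hη rfl
  have h5 := residue_real hr hη
  have h6 := regOfFamily_div_regulator (fun k ↦ v (ι k))
  have h7 := IsCMField.regulator_div_regulator_eq_two_pow_mul_indexRealUnits_inv K
  rw [← regulator_real hη (by omega), hrank] at h7
  rw [← h3] at h4
  set F := ℚ⟮η + η⁻¹⟯
  set m := (Subgroup.closure (Set.range fun k ↦ v (ι k)) ⊔ torsion K).index
  set Q := IsCMField.indexRealUnits K with hQ
  have hQ0 : Q ≠ 0 := by rcases IsCMField.indexRealUnits_eq_one_or_two K with h | h <;> omega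
  obtain ⟨d, hd⟩ := pow_dvd_discr_subfield p F
  rw [finrank_real hη (by omega), show (p - 1) / 2 = r by omega] at hd
  have hd' : |(discr F : ℝ)| = p ^ (r - 1) * d := by
    rw [← Int.cast_abs, Int.abs_eq_natAbs, hd]
    push_cast; rfl
  have hRF := regulator_pos F
  have hRK := regulator_pos K
  have hQR : (Q : ℝ) ≠ 0 := by exact_mod_cast hQ0
  rw [div_eq_iff hRK.ne'] at h6
  rw [div_eq_iff hRF.ne'] at h7
  rw [h6, h7] at h4
  -- Both expressions for the residue contain the regulator of `F`, which cancels.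
  have h8 : (classNumber F : ℝ) * √p ^ (r - 1) * Q = m * √|(discr F : ℝ)| := by
    have h9 : (2 ^ (r - 1) * regulator F) * ((classNumber F : ℝ) * √p ^ (r - 1) * Q) =
        (2 ^ (r - 1) * regulator F) * (m * √|(discr F : ℝ)|) := by
      calc _ = (2 ^ (r - 1) * regulator F * classNumber F) * √p ^ (r - 1) * Q := by ring
        _ = (dedekindZeta_residue F * √p ^ (r - 1)) * √|(discr F : ℝ)| * Q := by
          rw [← h5]; ring
        _ = _ := by
          rw [h4]; field_simp
    exact mul_left_cancel₀ (by positivity) h9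
  -- Squaring removes the square roots, and the Gauss sums' `p ^ (r - 1)` cancels against the
  -- discriminant. As `Q` is 1 or 2, a factor `p` of the index would have to divide the class
  -- number.
  have h10 : (classNumber F * Q) ^ 2 = m ^ 2 * d := by
    have h11 := congrArg (· ^ 2) h8
    simp only [mul_pow, hd'] at h11
    rw [pow_right_comm, Real.sq_sqrt (by positivity), Real.sq_sqrt (by positivity)] at h11
    have hp0 : ((p : ℝ) ^ (r - 1)) ≠ 0 := pow_ne_zero _ (by exact_mod_cast hp.out.ne_zero)
    have h12 : (p : ℝ) ^ (r - 1) * (classNumber F * Q) ^ 2 = (p : ℝ) ^ (r - 1) * (m ^ 2 * d) := by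
      linear_combination h11
    exact_mod_cast mul_left_cancel₀ hp0 h12
  intro hdvd
  have h13 : p ∣ (classNumber F * Q) ^ 2 := by
    rw [h10]
    exact (hdvd.pow two_ne_zero).mul_right d
  rcases hp.out.dvd_mul.mp (hp.out.dvd_of_dvd_pow h13) with h | h
  · exact hclass h
  · have := Nat.le_of_dvd (Nat.pos_of_ne_zero hQ0) h
    rcases IsCMField.indexRealUnits_eq_one_or_two K with h' | h' <;> omega

/-- The cyclotomic units are independent. -/
theorem isMaxRank_cyclotomicUnits {v : Fin r → (𝓞 K)ˣ}
    (hv : ∀ i, (1 - η) * ((v i : 𝓞 K) : K) = 1 - η ^ ((i : ℕ) + 1))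
    (ι : Fin (rank K) ≃ {j : Fin r // (j : ℕ) ≠ 0})
    (hclass : ¬ p ∣ classNumber (ℚ⟮η + η⁻¹⟯)) :
    IsMaxRank fun k ↦ v (ι k) := by
  rw [← regOfFamily_ne_zero_iff]
  intro h
  have h1 := regOfFamily_div_regulator (fun k ↦ v (ι k))
  rw [h, zero_div] at h1
  have h2 : (Subgroup.closure (Set.range fun k ↦ v (ι k)) ⊔ torsion K).index = 0 := by
    exact_mod_cast h1.symm
  refine not_dvd_index_cyclotomicUnits hr hη hv ι hclass ?_
  rw [h2]
  exact dvd_zero p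

end CyclotomicIndex

/-! ### Independence of the numbers `1 - ηⁱ` modulo `p`-th powers -/

section Independence

open NumberField NumberField.Units InfinitePlace Module IntermediateField

variable {p : ℕ} [hp : Fact p.Prime] {r : ℕ} (hr : p = 2 * r + 1)
  {K : Type*} [Field K] [NumberField K] [IsCyclotomicExtension {p} ℚ K] [IsAbelianGalois ℚ K]
  {η : K} (hη : IsPrimitiveRoot η p)

include hη

omit [IsCyclotomicExtension {p} ℚ K] [IsAbelianGalois ℚ K] in
theorem abs_norm_root_eq_one : |Algebra.norm ℚ η| = 1 := by
  have h := congrArg (fun x ↦ |Algebra.norm ℚ x|) hη.pow_eq_one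
  simp only [map_pow, map_one, abs_pow, abs_one] at h
  exact (pow_eq_one_iff_of_nonneg (abs_nonneg _) hp.out.ne_zero).mp h

omit [IsAbelianGalois ℚ K] in
theorem abs_norm_one_sub_root (hp2 : p ≠ 2) : |Algebra.norm ℚ (1 - η)| = p := by
  have h := hη.norm_sub_one_of_prime_ne_two' (Polynomial.cyclotomic.irreducible_rat hp.out.pos) hp2
  have h1 : (1 - η) = (-1) * (η - 1) := by ring
  have h2 : |Algebra.norm ℚ (-1 : K)| = 1 := by
    have h := congrArg (fun x ↦ |Algebra.norm ℚ x|) (neg_one_sq (R := K))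
    simp only [map_pow, map_one, abs_pow, abs_one] at h
    exact (pow_eq_one_iff_of_nonneg (abs_nonneg _) two_ne_zero).mp h
  rw [h1, map_mul, abs_mul, h, h2, one_mul, Nat.abs_cast]

omit [IsAbelianGalois ℚ K] in
-- If `p ∤ e` then `u` has order `p ^ 2`, but roots of unity in the `p`-th cyclotomic field have
-- order dividing `2 * p`.
theorem prime_dvd_of_root_pow_eq_pow (hp2 : p ≠ 2) {e : ℕ} {u : K} (hu : η ^ e = u ^ p) : p ∣ e := by
  by_contra h
  have h1 : IsPrimitiveRoot (η ^ e) p :=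
    hη.pow_of_coprime e ((Nat.Prime.coprime_iff_not_dvd hp.out).mpr h).symm
  rw [hu] at h1
  have h2 : orderOf u = p ^ (1 + 1) := by
    refine orderOf_eq_prime_pow ?_ ?_
    · rw [pow_one]
      exact h1.ne_one hp.out.one_lt
    · rw [pow_succ, pow_one, pow_mul, h1.pow_eq_one]
  have h3 : IsPrimitiveRoot u (p ^ 2) := by rw [IsPrimitiveRoot.iff_orderOf, h2]
  have h4 := h3.dvd_of_isCyclotomicExtension (n := p) (pow_ne_zero 2 hp.out.ne_zero)
  rw [sq] at h4
  have h5 := Nat.dvd_of_mul_dvd_mul_right hp.out.pos h4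
  exact hp2 ((Nat.prime_dvd_prime_iff_eq hp.out Nat.prime_two).mp h5)

include hr

omit [IsAbelianGalois ℚ K] in
-- Each `1 - η ^ (i + 1)` has norm `±p`; compare `p`-adic valuations of the norms.
theorem dvd_sum_of_prod_eq_pow {e₀ : ℕ} {e : Fin r → ℕ} {u : K}
    (hu : η⁻¹ ^ e₀ * ∏ i : Fin r, (1 - η ^ ((i : ℕ) + 1)) ^ e i = u ^ p) : p ∣ ∑ i, e i := by
  have h2 := hp.out.two_le
  have h := congrArg (fun x ↦ |Algebra.norm ℚ x|) hu
  have h1 : ∀ i : Fin r, |Algebra.norm ℚ (1 - η ^ ((i : ℕ) + 1))| = p := fun i ↦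
    abs_norm_one_sub_root (hη.pow_of_coprime _
      (Nat.coprime_of_lt_prime (by omega) (by omega) hp.out).symm) (by omega)
  simp only [map_mul, map_pow, map_prod, abs_mul, abs_pow, Finset.abs_prod, h1,
    abs_norm_root_eq_one hη.inv, one_pow, one_mul, Finset.prod_pow_eq_pow_sum] at h
  have h3 := congrArg (padicValRat p) h
  rw [padicValRat.pow, padicValRat.self hp.out.one_lt, mul_one, padicValRat.pow] at h3
  exact_mod_cast Dvd.intro _ h3.symm

/-- A product of powers of the units `v i` and a root of unity which is a `p`-th power of a unit has
all exponents divisible by `p`. -/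
theorem dvd_of_units_prod_eq_pow (hclass : ¬ p ∣ classNumber (ℚ⟮η + η⁻¹⟯)) {v : Fin r → (𝓞 K)ˣ}
    (hv : ∀ i, (1 - η) * ((v i : 𝓞 K) : K) = 1 - η ^ ((i : ℕ) + 1)) {e : Fin r → ℕ}
    {t Y : (𝓞 K)ˣ} (ht : t ∈ torsion K) (hY : t * ∏ i, v i ^ e i = Y ^ p)
    (i : Fin r) (hi : (i : ℕ) ≠ 0) : p ∣ e i := by
  classical
  have h2 := hp.out.two_le
  have : NeZero r := ⟨by omega⟩
  have hrank : rank K = r - 1 := by rw [rank, card_infinitePlace_cyclotomic hr hη]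
  let ι : Fin (rank K) ≃ {j : Fin r // (j : ℕ) ≠ 0} := Fintype.equivOfCardEq (by
    have h3 : Fintype.card {j : Fin r // (j : ℕ) ≠ 0} = Fintype.card {j : Fin r // j ≠ 0} :=
      Fintype.card_congr (Equiv.subtypeEquivRight fun j ↦ by rw [Ne, Ne, Fin.ext_iff, Fin.val_zero])
    rw [h3, Fintype.card_subtype_compl, Fintype.card_fin, Fintype.card_fin, hrank,
      Fintype.card_unique])
  have hu := isMaxRank_cyclotomicUnits hr hη hv ι hclass
  have hm := not_dvd_index_cyclotomicUnits hr hη hv ι hclass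
  set T := Subgroup.closure (Set.range fun k ↦ v (ι k)) ⊔ torsion K
  -- `Y` itself need not lie in the subgroup, but its power by the index does, and the index is
  -- prime to `p`.
  have hYm : Y ^ T.index ∈ T := Subgroup.pow_index_mem T Y
  have h3 : logEmbedding K (Additive.ofMul (Y ^ T.index)) ∈
      Submodule.span ℤ (Set.range (basisOfIsMaxRank hu)) := by
    rw [← Submodule.mem_toAddSubgroup, span_basisOfIsMaxRank hu, ← dirichletUnitTheorem.map_logEmbedding_sup_torsion]
    refine ⟨_, ?_, rfl⟩
    have h4 : Subgroup.toAddSubgroup (Subgroup.closure (Set.range fun k ↦ v (ι k))) ⊔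
        (torsion K).toAddSubgroup = T.toAddSubgroup :=
      (SupHomClass.map_sup Subgroup.toAddSubgroup _ _).symm
    rw [h4]
    exact hYm
  obtain ⟨n, hn⟩ := (Submodule.mem_span_range_iff_exists_fun ℤ).mp h3
  simp only [basisOfIsMaxRank_apply, ofMul_pow, map_nsmul] at hn
  have h5 := congrArg (fun x ↦ logEmbedding K (Additive.ofMul x)) hY
  simp only [ofMul_mul, ofMul_pow, ofMul_prod, map_add, map_sum, map_nsmul,
    dirichletUnitTheorem.logEmbedding_eq_zero_iff.mpr ht, zero_add] at h5
  -- Since this unit is trivial, the relation says nothing about `e 0`.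
  have hv0 : v 0 = 1 := by
    have h6 := hv 0
    have hη1 : (1 : K) - η ≠ 0 := sub_ne_zero.mpr (hη.ne_one hp.out.one_lt).symm
    rw [Fin.val_zero, zero_add, pow_one] at h6
    have h7 := mul_left_cancel₀ hη1 (h6.trans (mul_one _).symm)
    exact Units.ext (RingOfIntegers.ext (by simpa using h7))
  have h6 : ∑ i, e i • logEmbedding K (Additive.ofMul (v i)) =
      ∑ k, e (ι k) • logEmbedding K (Additive.ofMul (v (ι k))) := by
    rw [Equiv.sum_comp ι (fun j ↦ e j • logEmbedding K (Additive.ofMul (v j))),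
      ← Finset.sum_subtype (Finset.univ.erase 0) (fun j ↦ by
        rw [Finset.mem_erase, Ne, Fin.ext_iff, Fin.val_zero]; simp)
        (fun j ↦ e j • logEmbedding K (Additive.ofMul (v j))),
      ← Finset.add_sum_erase _ _ (Finset.mem_univ 0), hv0, ofMul_one, map_zero, smul_zero, zero_add]
  -- Two expressions for the logarithm of `Y`, scaled by `p` times the index, give a linear
  -- relation. Independence of the logarithms yields `T.index * e i = p * n i`.
  have h7 : ∑ k, ((T.index : ℝ) * e (ι k) - p * n k) •
      logEmbedding K (Additive.ofMul (v (ι k))) = 0 := by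
    simp only [sub_smul, mul_smul, Finset.sum_sub_distrib, ← Finset.smul_sum]
    have h8 : ∑ k, (e (ι k) : ℝ) • logEmbedding K (Additive.ofMul (v (ι k))) =
        (p : ℝ) • logEmbedding K (Additive.ofMul Y) := by
      simp only [Nat.cast_smul_eq_nsmul]
      rw [← h6, h5]
    have h9 : ∑ k, (n k : ℝ) • logEmbedding K (Additive.ofMul (v (ι k))) =
        (T.index : ℝ) • logEmbedding K (Additive.ofMul Y) := by
      simp only [Int.cast_smul_eq_zsmul, Nat.cast_smul_eq_nsmul]
      exact hn
    rw [h8, h9, smul_comm, sub_self]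
  have h8 := Fintype.linearIndependent_iff.mp hu _ h7 (ι.symm ⟨i, hi⟩)
  rw [Equiv.apply_symm_apply, sub_eq_zero] at h8
  have h9 : (T.index : ℤ) * e i = p * n (ι.symm ⟨i, hi⟩) := by exact_mod_cast h8
  have h10 : (p : ℤ) ∣ (T.index * e i : ℕ) := by push_cast; exact Dvd.intro _ h9.symm
  exact (hp.out.dvd_mul.mp (Int.natCast_dvd_natCast.mp h10)).resolve_left hm

/-- Since `p` divides the sum of the `e i`, dividing by a `p`-th power of a power of `1 - η` leaves
a relation between units, which handles all `i ≠ 0`. The sum then handles `i = 0`, and what remains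
is a power of a root of unity, which handles `e₀`. -/
theorem dvd_of_prod_eq_pow (hclass : ¬ p ∣ classNumber (ℚ⟮η + η⁻¹⟯)) {e₀ : ℕ} {e : Fin r → ℕ}
    {u : K} (hu : η⁻¹ ^ e₀ * ∏ i : Fin r, (1 - η ^ ((i : ℕ) + 1)) ^ e i = u ^ p) :
    p ∣ e₀ ∧ ∀ i, p ∣ e i := by
  classical
  have h2 := hp.out.two_le
  have hp2 : p ≠ 2 := by omega
  have : NeZero r := ⟨by omega⟩
  obtain ⟨v, hv⟩ := exists_cyclotomicUnits hr hη
  obtain ⟨k, hk⟩ := dvd_sum_of_prod_eq_pow hr hη hu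
  have hη1 : (1 : K) - η ≠ 0 := sub_ne_zero.mpr (hη.ne_one hp.out.one_lt).symm
  have h3 : η⁻¹ ^ e₀ * ∏ i, ((v i : 𝓞 K) : K) ^ e i = (u / (1 - η) ^ k) ^ p := by
    rw [div_pow, ← hu, ← pow_mul, mul_comm k, ← hk, eq_div_iff (pow_ne_zero _ hη1),
      ← Finset.prod_pow_eq_pow_sum, mul_assoc, ← Finset.prod_mul_distrib]
    congr 1
    refine Finset.prod_congr rfl fun i _ ↦ ?_
    rw [← mul_pow, mul_comm, hv]
  obtain ⟨t, ht⟩ : ∃ t : (𝓞 K)ˣ, ((t : 𝓞 K) : K) = η⁻¹ :=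
    ⟨(hη.inv.toInteger_isPrimitiveRoot.isUnit hp.out.ne_zero).unit, rfl⟩
  have htt : t ∈ torsion K := by
    rw [torsion, CommGroup.mem_torsion, isOfFinOrder_iff_pow_eq_one]
    refine ⟨p, hp.out.pos, Units.ext (RingOfIntegers.ext ?_)⟩
    change algebraMap (𝓞 K) K ((t : 𝓞 K) ^ p) = algebraMap (𝓞 K) K 1
    rw [map_pow, map_one]
    exact (congrArg (· ^ p) ht).trans hη.inv.pow_eq_one
  set U : (𝓞 K)ˣ := t ^ e₀ * ∏ i, v i ^ e i with hU
  have hUval : ((U : 𝓞 K) : K) = (u / (1 - η) ^ k) ^ p := by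
    let g : (𝓞 K)ˣ →* K := (algebraMap (𝓞 K) K).toMonoidHom.comp (Units.coeHom (𝓞 K))
    change g U = _
    rw [← h3, hU, map_mul, map_prod, map_pow, show g t = η⁻¹ from ht]
    simp only [map_pow]
    rfl
  have hint : IsIntegral ℤ (u / (1 - η) ^ k) := by
    refine IsIntegral.of_pow hp.out.pos ?_
    rw [← hUval]
    exact (U : 𝓞 K).2
  let y : 𝓞 K := ⟨_, hint⟩
  have hy : y ^ p = (U : 𝓞 K) := RingOfIntegers.ext (by rw [hUval]; push_cast; rfl)
  have hyu : IsUnit y := (isUnit_pow_iff hp.out.ne_zero).mp (hy ▸ U.isUnit)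
  have hY : U = hyu.unit ^ p := Units.ext (by rw [Units.val_pow_eq_pow_val, IsUnit.unit_spec, hy])
  have h4 : ∀ i : Fin r, (i : ℕ) ≠ 0 → p ∣ e i := fun i hi ↦
    dvd_of_units_prod_eq_pow hr hη hclass hv (pow_mem htt e₀) (hU.symm.trans hY) i hi
  have h5 : ∀ i : Fin r, p ∣ e i := by
    intro i
    by_cases hi : i = 0
    · rw [← Finset.add_sum_erase _ _ (Finset.mem_univ 0)] at hk
      rw [hi]
      refine (Nat.dvd_add_left (Finset.dvd_sum fun j hj ↦ h4 j fun h ↦ ?_)).mp (Dvd.intro _ hk.symm)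
      exact Finset.ne_of_mem_erase hj (Fin.ext h)
    · exact h4 i fun h ↦ hi (Fin.ext h)
  refine ⟨?_, h5⟩
  choose g hg using h5
  set w : K := ∏ i : Fin r, (1 - η ^ ((i : ℕ) + 1)) ^ g i
  have hw : ∏ i : Fin r, (1 - η ^ ((i : ℕ) + 1)) ^ e i = w ^ p := by
    simp only [w, ← Finset.prod_pow, ← pow_mul, hg, mul_comm p]
  have hw0 : w ≠ 0 := by
    refine Finset.prod_ne_zero_iff.mpr fun i _ ↦ pow_ne_zero _ ?_
    rw [← hv]
    exact mul_ne_zero hη1 (by simp)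
  rw [hw] at hu
  refine prime_dvd_of_root_pow_eq_pow hη.inv hp2 (u := u / w) ?_
  rw [div_pow, ← hu, mul_div_cancel_right₀ _ (pow_ne_zero _ hw0)]

end Independence

/-! ### Transfer to the subfield `K` of `Ω` -/

namespace FermatHeis

open NumberField IntermediateField

variable {Ω : Type*} [Field Ω] [CharZero Ω] {p : ℕ} [hp : Fact p.Prime] {ζ : Ω}
  (hζ : IsPrimitiveRoot ζ p)

include hζ

theorem isCyclotomicExtension_fieldK : IsCyclotomicExtension {p} ℚ (fieldK ζ) := by
  have hint : IsIntegral ℚ ζ := hζ.isIntegral hp.out.pos |>.tower_top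
  change IsCyclotomicExtension {p} ℚ (adjoin ℚ {ζ}).toSubalgebra
  rw [adjoin_simple_toSubalgebra_of_isAlgebraic hint.isAlgebraic]
  exact hζ.adjoin_isCyclotomicExtension ℚ

omit hζ in
theorem natCard_classGroup_congr {F F' : Type*} [Field F] [Field F'] (e : F ≃+* F') :
    Nat.card (ClassGroup (𝓞 F)) = Nat.card (ClassGroup (𝓞 F')) :=
  Nat.card_congr (ClassGroup.mulEquiv (RingOfIntegers.mapRingEquiv e)).toEquiv

omit hζ [CharZero Ω] hp in
theorem zeta_mem_fieldK [CharZero Ω] : ζ ∈ fieldK ζ := mem_adjoin_simple_self ℚ ζ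

omit hζ [CharZero Ω] hp in
theorem natCard_classGroup_adjoin [CharZero Ω] {M : Type*} [Field M] [CharZero M] (i : M →+* Ω)
    (x : M) : Nat.card (ClassGroup (𝓞 (adjoin ℚ {i x}))) = Nat.card (ClassGroup (𝓞 (ℚ⟮x⟯))) := by
  have h1 : (ℚ⟮x⟯).map i.toRatAlgHom = adjoin ℚ {i x} := by
    rw [adjoin_map, Set.image_singleton]
    rfl
  rw [natCard_classGroup_congr (equivMap (ℚ⟮x⟯) i.toRatAlgHom).toRingEquiv, h1]

omit hζ in
-- `hPlus` refers to a subfield of `Ω`, the index theorem to a subfield of `K`; isomorphic fields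
-- have the same class number. The shape of the generator matches `η = ζ⁻¹`.
theorem hPlus_eq [NumberField (fieldK ζ)] (z : fieldK ζ) (hz : (z : Ω) = ζ) :
    hPlus ζ = classNumber (ℚ⟮z⁻¹ + z⁻¹⁻¹⟯) := by
  rw [classNumber, ← Nat.card_eq_fintype_card,
    ← natCard_classGroup_adjoin (fieldK ζ).val.toRingHom (z⁻¹ + z⁻¹⁻¹)]
  have h1 : (fieldK ζ).val.toRingHom (z⁻¹ + z⁻¹⁻¹) = ζ + ζ⁻¹ := by
    rw [inv_inv, add_comm, map_add, map_inv₀]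
    change (z : Ω) + (z : Ω)⁻¹ = _
    rw [hz]
  rw [h1]
  rfl

/-- The Kummer generators are independent modulo `p`-th powers of `K` if `p` does not divide
`h⁺`. -/
theorem dvd_of_prod_kummerGen_eq_pow (hp2 : p ≠ 2) (hV : ¬ p ∣ hPlus ζ)
    {e : Fin (halfRank p + 1) → ℕ} {u : Ω} (hu : u ∈ fieldK ζ)
    (h : ∏ j : Fin (halfRank p + 1), kummerGen ζ j ^ e j = u ^ p) (j : Fin (halfRank p + 1)) : p ∣ e j := by
  have := isCyclotomicExtension_fieldK hζ
  have : NumberField (fieldK ζ) := IsCyclotomicExtension.numberField {p} ℚ _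
  have : IsAbelianGalois ℚ (fieldK ζ) := IsCyclotomicExtension.isAbelianGalois {p} ℚ _
  have hr : p = 2 * halfRank p + 1 := by
    have := hp.out.eq_two_or_odd
    unfold halfRank
    omega
  let z : fieldK ζ := ⟨ζ, zeta_mem_fieldK⟩
  have hz : IsPrimitiveRoot z p := IsPrimitiveRoot.of_map_of_injective (f := (fieldK ζ).val)
    hζ (fieldK ζ).val.injective
  rw [hPlus_eq z rfl] at hV
  -- With `η = ζ⁻¹` the factors `η⁻¹` and `1 - η ^ i` become the Kummer generators `t₀` and `tᵢ`.
  have key : z⁻¹⁻¹ ^ e 0 * ∏ i : Fin (halfRank p), (1 - z⁻¹ ^ ((i : ℕ) + 1)) ^ e i.succ =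
      (⟨u, hu⟩ : fieldK ζ) ^ p := by
    apply (fieldK ζ).val.injective
    rw [Fin.prod_univ_succ] at h
    simp only [map_mul, map_prod, map_pow, map_sub, map_one, map_inv₀, inv_inv]
    change ζ ^ e 0 * ∏ i : Fin (halfRank p), (1 - ζ⁻¹ ^ ((i : ℕ) + 1)) ^ e i.succ = u ^ p
    rw [← h]
    simp [kummerGen]
  obtain ⟨h1, h2⟩ := dvd_of_prod_eq_pow hr hz.inv hV key
  exact Fin.cases h1 h2 j

end FermatHeis

theorem AddChar.map_finset_sum {A M ι : Type*} [AddCommMonoid A] [CommMonoid M] (ψ : AddChar A M)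
    (s : Finset ι) (f : ι → A) : ψ (∑ i ∈ s, f i) = ∏ i ∈ s, ψ (f i) := by
  classical
  induction s using Finset.induction_on with
  | empty => simp
  | insert a s ha ih => rw [Finset.sum_insert ha, Finset.prod_insert ha, map_add_eq_mul, ih]

/-! ### Kummer theory for several generators -/

section Kummer

variable {p : ℕ} [hp : Fact p.Prime] {K L : Type*} [Field K] [Field L] [Algebra K L]
  {ζ : K} (hζ : IsPrimitiveRoot ζ p) {ι : Type*} [Fintype ι] {x : ι → L} {t : ι → K}

/-- The exponent of `σ` on the Kummer generators `x i`. -/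
theorem exists_kummer_exponent (hx : ∀ i, x i ^ p = algebraMap K L (t i)) (ht : ∀ i, t i ≠ 0) :
    ∃ κ : Gal(L/K) →* Multiplicative (ι → ZMod p), ∀ σ i,
      σ (x i) = algebraMap K L (AddChar.zmodChar p hζ.pow_eq_one ((κ σ).toAdd i)) * x i := by
  set ψ := AddChar.zmodChar p hζ.pow_eq_one
  have hx0 : ∀ i, x i ≠ 0 := fun i h ↦ by
    have := hx i
    rw [h, zero_pow hp.out.ne_zero, eq_comm, map_eq_zero] at this
    exact ht i this
  have hψ : Function.Injective ψ := by
    intro a b hab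
    exact ZMod.val_injective p (hζ.pow_inj (ZMod.val_lt a) (ZMod.val_lt b) hab)
  have h : ∀ (σ : Gal(L/K)) i, ∃ c : ZMod p, σ (x i) = algebraMap K L (ψ c) * x i := by
    intro σ i
    have h1 : (σ (x i) / x i) ^ p = 1 := by
      rw [div_pow, ← map_pow, hx, AlgEquiv.commutes, div_self]
      simpa using ht i
    obtain ⟨k, hk, hk'⟩ := (hζ.map_of_injective (algebraMap K L).injective).eq_pow_of_pow_eq_one h1
    refine ⟨k, ?_⟩
    rw [eq_div_iff (hx0 i)] at hk'
    rw [← hk', AddChar.zmodChar_apply, map_pow, ZMod.val_cast_of_lt hk]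
  choose c hc using h
  refine ⟨MonoidHom.mk' (fun σ ↦ Multiplicative.ofAdd (c σ)) fun σ τ ↦ ?_, hc⟩
  rw [← ofAdd_add]
  congr 1
  funext i
  apply hψ
  apply (algebraMap K L).injective
  apply mul_right_cancel₀ (hx0 i)
  rw [← hc, AlgEquiv.mul_apply, hc τ, map_mul, AlgEquiv.commutes, hc σ, Pi.add_apply,
    AddChar.map_add_eq_mul, map_mul]
  ring

/-- Kummer generators which are independent modulo `p`-th powers can be multiplied by arbitrary
roots of unity. -/
theorem kummer_exponent_surjective [FiniteDimensional K L] [IsGalois K L] (hx : ∀ i, x i ^ p = algebraMap K L (t i))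
    (hind : ∀ (e : ι → ℕ) (u : K), ∏ i, t i ^ e i = u ^ p → ∀ i, p ∣ e i)
    {κ : Gal(L/K) →* Multiplicative (ι → ZMod p)} (hκ : ∀ σ i,
      σ (x i) = algebraMap K L (AddChar.zmodChar p hζ.pow_eq_one ((κ σ).toAdd i)) * x i) :
    Function.Surjective κ := by
  classical
  set ψ := AddChar.zmodChar p hζ.pow_eq_one
  let A : AddSubgroup (ι → ZMod p) := κ.range.toAddSubgroup'
  let S : Submodule (ZMod p) (ι → ZMod p) := AddSubgroup.toZModSubmodule p A
  suffices hS : S = ⊤ by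
    intro c
    have : c.toAdd ∈ S := hS ▸ Submodule.mem_top
    exact this
  by_contra hne
  -- A nonzero functional vanishing on the image gives exponents `e` for which `∏ x i ^ e i` is
  -- Galois invariant, hence in `K`. Independence of the `t i` then forces `e = 0`.
  obtain ⟨f, hf0, hf⟩ := Submodule.exists_le_ker_of_lt_top S (lt_top_iff_ne_top.mpr hne)
  let e : ι → ZMod p := fun i ↦ f (Pi.single i 1)
  have hfe : ∀ c : ι → ZMod p, f c = ∑ i, e i * c i := by
    intro c
    conv_lhs => rw [LinearMap.pi_apply_eq_sum_univ f c]
    refine Finset.sum_congr rfl fun i _ ↦ ?_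
    rw [smul_eq_mul, mul_comm]
    congr 2
    funext j
    simp [Pi.single_apply, eq_comm]
  have hfix : ∀ σ : Gal(L/K), σ (∏ i, x i ^ (e i).val) = ∏ i, x i ^ (e i).val := by
    intro σ
    have h1 : (κ σ).toAdd ∈ S := ⟨σ, rfl⟩
    have h2 := hf h1
    rw [LinearMap.mem_ker, hfe] at h2
    rw [map_prod]
    simp only [map_pow, hκ, mul_pow]
    rw [Finset.prod_mul_distrib]
    have h3 : ∀ i, algebraMap K L (ψ ((κ σ).toAdd i)) ^ (e i).val =
        algebraMap K L (ψ (e i * (κ σ).toAdd i)) := by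
      intro i
      rw [← map_pow, ← AddChar.map_nsmul_eq_pow, nsmul_eq_mul, ZMod.natCast_val, ZMod.cast_id', id]
    simp only [h3]
    rw [← map_prod, ← AddChar.map_finset_sum, h2, AddChar.map_zero_eq_one, map_one, one_mul]
  obtain ⟨u, hu⟩ := (IsGalois.mem_bot_iff_fixed (F := K) (E := L) _).mpr hfix
  have h4 : ∏ i, t i ^ (e i).val = u ^ p := by
    apply (algebraMap K L).injective
    rw [map_pow]
    change _ = (algebraMap K L u) ^ p
    have hu' : algebraMap K L u = ∏ i, x i ^ (e i).val := hu
    rw [hu', map_prod, ← Finset.prod_pow]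
    refine Finset.prod_congr rfl fun i _ ↦ ?_
    rw [map_pow, ← hx, pow_right_comm]
  apply hf0
  ext i
  have h5 := hind _ _ h4 i
  have h6 : (e i).val = 0 := Nat.eq_zero_of_dvd_of_lt h5 (ZMod.val_lt _)
  simpa [e] using h6

theorem kummer_exponent_injective (hgen : Algebra.adjoin K (Set.range x) = ⊤)
    {κ : Gal(L/K) →* Multiplicative (ι → ZMod p)} (hκ : ∀ σ i,
      σ (x i) = algebraMap K L (AddChar.zmodChar p hζ.pow_eq_one ((κ σ).toAdd i)) * x i) :
    Function.Injective κ := by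
  rw [injective_iff_map_eq_one]
  intro σ hσ
  have h : (σ : L →ₐ[K] L) = AlgHom.id K L := by
    apply AlgHom.ext_of_adjoin_eq_top hgen
    rintro _ ⟨i, rfl⟩
    simpa [hσ] using hκ σ i
  exact AlgEquiv.ext fun z ↦ DFunLike.congr_fun h z

end Kummer

/-! ### Kummer extensions as intermediate fields -/

section KummerField

open IntermediateField

variable {p : ℕ} [hp : Fact p.Prime] {K Ω : Type*} [Field K] [Field Ω] [Algebra K Ω]
  {ζ : K} (hζ : IsPrimitiveRoot ζ p) {ι : Type*} [Fintype ι] {x : ι → Ω} {t : ι → K}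
  {M : IntermediateField K Ω}

include hζ

omit hζ in
theorem isIntegral_of_pow_eq (hx : ∀ i, x i ^ p = algebraMap K Ω (t i)) (i : ι) :
    IsIntegral K (x i) :=
  IsIntegral.of_pow hp.out.pos (by rw [hx]; exact isIntegral_algebraMap)

omit hζ in
theorem adjoin_kummer_eq_top (hM : M = adjoin K (Set.range x))
    (hx : ∀ i, x i ^ p = algebraMap K Ω (t i)) (hxM : ∀ i, x i ∈ M) :
    Algebra.adjoin K (Set.range fun i ↦ (⟨x i, hxM i⟩ : M)) = ⊤ := by
  have h1 : Algebra.adjoin K (Set.range x) = M.toSubalgebra := by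
    rw [hM, adjoin_toSubalgebra_of_isAlgebraic]
    rintro _ ⟨i, rfl⟩
    exact (isIntegral_of_pow_eq hx i).isAlgebraic
  apply Subalgebra.map_injective (f := M.val) M.val.injective
  rw [AlgHom.map_adjoin, ← Set.range_comp, Algebra.map_top, M.range_val, ← h1]
  rfl

omit hζ in
theorem finiteDimensional_kummer (hM : M = adjoin K (Set.range x))
    (hx : ∀ i, x i ^ p = algebraMap K Ω (t i)) : FiniteDimensional K M := by
  subst hM
  have : Finite (Set.range x) := Set.finite_range x
  exact finiteDimensional_adjoin fun y hy ↦ by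
    obtain ⟨i, rfl⟩ := hy
    exact isIntegral_of_pow_eq hx i

theorem normal_adjoin_kummer {x : Ω} {t : K} (hx : x ^ p = algebraMap K Ω t) :
    Normal K (adjoin K {x}) := by
  have hxi : x ∈ adjoin K {x} := mem_adjoin_simple_self K x
  have : Polynomial.IsSplittingField K (adjoin K {x}) (Polynomial.X ^ p - Polynomial.C t) := by
    refine ⟨?_, ?_⟩
    · rw [Polynomial.map_sub, Polynomial.map_pow, Polynomial.map_X, Polynomial.map_C]
      exact X_pow_sub_C_splits_of_isPrimitiveRoot
        (hζ.map_of_injective (algebraMap K (adjoin K {x})).injective)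
        (α := ⟨x, hxi⟩) (Subtype.ext hx)
    · refine top_le_iff.mp ?_
      rw [← adjoin_kummer_eq_top (ι := Unit) (x := fun _ ↦ x) (t := fun _ ↦ t) (p := p)
        (M := adjoin K {x}) (by rw [Set.range_const]) (fun _ ↦ hx) (fun _ ↦ hxi)]
      refine Algebra.adjoin_mono ?_
      rintro _ ⟨_, rfl⟩
      rw [Polynomial.mem_rootSet]
      refine ⟨Polynomial.X_pow_sub_C_ne_zero hp.out.pos _, ?_⟩
      rw [map_sub, map_pow, Polynomial.aeval_X, Polynomial.aeval_C, sub_eq_zero]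
      exact Subtype.ext hx
  exact Normal.of_isSplittingField (Polynomial.X ^ p - Polynomial.C t)

theorem isGalois_kummer [CharZero K] (hM : M = adjoin K (Set.range x))
    (hx : ∀ i, x i ^ p = algebraMap K Ω (t i)) : IsGalois K M := by
  have h1 : M = ⨆ i, adjoin K {x i} := by
    rw [hM, ← Set.iUnion_singleton_eq_range, adjoin_iUnion]
  have h2 : ∀ i, Normal K (adjoin K {x i}) := fun i ↦ normal_adjoin_kummer hζ (hx i)
  rw [h1]
  exact {}

/-- Kummer theory: the Galois group of an extension generated by the `p`-th roots of elements
which are independent modulo `p`-th powers. -/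
theorem exists_kummerEquiv [CharZero K] (hM : M = adjoin K (Set.range x))
    (hx : ∀ i, x i ^ p = algebraMap K Ω (t i)) (hxM : ∀ i, x i ∈ M) (ht : ∀ i, t i ≠ 0)
    (hind : ∀ (e : ι → ℕ) (u : K), ∏ i, t i ^ e i = u ^ p → ∀ i, p ∣ e i) :
    ∃ κ : Gal(M/K) ≃* Multiplicative (ι → ZMod p), ∀ σ i, σ ⟨x i, hxM i⟩ =
      algebraMap K M (AddChar.zmodChar p hζ.pow_eq_one ((κ σ).toAdd i)) * ⟨x i, hxM i⟩ := by
  have := finiteDimensional_kummer hM hx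
  have := isGalois_kummer hζ hM hx
  have hx' : ∀ i, (⟨x i, hxM i⟩ : M) ^ p = algebraMap K M (t i) := fun i ↦ Subtype.ext (hx i)
  obtain ⟨κ, hκ⟩ := exists_kummer_exponent hζ hx' ht
  exact ⟨MulEquiv.ofBijective κ ⟨kummer_exponent_injective hζ (adjoin_kummer_eq_top hM hx hxM) hκ,
    kummer_exponent_surjective hζ hx' hind hκ⟩, hκ⟩

end KummerField

/-! ### Functional equations of the product `γ` -/

namespace FermatHeis

open Finset

section Products

variable {M : Type*} [Field M] {p : ℕ} [hp : Fact p.Prime] {ζ : M} (hζ : IsPrimitiveRoot ζ p)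

/-- `∏ j < p, (1 - ζ ^ j u) ^ j`. -/
def gamProd (p : ℕ) (ζ u : M) : M := ∏ j ∈ range p, (1 - ζ ^ j * u) ^ j

/-- `∏ i < I, (1 - ζ ^ (-(i + 1)) u)`. -/
def theta (ζ u : M) (I : ℕ) : M := ∏ i ∈ range I, (1 - ζ⁻¹ ^ (i + 1) * u)

/-- The factor at `j = 0` has exponent 0, so the product may run over all residues, which `u ↦ ζ⁻¹
u` shifts. -/
theorem gam_eq_gamProd [CharZero M] (w : M) (I : ℕ) : gam p ζ w I = gamProd p ζ (w ^ I)⁻¹ := by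
  have h2 := hp.out.two_le
  rw [gam, gamProd, show range p = insert 0 (Icc 1 (p - 1)) by ext; simp; omega,
    prod_insert (by simp), pow_zero, one_mul]

include hζ

theorem prod_one_sub_pow_mul (u : M) : ∏ j ∈ range p, (1 - ζ ^ j * u) = 1 - u ^ p := by
  classical
  have h := hζ.pow_sub_pow_eq_prod_sub_mul 1 u hp.out.pos
  rw [one_pow] at h
  rw [h]
  refine prod_bij (fun j _ ↦ ζ ^ j) (fun j _ ↦ ?_) (fun i hi j hj hij ↦ ?_) (fun z hz ↦ ?_)
    (fun j _ ↦ rfl)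
  · rw [Polynomial.mem_nthRootsFinset hp.out.pos, ← pow_mul, mul_comm, pow_mul, hζ.pow_eq_one, one_pow]
  · exact hζ.pow_inj (mem_range.mp hi) (mem_range.mp hj) hij
  · rw [Polynomial.mem_nthRootsFinset hp.out.pos] at hz
    obtain ⟨i, hi, rfl⟩ := hζ.eq_pow_of_pow_eq_one hz
    exact ⟨i, mem_range.mpr hi, rfl⟩

/-- The substitution shifts indices, which raises the exponent of each factor by one, that is,
multiplies by `1 - u ^ p`. The exception is the factor `1 - ζ⁻¹ u`, whose exponent would reach `p`
but drops to 0. -/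
theorem gamProd_inv_mul (u : M) :
    gamProd p ζ (ζ⁻¹ * u) * (1 - ζ⁻¹ * u) ^ p = gamProd p ζ u * (1 - u ^ p) := by
  obtain ⟨q, rfl⟩ : ∃ q, p = q + 1 := ⟨p - 1, by have := hp.out.pos; omega⟩
  have hζ0 : ζ ≠ 0 := hζ.ne_zero hp.out.ne_zero
  have hinv : ζ⁻¹ = ζ ^ q := by
    rw [inv_eq_iff_eq_inv, ← mul_eq_one_iff_eq_inv₀ (pow_ne_zero _ hζ0), ← pow_succ', hζ.pow_eq_one]
  rw [← prod_one_sub_pow_mul hζ, gamProd, gamProd, ← prod_mul_distrib, prod_range_succ', pow_zero,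
    mul_one, prod_range_succ (fun j ↦ (1 - ζ ^ j * u) ^ j * (1 - ζ ^ j * u)), ← pow_succ, ← hinv]
  congr 1
  refine prod_congr rfl fun i _ ↦ ?_
  rw [show ζ ^ (i + 1) * (ζ⁻¹ * u) = ζ ^ i * u by
    rw [pow_succ, mul_assoc, mul_inv_cancel_left₀ hζ0], pow_succ]

/-- Iterates the previous rule; `theta` collects the factors that wrap around. -/
theorem gamProd_inv_pow_mul (u : M) (I : ℕ) :
    gamProd p ζ (ζ⁻¹ ^ I * u) * theta ζ u I ^ p = gamProd p ζ u * (1 - u ^ p) ^ I := by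
  induction I with
  | zero => simp [theta]
  | succ I ih =>
    have h := gamProd_inv_mul hζ (ζ⁻¹ ^ I * u)
    rw [mul_pow, ← pow_mul, mul_comm I, pow_mul, hζ.inv.pow_eq_one, one_pow, one_mul,
      ← mul_assoc, ← pow_succ'] at h
    rw [theta, prod_range_succ, ← theta, mul_pow]
    linear_combination (theta ζ u I ^ p) * h + (1 - u ^ p) * ih

/-- As `p ∤ I`, the powers `ζ ^ (-I k)` run through all `p`-th roots of unity, so each of the `I`
factors of `theta` has orbit product `1 - u ^ p`. -/
theorem prod_theta (u : M) {I : ℕ} (hI : ¬ p ∣ I) :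
    ∏ k ∈ range p, theta ζ (ζ⁻¹ ^ (I * k) * u) I = (1 - u ^ p) ^ I := by
  simp only [theta]
  rw [prod_comm, ← card_range I, ← prod_const, card_range]
  refine prod_congr rfl fun i _ ↦ ?_
  have hξ : IsPrimitiveRoot (ζ⁻¹ ^ I) p :=
    hζ.inv.pow_of_coprime _ ((Nat.Prime.coprime_iff_not_dvd hp.out).mpr hI).symm
  have h := prod_one_sub_pow_mul hξ (ζ⁻¹ ^ (i + 1) * u)
  rw [mul_pow, ← pow_mul, mul_comm (i + 1), pow_mul, hζ.inv.pow_eq_one, one_pow, one_mul] at h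
  rw [← h]
  refine prod_congr rfl fun k _ ↦ ?_
  rw [← pow_mul]
  ring

theorem one_sub_zpow_mul_ne_zero {u : M} (hu : u ^ p ≠ 1) (j : ℕ) : 1 - ζ ^ j * u ≠ 0 := by
  intro h
  apply hu
  have h1 := congrArg (· ^ p) (sub_eq_zero.mp h)
  simp only [one_pow, mul_pow] at h1
  rw [← pow_mul, mul_comm j, pow_mul, hζ.pow_eq_one, one_pow, one_mul] at h1
  exact h1.symm

theorem theta_ne_zero {u : M} (hu : u ^ p ≠ 1) (I : ℕ) : theta ζ u I ≠ 0 :=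
  prod_ne_zero_iff.mpr fun i _ ↦ one_sub_zpow_mul_ne_zero hζ.inv hu (i + 1)

theorem gamProd_ne_zero {u : M} (hu : u ^ p ≠ 1) : gamProd p ζ u ≠ 0 :=
  prod_ne_zero_iff.mpr fun j _ ↦ pow_ne_zero _ (one_sub_zpow_mul_ne_zero hζ hu j)

end Products

/-! ### Automorphisms acting on a `p`-th root of `γ` -/

section Action

variable {M : Type*} [Field M] {p : ℕ} [hp : Fact p.Prime] {ζ : M} (hζ : IsPrimitiveRoot ζ p)
  {u v y : M} {I : ℕ} {σ ρ c : M →+* M}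

theorem map_gamProd (hσ : σ ζ = ζ) (u : M) : σ (gamProd p ζ u) = gamProd p ζ (σ u) := by
  simp [gamProd, hσ]

theorem map_theta (hσ : σ ζ = ζ) (u : M) : σ (theta ζ u I) = theta ζ (σ u) I := by
  simp [theta, hσ]

include hζ

theorem exists_eq_pow_mul_of_pow_eq {a b : M} (hb : b ≠ 0) (h : a ^ p = b ^ p) :
    ∃ m : ℕ, a = ζ ^ m * b := by
  obtain ⟨m, -, hm⟩ := hζ.eq_pow_of_pow_eq_one (ξ := a / b)
    (by rw [div_pow, h, div_self (pow_ne_zero _ hb)])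
  exact ⟨m, by rw [hm, div_mul_cancel₀ _ hb]⟩

/-- The action on `y = γ ^ (1 / p)` of an automorphism fixing `u`. -/
theorem exists_map_eq_of_fixed (hσ : σ ζ = ζ) (hu : u ^ p ≠ 1) (hy : y ^ p = gamProd p ζ u)
    (hσu : σ u = u) : ∃ m : ℕ, σ y = ζ ^ m * y := by
  have hy0 : y ≠ 0 := fun h ↦ gamProd_ne_zero hζ hu (by rw [← hy, h, zero_pow hp.out.ne_zero])
  apply exists_eq_pow_mul_of_pow_eq hζ hy0
  rw [← map_pow, hy, map_gamProd hσ, hσu]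

/-- The action on `y = γ ^ (1 / p)` of an automorphism with `σ u = ζ ^ (-I) u`. -/
theorem exists_map_eq_of_mul (hσ : σ ζ = ζ) (hu : u ^ p ≠ 1) (hy : y ^ p = gamProd p ζ u)
    (hv : v ^ p = 1 - u ^ p) (hσu : σ u = ζ⁻¹ ^ I * u) :
    ∃ m : ℕ, σ y = ζ ^ m * (v ^ I / theta ζ u I * y) := by
  have hy0 : y ≠ 0 := fun h ↦ gamProd_ne_zero hζ hu (by rw [← hy, h, zero_pow hp.out.ne_zero])
  have hv0 : v ≠ 0 := fun h ↦ by
    rw [h, zero_pow hp.out.ne_zero, eq_comm, sub_eq_zero] at hv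
    exact hu hv.symm
  have hθ := theta_ne_zero hζ hu I
  apply exists_eq_pow_mul_of_pow_eq hζ (mul_ne_zero (div_ne_zero (pow_ne_zero _ hv0) hθ) hy0)
  rw [← map_pow, hy, map_gamProd hσ, hσu, mul_pow, hy, div_pow, ← pow_mul, mul_comm I, pow_mul, hv]
  rw [div_mul_eq_mul_div, eq_div_iff (pow_ne_zero _ hθ), gamProd_inv_pow_mul hζ, mul_comm]

omit hp in
theorem iterate_eq_of_fixed (hσ : σ ζ = ζ) {m : ℕ} (h : σ y = ζ ^ m * y) : σ^[p] y = y := by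
  have key : ∀ k : ℕ, σ^[k] y = ζ ^ (m * k) * y := by
    intro k
    induction k with
    | zero => simp
    | succ k ih =>
      rw [Function.iterate_succ_apply', ih, map_mul, map_pow, hσ, h]
      ring
  rw [key, mul_comm m, pow_mul, hζ.pow_eq_one, one_pow, one_mul]

/-- After `p` iterations `y` is multiplied by `v ^ (I * p)` over the orbit product of `theta`. Both
are `(1 - u ^ p) ^ I`, and the root of unity has become `ζ ^ (m * p) = 1`. -/
theorem iterate_eq_of_mul (hσ : σ ζ = ζ) (hu : u ^ p ≠ 1) (hv : v ^ p = 1 - u ^ p)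
    (hσu : σ u = ζ⁻¹ ^ I * u) (hσv : σ v = v) (hI : ¬ p ∣ I) {m : ℕ}
    (h : σ y = ζ ^ m * (v ^ I / theta ζ u I * y)) : σ^[p] y = y := by
  have hσinv : σ ζ⁻¹ = ζ⁻¹ := by rw [map_inv₀, hσ]
  have hiter : ∀ k : ℕ, σ^[k] u = ζ⁻¹ ^ (I * k) * u := by
    intro k
    induction k with
    | zero => simp
    | succ k ih =>
      rw [Function.iterate_succ_apply', ih, map_mul, map_pow, hσinv, hσu]
      ring
  have hne : ∀ k : ℕ, theta ζ (ζ⁻¹ ^ (I * k) * u) I ≠ 0 := by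
    intro k
    apply theta_ne_zero hζ
    rwa [mul_pow, ← pow_mul, mul_comm (I * k), pow_mul, hζ.inv.pow_eq_one, one_pow, one_mul]
  have hfix : ∀ k : ℕ, σ^[k] (v ^ I) = v ^ I := by
    intro k
    exact Function.iterate_fixed (by rw [map_pow, hσv]) k
  have key : ∀ k : ℕ, σ^[k] y * ∏ i ∈ range k, theta ζ (ζ⁻¹ ^ (I * i) * u) I =
      ζ ^ (m * k) * v ^ (I * k) * y := by
    intro k
    induction k with
    | zero => simp
    | succ k ih =>
      have h1 : σ^[k + 1] y = ζ ^ m * (v ^ I / theta ζ (ζ⁻¹ ^ (I * k) * u) I * σ^[k] y) := by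
        rw [Function.iterate_succ_apply, h, ← RingHom.coe_pow, map_mul, map_mul, map_div₀, map_pow,
          RingHom.coe_pow, hfix, Function.iterate_fixed hσ, ← hiter]
        congr 4
        clear ih
        induction k with
        | zero => simp
        | succ k ih => rw [Function.iterate_succ_apply', Function.iterate_succ_apply', ih, map_theta hσ]
      rw [prod_range_succ, h1]
      have hT := hne k
      clear h1
      generalize theta ζ (ζ⁻¹ ^ (I * k) * u) I = T at hT ⊢
      generalize ∏ i ∈ range k, theta ζ (ζ⁻¹ ^ (I * i) * u) I = P at ih ⊢
      field_simp
      linear_combination (v ^ I * ζ ^ m) * ih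
  have h2 := key p
  rw [prod_theta hζ u hI, mul_comm m, pow_mul, hζ.pow_eq_one, one_pow, one_mul, mul_comm I,
    pow_mul, hv, mul_comm] at h2
  exact mul_left_cancel₀ (pow_ne_zero _ (sub_ne_zero.mpr hu.symm)) h2

omit hp in
-- `ρ` fixes `u`, hence `theta`, and only `v ^ I` in the multiplier of `σ` feels it, by `ζ ^ (d *
-- I)`. Writing the commutator as `c σ ρ = ρ σ` avoids inverses.
theorem commutator_eq_of_mul (hp0 : p ≠ 0) (hσ : σ ζ = ζ) (hρ : ρ ζ = ζ) (hρu : ρ u = u) {d m n : ℕ}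
    (hρv : ρ v = ζ ^ d * v) (hσy : σ y = ζ ^ m * (v ^ I / theta ζ u I * y))
    (hρy : ρ y = ζ ^ n * y) (hv0 : v ≠ 0) (hθ : theta ζ u I ≠ 0)
    (hcζ : c ζ = ζ) (hcu : c u = u) (hcv : c v = v) (hc : c (σ (ρ y)) = ρ (σ y)) :
    c y = ζ ^ (d * I) * y := by
  have hζ0 : ζ ≠ 0 := hζ.ne_zero hp0
  rw [hρy, hσy] at hc
  simp only [map_mul, map_pow, map_div₀, hσ, hσy, hcζ, hcu, hcv, map_theta hcζ, hρ, hρv,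
    map_theta hρ, hρu, hρy] at hc
  have h1 : ζ ^ n * ζ ^ m * (v ^ I / theta ζ u I) ≠ 0 := by positivity
  apply mul_left_cancel₀ h1
  rw [pow_mul]
  linear_combination hc

omit hp in
theorem commutator_eq_of_fixed (hp0 : p ≠ 0) (hσ : σ ζ = ζ) (hρ : ρ ζ = ζ) {m n : ℕ}
    (hσy : σ y = ζ ^ m * y) (hρy : ρ y = ζ ^ n * y)
    (hcζ : c ζ = ζ) (hc : c (σ (ρ y)) = ρ (σ y)) : c y = y := by
  have hζ0 : ζ ≠ 0 := hζ.ne_zero hp0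
  rw [hρy, hσy] at hc
  simp only [map_mul, map_pow, hσ, hσy, hcζ, hρ, hρy] at hc
  have h1 : ζ ^ n * ζ ^ m ≠ 0 := mul_ne_zero (pow_ne_zero _ hζ0) (pow_ne_zero _ hζ0)
  apply mul_left_cancel₀ h1
  linear_combination hc

end Action

end FermatHeis

/-! ### The field `L` and its Galois group over `K` -/

namespace FermatHeis

open IntermediateField

variable {Ω : Type*} [Field Ω] [CharZero Ω] {p : ℕ} [hp : Fact p.Prime] {ζ : Ω}
  (hζ : IsPrimitiveRoot ζ p)

/-- `ζ` as an element of `K`. -/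
def zetaK (ζ : Ω) : fieldK ζ := ⟨ζ, zeta_mem_fieldK⟩

include hζ

theorem isPrimitiveRoot_zetaK : IsPrimitiveRoot (zetaK ζ) p :=
  IsPrimitiveRoot.of_map_of_injective (f := (fieldK ζ).val) hζ (fieldK ζ).val.injective

omit hp in
theorem mem_fieldL_of_pow_eq {x : Ω} {i : ℕ} (hx : x ^ p = 1 - ζ ^ i) : x ∈ fieldL p ζ := by
  apply subset_adjoin
  change 1 - (1 - x ^ p) ^ p = 0
  rw [hx, sub_sub_cancel, ← pow_mul, mul_comm, pow_mul, hζ.pow_eq_one, one_pow, sub_self]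

omit hζ hp in
theorem zeta_mem_fieldL : ζ ∈ fieldL p ζ := (fieldL p ζ).algebraMap_mem (zetaK ζ)

theorem inv_pow_eq {i : ℕ} (hi : i ≤ p) : (ζ ^ i)⁻¹ = ζ ^ (p - i) := by
  rw [inv_eq_iff_eq_inv, ← mul_eq_one_iff_eq_inv₀ (pow_ne_zero _ (hζ.ne_zero hp.out.ne_zero)),
    ← pow_add, Nat.add_sub_cancel' hi, hζ.pow_eq_one]

theorem mem_fieldL_of_pow_eq_inv {x : Ω} {i : ℕ} (hi : i ≤ p) (hx : x ^ p = 1 - (ζ ^ i)⁻¹) :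
    x ∈ fieldL p ζ :=
  mem_fieldL_of_pow_eq hζ (i := p - i) (by rw [hx, inv_pow_eq hζ hi])

theorem exists_eq_zeta_pow_mul {x y : Ω} (h : x ^ p = y ^ p) : ∃ m : ℕ, x = ζ ^ m * y := by
  by_cases hy : y = 0
  · rw [hy, zero_pow hp.out.ne_zero] at h
    exact ⟨0, by rw [pow_eq_zero_iff hp.out.ne_zero] at h; rw [h, hy, mul_zero]⟩
  · exact exists_eq_pow_mul_of_pow_eq hζ hy h

/-- The extension `L` contains the `p`-th roots of `ζ`. -/
theorem mem_fieldL_of_pow_eq_zeta [IsAlgClosed Ω] (hp2 : p ≠ 2) {w : Ω} (hw : w ^ p = ζ) :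
    w ∈ fieldL p ζ := by
  obtain ⟨a, ha⟩ := IsAlgClosed.exists_pow_nat_eq (1 - ζ ^ 1) hp.out.pos
  obtain ⟨b, hb⟩ := IsAlgClosed.exists_pow_nat_eq (1 - (ζ ^ 1)⁻¹) hp.out.pos
  have hζ0 : ζ ≠ 0 := hζ.ne_zero hp.out.ne_zero
  have hb0 : (1 : Ω) - (ζ ^ 1)⁻¹ ≠ 0 := by
    rw [pow_one]
    exact sub_ne_zero.mpr (hζ.inv.ne_one hp.out.one_lt).symm
  -- This uses `ζ = -(1 - ζ) / (1 - ζ⁻¹)`, the sign being a `p`-th power as `p` is odd.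
  have h : w ^ p = (-(a / b)) ^ p := by
    rw [(hp.out.odd_of_ne_two hp2).neg_pow, div_pow, ha, hb, hw]
    rw [pow_one] at hb0 ⊢
    have h2 : ζ - 1 ≠ 0 := sub_ne_zero.mpr (hζ.ne_one hp.out.one_lt)
    field_simp
    ring
  obtain ⟨m, rfl⟩ := exists_eq_zeta_pow_mul hζ h
  exact mul_mem (pow_mem zeta_mem_fieldL m) (neg_mem (div_mem (mem_fieldL_of_pow_eq hζ ha)
    (mem_fieldL_of_pow_eq_inv hζ hp.out.one_lt.le hb)))

theorem mem_fieldL_of_pow_eq_kummerGen [IsAlgClosed Ω] (hp2 : p ≠ 2) {x : Ω} {i : ℕ} (hi : i ≤ p)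
    (hx : x ^ p = kummerGen ζ i) : x ∈ fieldL p ζ := by
  rw [kummerGen] at hx
  split_ifs at hx
  · exact mem_fieldL_of_pow_eq_zeta hζ hp2 hx
  · exact mem_fieldL_of_pow_eq_inv hζ hi hx

omit hζ in
theorem halfRank_eq (hp2 : p ≠ 2) : p = 2 * halfRank p + 1 := by
  have := hp.out.eq_two_or_odd
  unfold halfRank
  omega

theorem kummerGen_ne_zero {i : ℕ} (hi : i < p) : kummerGen ζ i ≠ 0 := by
  rw [kummerGen]
  split_ifs with h
  · exact hζ.ne_zero hp.out.ne_zero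
  · rw [sub_ne_zero, ne_comm, inv_ne_one]
    exact hζ.pow_ne_one_of_pos_of_lt h hi

omit hζ hp in
theorem kummerGen_mem_fieldK (i : ℕ) : kummerGen ζ i ∈ fieldK ζ := by
  have h : ζ ∈ fieldK ζ := zeta_mem_fieldK
  rw [kummerGen]
  split_ifs
  · exact h
  · exact sub_mem (one_mem _) (inv_mem (pow_mem h i))

/-- `L` is generated by `p`-th roots of the Kummer generators. -/
theorem fieldL_eq_adjoin [IsAlgClosed Ω] (hp2 : p ≠ 2) {x : Fin (halfRank p + 1) → Ω}
    (hx : ∀ j, x j ^ p = kummerGen ζ j) :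
    fieldL p ζ = adjoin (fieldK ζ) (Set.range x) := by
  have hr := halfRank_eq hp2
  apply le_antisymm
  · rw [fieldL, adjoin_le_iff]
    intro y hy
    change 1 - (1 - y ^ p) ^ p = 0 at hy
    have hmem : ∀ j, x j ∈ adjoin (fieldK ζ) (Set.range x) := fun j ↦ subset_adjoin _ _ ⟨j, rfl⟩
    have hζm : ζ ∈ adjoin (fieldK ζ) (Set.range x) :=
      IntermediateField.algebraMap_mem _ (zetaK ζ)
    obtain ⟨i, hi, hi'⟩ := hζ.eq_pow_of_pow_eq_one (sub_eq_zero.mp hy).symm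
    have hy' : y ^ p = 1 - ζ ^ i := by rw [hi', sub_sub_cancel]
    by_cases hi0 : i = 0
    · rw [hi0, pow_zero, sub_self, pow_eq_zero_iff hp.out.ne_zero] at hy'
      rw [hy']
      exact zero_mem _
    -- If `p - i ≤ r` then `1 - ζ ^ i` is the generator of index `p - i`. Otherwise `i ≤ r` and `1 -
    -- ζ ^ i = -ζ ^ i * (1 - ζ ^ (-i))`.
    by_cases hir : p - i ≤ halfRank p
    · have h1 : y ^ p = x ⟨p - i, by omega⟩ ^ p := by
        rw [hx, hy', kummerGen, if_neg (by simp; omega)]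
        simp only
        rw [inv_pow_eq hζ (by omega), Nat.sub_sub_self hi.le]
      obtain ⟨m, rfl⟩ := exists_eq_zeta_pow_mul hζ h1
      exact mul_mem (pow_mem hζm m) (hmem _)
    · have h1 : y ^ p = (-(x 0 ^ i * x ⟨i, by omega⟩)) ^ p := by
        rw [(hp.out.odd_of_ne_two hp2).neg_pow, mul_pow, ← pow_mul, mul_comm i, pow_mul, hx, hx,
          hy', kummerGen, kummerGen, if_pos (by simp), if_neg (by simpa using hi0)]
        simp only
        have : ζ ^ i ≠ 0 := pow_ne_zero _ (hζ.ne_zero hp.out.ne_zero)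
        field_simp
        ring
      obtain ⟨m, rfl⟩ := exists_eq_zeta_pow_mul hζ h1
      exact mul_mem (pow_mem hζm m) (neg_mem (mul_mem (pow_mem (hmem _) i) (hmem _)))
  · rw [adjoin_le_iff]
    rintro _ ⟨j, rfl⟩
    exact mem_fieldL_of_pow_eq_kummerGen hζ hp2 (by omega) (hx j)

/-- The Galois group of `L / K`. -/
theorem exists_kummerEquiv_fieldL [IsAlgClosed Ω] (hp2 : p ≠ 2) (hV : ¬ p ∣ hPlus ζ)
    {x : Fin (halfRank p + 1) → fieldL p ζ} (hx : ∀ j, (x j : Ω) ^ p = kummerGen ζ j) :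
    ∃ κ : Gal((fieldL p ζ)/(fieldK ζ)) ≃* Multiplicative (Fin (halfRank p + 1) → ZMod p), ∀ σ i,
      ((σ (x i) : fieldL p ζ) : Ω) = AddChar.zmodChar p hζ.pow_eq_one ((κ σ).toAdd i) * (x i : Ω) := by
  have hr := halfRank_eq hp2
  obtain ⟨κ, hκ⟩ := exists_kummerEquiv (isPrimitiveRoot_zetaK hζ)
    (x := fun j ↦ (x j : Ω)) (t := fun j ↦ ⟨kummerGen ζ j, kummerGen_mem_fieldK j⟩)
    (fieldL_eq_adjoin hζ hp2 hx) hx (fun j ↦ (x j).2)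
    (fun j h ↦ kummerGen_ne_zero hζ (by omega) (congrArg Subtype.val h))
    (fun e u hu i ↦ dvd_of_prod_kummerGen_eq_pow hζ hp2 hV u.2 (by
      have h1 := congrArg (algebraMap (fieldK ζ) Ω) hu
      rw [map_prod, map_pow] at h1
      simpa using h1) i)
  refine ⟨κ, fun σ i ↦ ?_⟩
  have h2 := congrArg (algebraMap (fieldL p ζ) Ω) (hκ σ i)
  rw [map_mul] at h2
  exact h2

theorem finiteDimensional_fieldL [IsAlgClosed Ω] (hp2 : p ≠ 2) :
    FiniteDimensional (fieldK ζ) (fieldL p ζ) := by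
  choose x hx using fun j : Fin (halfRank p + 1) ↦
    IsAlgClosed.exists_pow_nat_eq (kummerGen ζ j) hp.out.pos
  exact finiteDimensional_kummer (t := fun j ↦ ⟨kummerGen ζ j, kummerGen_mem_fieldK j⟩)
    (fieldL_eq_adjoin hζ hp2 hx) hx

omit hζ in
theorem exists_roots_kummerGen [IsAlgClosed Ω] (hζ : IsPrimitiveRoot ζ p) (hp2 : p ≠ 2) :
    ∃ x : Fin (halfRank p + 1) → fieldL p ζ, ∀ j, (x j : Ω) ^ p = kummerGen ζ j := by
  have hr := halfRank_eq hp2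
  choose x hx using fun j : Fin (halfRank p + 1) ↦
    IsAlgClosed.exists_pow_nat_eq (kummerGen ζ j) hp.out.pos
  exact ⟨fun j ↦ ⟨x j, mem_fieldL_of_pow_eq_kummerGen hζ hp2 (by omega) (hx j)⟩, hx⟩

theorem gal_fieldL_pow_eq_one [IsAlgClosed Ω] (hp2 : p ≠ 2) (hV : ¬ p ∣ hPlus ζ)
    (σ : Gal((fieldL p ζ)/(fieldK ζ))) : σ ^ p = 1 := by
  obtain ⟨x, hx⟩ := exists_roots_kummerGen hζ hp2
  obtain ⟨κ, -⟩ := exists_kummerEquiv_fieldL hζ hp2 hV hx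
  apply κ.injective
  rw [map_pow, map_one, ← ofAdd_toAdd (κ σ), ← ofAdd_nsmul, ← ofAdd_zero]
  congr 1
  funext i
  simp

theorem gal_fieldL_comm [IsAlgClosed Ω] (hp2 : p ≠ 2) (hV : ¬ p ∣ hPlus ζ)
    (σ τ : Gal((fieldL p ζ)/(fieldK ζ))) : σ * τ = τ * σ := by
  obtain ⟨x, hx⟩ := exists_roots_kummerGen hζ hp2
  obtain ⟨κ, -⟩ := exists_kummerEquiv_fieldL hζ hp2 hV hx
  apply κ.injective
  rw [map_mul, map_mul, mul_comm]

theorem exists_isKummerDual [IsAlgClosed Ω] (hp2 : p ≠ 2) (hV : ¬ p ∣ hPlus ζ) :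
    ∃ τ, IsKummerDual p ζ τ := by
  obtain ⟨x, hx⟩ := exists_roots_kummerGen hζ hp2
  obtain ⟨κ, hκ⟩ := exists_kummerEquiv_fieldL hζ hp2 hV hx
  refine ⟨fun i ↦ κ.symm (Multiplicative.ofAdd (Pi.single i 1)), fun i j y hy ↦ ?_⟩
  -- The definition speaks of every `p`-th root of `tⱼ`; each is the chosen root times a power of
  -- `ζ`, which lies in `K`.
  obtain ⟨m, hm⟩ := exists_eq_zeta_pow_mul hζ (hy.trans (hx j).symm)
  have hy' : y = algebraMap (fieldK ζ) (fieldL p ζ) (zetaK ζ) ^ m * x j := Subtype.ext hm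
  have h1 : (1 : ZMod p).val = 1 := ZMod.val_one p
  have h2 := hκ (κ.symm (Multiplicative.ofAdd (Pi.single i 1))) j
  rw [MulEquiv.apply_symm_apply, toAdd_ofAdd] at h2
  conv_lhs => rw [hy', map_mul, map_pow, AlgEquiv.commutes]
  have h3 : ∀ a b : fieldL p ζ, ((a * b : fieldL p ζ) : Ω) = a * b := fun _ _ ↦ rfl
  have h4 : ((algebraMap (fieldK ζ) (fieldL p ζ) (zetaK ζ) ^ m : fieldL p ζ) : Ω) = ζ ^ m := rfl
  rw [h3, h2, h4, hm]
  by_cases hij : j = i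
  · subst hij
    rw [Pi.single_eq_same, if_pos rfl, AddChar.zmodChar_apply, h1]
    ring
  · rw [Pi.single_eq_of_ne hij, if_neg hij, AddChar.map_zero_eq_one, one_mul]

end FermatHeis

/-! ### Ramification in Kummer extensions -/

section Unramified

open NumberField Polynomial

/-- An extension `L(g ^ (1 / p))` is unramified at the primes not containing `p * g`. -/
theorem isUnramifiedAt_of_pow_eq {p : ℕ} {L F : Type*} [Field L] [NumberField L]
    [Field F] [NumberField F] [Algebra L F] {y : 𝓞 F} {g : 𝓞 L} (hy : y ^ p = algebraMap (𝓞 L) (𝓞 F) g)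
    (hgen : Algebra.adjoin L {(y : F)} = ⊤) (P : Ideal (𝓞 F)) [P.IsPrime] (hpP : (p : 𝓞 F) ∉ P)
    (hyP : y ∉ P) : Algebra.IsUnramifiedAt (𝓞 L) P := by
  rw [← not_dvd_differentIdeal_iff]
  intro hdvd
  have h1 := aeval_derivative_mem_differentIdeal (𝓞 L) L F y hgen
  have hint : IsIntegral (𝓞 L) y := Algebra.IsIntegral.isIntegral y
  -- Differentiating `X ^ p - g = minpoly * q` at `y` shows that `p * y ^ (p - 1)` is a multiple of
  -- the derivative of the minimal polynomial, which lies in the different.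
  obtain ⟨q, hq⟩ : minpoly (𝓞 L) y ∣ X ^ p - C g :=
    minpoly.isIntegrallyClosed_dvd hint (by simp [hy])
  have h2 := congrArg (fun f ↦ aeval y (derivative f)) hq
  simp only [derivative_sub, derivative_X_pow, derivative_C, derivative_mul, map_add, map_mul,
    minpoly.aeval, zero_mul, add_zero, sub_zero, map_pow, aeval_X, map_natCast] at h2
  have h3 : (p : 𝓞 F) * y ^ (p - 1) ∈ P := by
    rw [h2]
    exact Ideal.mul_mem_right _ _ (Ideal.le_of_dvd hdvd h1)
  rcases ‹P.IsPrime›.mem_or_mem h3 with h | h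
  · exact hpP h
  · exact hyP (‹P.IsPrime›.mem_of_pow_mem _ h)

end Unramified

namespace FermatHeis

open IntermediateField

/-- `ζ` as an element of `L`. -/
noncomputable def zetaL {Ω : Type*} [Field Ω] [CharZero Ω] (p : ℕ) (ζ : Ω) : fieldL p ζ :=
  algebraMap (fieldK ζ) (fieldL p ζ) (zetaK ζ)

theorem algEquiv_pow_apply {K M : Type*} [Field K] [Field M] [Algebra K M] (σ : Gal(M/K)) (n : ℕ)
    (y : M) : (σ ^ n) y = (⇑σ)^[n] y := by
  induction n with
  | zero => rfl
  | succ n ih => rw [pow_succ', Function.iterate_succ_apply', AlgEquiv.mul_apply, ih]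

/-! ### Lifts of the `τᵢ` to an extension of `L` -/

section Lifts

variable {Ω : Type*} [Field Ω] [CharZero Ω] [IsAlgClosed Ω] {p : ℕ} [hp : Fact p.Prime] {ζ : Ω}
  (hζ : IsPrimitiveRoot ζ p) (hp2 : p ≠ 2)
  {τ : Fin (halfRank p + 1) → Gal((fieldL p ζ)/(fieldK ζ))} (hτ : IsKummerDual p ζ τ)
  {M : Type*} [Field M] [Algebra (fieldK ζ) M] [Algebra (fieldL p ζ) M]
  [IsScalarTower (fieldK ζ) (fieldL p ζ) M]
  {σ : Fin (halfRank p + 1) → Gal(M/(fieldK ζ))}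
  (hσ : ∀ i x, σ i (algebraMap (fieldL p ζ) M x) = algebraMap (fieldL p ζ) M (τ i x))

omit [IsAlgClosed Ω] hp in
include hτ in
theorem kummerDual_apply (i j : Fin (halfRank p + 1)) {x : fieldL p ζ}
    (hx : (x : Ω) ^ p = kummerGen ζ j) : τ i x = if j = i then zetaL p ζ * x else x := by
  apply Subtype.ext
  rw [hτ i j x hx]
  split_ifs <;> rfl

include hσ in
theorem lift_pow_algebraMap (hζ : IsPrimitiveRoot ζ p) (hp2 : p ≠ 2) (hV : ¬ p ∣ hPlus ζ)
    (i : Fin (halfRank p + 1)) (x : fieldL p ζ) :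
    (σ i ^ p) (algebraMap (fieldL p ζ) M x) = algebraMap (fieldL p ζ) M x := by
  have h : ∀ n : ℕ, (σ i ^ n) (algebraMap (fieldL p ζ) M x) =
      algebraMap (fieldL p ζ) M ((τ i ^ n) x) := by
    intro n
    induction n with
    | zero => rfl
    | succ n ih => rw [pow_succ', AlgEquiv.mul_apply, ih, hσ, pow_succ', AlgEquiv.mul_apply]
  rw [h, gal_fieldL_pow_eq_one hζ hp2 hV]
  rfl

include hσ in
theorem lift_commutator_algebraMap (hζ : IsPrimitiveRoot ζ p) (hp2 : p ≠ 2) (hV : ¬ p ∣ hPlus ζ)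
    (j k : Fin (halfRank p + 1)) (x : fieldL p ζ) :
    (σ k * σ j * (σ k)⁻¹ * (σ j)⁻¹) (algebraMap (fieldL p ζ) M x) = algebraMap (fieldL p ζ) M x := by
  have h1 : ∀ i x, (σ i)⁻¹ (algebraMap (fieldL p ζ) M x) =
      algebraMap (fieldL p ζ) M ((τ i)⁻¹ x) := by
    intro i x
    apply (σ i).injective
    rw [← AlgEquiv.mul_apply, mul_inv_cancel, AlgEquiv.one_apply, hσ, ← AlgEquiv.mul_apply,
      mul_inv_cancel, AlgEquiv.one_apply]
  have hc : τ k * τ j * (τ k)⁻¹ * (τ j)⁻¹ = 1 := by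
    rw [gal_fieldL_comm hζ hp2 hV (τ k), mul_inv_cancel_right, mul_inv_cancel]
  simp only [AlgEquiv.mul_apply, h1, hσ]
  exact congrArg (algebraMap (fieldL p ζ) M) (DFunLike.congr_fun hc x)

variable {wL : fieldL p ζ} (hw : (wL : Ω) ^ p = ζ) {I : ℕ} (hI1 : 1 ≤ I) (hI2 : I ≤ halfRank p) {y : M}
  (hy : y ^ p = algebraMap (fieldL p ζ) M (gamProd p (zetaL p ζ) (wL ^ I)⁻¹))

include hζ in
omit [IsAlgClosed Ω] in
theorem isPrimitiveRoot_zetaL : IsPrimitiveRoot (zetaL p ζ) p :=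
  (isPrimitiveRoot_zetaK hζ).map_of_injective (algebraMap (fieldK ζ) (fieldL p ζ)).injective

include hζ hp2 hw hI1 hI2 in
omit [IsAlgClosed Ω] in
theorem inv_pow_pow_ne_one : (wL ^ I)⁻¹ ^ p ≠ 1 := by
  have hr := halfRank_eq hp2
  intro h
  have h1 : (ζ ^ I)⁻¹ = 1 := by
    rw [← hw, ← pow_mul, mul_comm, pow_mul, ← inv_pow]
    exact congrArg Subtype.val h
  rw [inv_eq_one] at h1
  exact hζ.pow_ne_one_of_pos_of_lt (by omega) (by omega) h1

/-- The data attached to `γ_I` in `M`, and the action of the lifts `σ i` on it. -/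
structure LiftData {M : Type*} [Field M] (p I r : ℕ) (σ : Fin (r + 1) → M →+* M) (z u v y : M) :
    Prop where
  prim : IsPrimitiveRoot z p
  u_pow_ne_one : u ^ p ≠ 1
  v_pow : v ^ p = 1 - u ^ p
  y_pow : y ^ p = gamProd p z u
  map_z : ∀ i, σ i z = z
  map_zero_u : σ 0 u = z⁻¹ ^ I * u
  map_u : ∀ i, i ≠ 0 → σ i u = u
  map_v : ∀ i, σ i v = z ^ (if (i : ℕ) = I then 1 else 0) * v

include hζ hp2 hτ hσ hw hI1 hI2 hy in
theorem exists_liftData : ∃ v : fieldL p ζ, LiftData p I (halfRank p) (fun i ↦ ((σ i : M →ₐ[fieldK ζ] M) : M →+* M))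
    (algebraMap (fieldL p ζ) M (zetaL p ζ)) (algebraMap (fieldL p ζ) M (wL ^ I)⁻¹)
    (algebraMap (fieldL p ζ) M v) y := by
  have hr := halfRank_eq hp2
  obtain ⟨v, hv⟩ := IsAlgClosed.exists_pow_nat_eq (kummerGen ζ I) hp.out.pos
  let vL : fieldL p ζ := ⟨v, mem_fieldL_of_pow_eq_kummerGen hζ hp2 (by omega) hv⟩
  have hwinv : ((wL ^ I)⁻¹ : fieldL p ζ) ^ p = (zetaL p ζ ^ I)⁻¹ := by
    apply Subtype.ext
    change ((wL : Ω) ^ I)⁻¹ ^ p = (ζ ^ I)⁻¹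
    rw [inv_pow, ← pow_mul, mul_comm, pow_mul, hw]
  have hvL : vL ^ p = 1 - (wL ^ I)⁻¹ ^ p := by
    rw [hwinv]
    apply Subtype.ext
    refine hv.trans ?_
    rw [kummerGen, if_neg (by omega)]
    rfl
  have hwτ : ∀ i, τ i wL = if 0 = i then zetaL p ζ * wL else wL := fun i ↦
    kummerDual_apply hτ i 0 (by rw [hw]; simp [kummerGen])
  have hvτ : ∀ i, τ i vL = if (⟨I, by omega⟩ : Fin (halfRank p + 1)) = i then zetaL p ζ * vL
      else vL := fun i ↦ kummerDual_apply hτ i _ hv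
  have hσ' : ∀ i x, ((σ i : M →ₐ[fieldK ζ] M) : M →+* M) (algebraMap (fieldL p ζ) M x) =
      algebraMap (fieldL p ζ) M (τ i x) := hσ
  have hzτ : ∀ i, τ i (zetaL p ζ) = zetaL p ζ := fun i ↦ (τ i).commutes _
  refine ⟨vL, ⟨(isPrimitiveRoot_zetaL hζ).map_of_injective
    (algebraMap (fieldL p ζ) M).injective, ?_, ?_, ?_, fun i ↦ ?_, ?_, fun i hi ↦ ?_, fun i ↦ ?_⟩⟩
  · rw [← map_pow, Ne, map_eq_one_iff _ (algebraMap (fieldL p ζ) M).injective]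
    exact inv_pow_pow_ne_one hζ hp2 hw hI1 hI2
  · rw [← map_pow, hvL, map_sub, map_one, map_pow]
  · rw [hy]
    simp [gamProd]
  · rw [hσ', hzτ]
  · rw [hσ', map_inv₀, map_pow, hwτ, if_pos rfl, mul_pow, mul_inv, map_mul, map_inv₀, map_inv₀,
      map_pow, map_pow, inv_pow]
  · rw [hσ', map_inv₀, map_pow, hwτ, if_neg hi.symm]
  · rw [hσ', hvτ]
    simp only [Fin.ext_iff, eq_comm (a := I)]
    split_ifs <;> simp

include hζ hp2 hτ hσ hw hI1 hI2 hy in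
theorem lift_pow_apply (i : Fin (halfRank p + 1)) : (σ i ^ p) y = y := by
  have hr := halfRank_eq hp2
  obtain ⟨v, hd⟩ := exists_liftData hζ hp2 hτ hσ hw hI1 hI2 hy
  rw [algEquiv_pow_apply]
  by_cases hi : i = 0
  · subst hi
    obtain ⟨m, hm⟩ := exists_map_eq_of_mul hd.prim (hd.map_z 0) hd.u_pow_ne_one hd.y_pow hd.v_pow
      hd.map_zero_u
    refine iterate_eq_of_mul hd.prim (hd.map_z 0) hd.u_pow_ne_one hd.v_pow hd.map_zero_u ?_
      (Nat.not_dvd_of_pos_of_lt (by omega) (by omega)) hm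
    rw [hd.map_v, if_neg (by simp; omega), pow_zero, one_mul]
  · obtain ⟨m, hm⟩ := exists_map_eq_of_fixed hd.prim (hd.map_z i) hd.u_pow_ne_one hd.y_pow
      (hd.map_u i hi)
    exact iterate_eq_of_fixed hd.prim (hd.map_z i) hm

include hζ hp2 hτ hσ hw hI1 hI2 hy in
-- The field `M` is left arbitrary for two uses: an algebraic closure of `L`, where this proves
-- independence of the `γ_I`, and `E`, where it computes the commutators of the theorem.
theorem lift_commutator_apply (hV : ¬ p ∣ hPlus ζ) {j k : Fin (halfRank p + 1)} (hjk : j < k) :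
    (σ k * σ j * (σ k)⁻¹ * (σ j)⁻¹) y =
      algebraMap (fieldL p ζ) M (zetaL p ζ) ^ (if j = 0 ∧ (k : ℕ) = I then I else 0) * y := by
  have hk0 : k ≠ 0 := (lt_of_le_of_lt (Fin.zero_le j) hjk).ne'
  obtain ⟨v, hd⟩ := exists_liftData hζ hp2 hτ hσ hw hI1 hI2 hy
  set c := σ k * σ j * (σ k)⁻¹ * (σ j)⁻¹ with hc
  have hcL := lift_commutator_algebraMap hσ hζ hp2 hV j k
  have hcσ : c (σ j (σ k y)) = σ k (σ j y) := by
    simp only [← AlgEquiv.mul_apply, hc]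
    congr 1
    group
  obtain ⟨n, hn⟩ := exists_map_eq_of_fixed hd.prim (hd.map_z k) hd.u_pow_ne_one hd.y_pow
      (hd.map_u k hk0)
  by_cases hj : j = 0
  · subst hj
    obtain ⟨m, hm⟩ := exists_map_eq_of_mul hd.prim (hd.map_z 0) hd.u_pow_ne_one hd.y_pow hd.v_pow
      hd.map_zero_u
    have hv0 : algebraMap (fieldL p ζ) M v ≠ 0 := fun h ↦ by
      have h1 := hd.v_pow
      rw [h, zero_pow hp.out.ne_zero, eq_comm, sub_eq_zero] at h1
      exact hd.u_pow_ne_one h1.symm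
    have h := commutator_eq_of_mul hd.prim hp.out.ne_zero (hd.map_z 0) (hd.map_z k)
      (hd.map_u k hk0) (hd.map_v k) hm hn hv0 (theta_ne_zero hd.prim hd.u_pow_ne_one I)
      (c := ((c : M →ₐ[fieldK ζ] M) : M →+* M)) (hcL _) (hcL _) (hcL _) hcσ
    refine h.trans ?_
    simp
  · obtain ⟨m, hm⟩ := exists_map_eq_of_fixed hd.prim (hd.map_z j) hd.u_pow_ne_one hd.y_pow
      (hd.map_u j hj)
    have h := commutator_eq_of_fixed hd.prim hp.out.ne_zero (hd.map_z j) (hd.map_z k) hm hn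
      (c := ((c : M →ₐ[fieldK ζ] M) : M →+* M)) (hcL _) hcσ
    refine h.trans ?_
    simp [hj]

end Lifts

end FermatHeis

/-! ### The fields `L R_I`: independence and ramification -/

namespace FermatHeis

open IntermediateField

theorem one_sub_dvd_natCast {R : Type*} [CommRing R] [IsDomain R] {p : ℕ} (hp : 1 < p) {ξ : R}
    (hξ : IsPrimitiveRoot ξ p) : 1 - ξ ∣ (p : R) := by
  have h : (p : R) = ∑ k ∈ Finset.range p, (1 - ξ ^ k) := by
    rw [Finset.sum_sub_distrib, hξ.geom_sum_eq_zero hp]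
    simp
  rw [h]
  refine Finset.dvd_sum fun k _ ↦ ?_
  simpa using sub_dvd_pow_sub_pow 1 ξ k

/-- Each factor `1 - z ^ j * u` divides `1 - u ^ p`, which divides `p`. -/
theorem natCast_mem_of_prod_mem {R : Type*} [CommRing R] [IsDomain R] {p : ℕ} (hp : 1 < p)
    (P : Ideal R) [hP : P.IsPrime] {z u : R} (hz : z ^ p = 1) (hu : IsPrimitiveRoot (u ^ p) p)
    (h : ∏ j ∈ Finset.range p, (1 - z ^ j * u) ^ j ∈ P) : (p : R) ∈ P := by
  obtain ⟨j, -, hj⟩ := hP.prod_mem_iff.mp h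
  have h1 := hP.mem_of_pow_mem _ hj
  have h2 : 1 - z ^ j * u ∣ 1 - u ^ p := by
    have h3 := sub_dvd_pow_sub_pow 1 (z ^ j * u) p
    rwa [one_pow, mul_pow, ← pow_mul, mul_comm j, pow_mul, hz, one_pow, one_mul] at h3
  exact P.mem_of_dvd (h2.trans (one_sub_dvd_natCast hp hu)) h1

/-- The extension obtained by adjoining a `p`-th root of `γ` is unramified outside `p`. -/
theorem isUnramifiedAt_of_pow_eq_gamProd {p : ℕ} [hp : Fact p.Prime] {L F : Type*} [Field L]
    [Field F] [NumberField L] [NumberField F] [Algebra L F] {z u : L} (hz : IsPrimitiveRoot z p)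
    (hu : IsPrimitiveRoot (u ^ p) p) {y : F} (hy : y ^ p = algebraMap L F (gamProd p z u))
    (hgen : Algebra.adjoin L {y} = ⊤) (P : Ideal (𝓞 F)) [P.IsPrime] (hP : (p : 𝓞 F) ∉ P) :
    Algebra.IsUnramifiedAt (𝓞 L) P := by
  let zO : 𝓞 L := hz.toInteger
  have huint : IsIntegral ℤ u := IsIntegral.of_pow hp.out.pos (hu.isIntegral hp.out.pos)
  let uO : 𝓞 L := ⟨u, huint⟩
  let gO : 𝓞 L := ∏ j ∈ Finset.range p, (1 - zO ^ j * uO) ^ j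
  have hgO : algebraMap (𝓞 L) L gO = gamProd p z u := by
    simp only [gO, map_prod, map_pow, map_sub, map_one, map_mul]
    rfl
  have hyint : IsIntegral ℤ y := by
    refine IsIntegral.of_pow hp.out.pos ?_
    rw [hy, ← hgO]
    exact gO.2.map (algebraMap L F).toIntAlgHom
  let yO : 𝓞 F := ⟨y, hyint⟩
  have hyO : yO ^ p = algebraMap (𝓞 L) (𝓞 F) gO := by
    apply NumberField.RingOfIntegers.ext
    change y ^ p = algebraMap L F (algebraMap _ _ gO)
    rw [hy, hgO]
  refine isUnramifiedAt_of_pow_eq hyO hgen P hP fun hyP ↦ hP ?_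
  have h1 : gO ∈ P.comap (algebraMap (𝓞 L) (𝓞 F)) := by
    rw [Ideal.mem_comap, ← hyO]
    exact P.pow_mem_of_mem hyP _ hp.out.pos
  have h2 := natCast_mem_of_prod_mem hp.out.one_lt (P.comap (algebraMap (𝓞 L) (𝓞 F)))
    hz.toInteger_isPrimitiveRoot.pow_eq_one
    (hu.toInteger_isPrimitiveRoot : IsPrimitiveRoot (uO ^ p) p) h1
  rwa [Ideal.mem_comap, map_natCast] at h2

variable {Ω : Type*} [Field Ω] [CharZero Ω] {p : ℕ} [hp : Fact p.Prime] {ζ : Ω}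
  (hζ : IsPrimitiveRoot ζ p) (hp2 : p ≠ 2)

theorem coe_gamProd_fieldL (wL : fieldL p ζ) (I : ℕ) :
    ((gamProd p (zetaL p ζ) (wL ^ I)⁻¹ : fieldL p ζ) : Ω) = gam p ζ (wL : Ω) I := by
  rw [gam_eq_gamProd]
  change algebraMap (fieldL p ζ) Ω _ = _
  simp only [gamProd, map_prod, map_pow, map_sub, map_one, map_mul, map_inv₀]
  rfl

variable [IsAlgClosed Ω]

/-- An algebraic closure of `L` replaces `Ω`, which need not be algebraic over `K`, so that
normality provides the lifts. -/
theorem exists_lifts (τ : Gal((fieldL p ζ)/(fieldK ζ))) (hL : FiniteDimensional (fieldK ζ) (fieldL p ζ)) :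
    ∃ σ : Gal((AlgebraicClosure (fieldL p ζ))/(fieldK ζ)), ∀ x,
      σ (algebraMap (fieldL p ζ) (AlgebraicClosure (fieldL p ζ)) x) =
        algebraMap (fieldL p ζ) (AlgebraicClosure (fieldL p ζ)) (τ x) := by
  have : Algebra.IsAlgebraic (fieldK ζ) (AlgebraicClosure (fieldL p ζ)) :=
    Algebra.IsAlgebraic.trans (fieldK ζ) (fieldL p ζ) _
  have : IsAlgClosure (fieldK ζ) (AlgebraicClosure (fieldL p ζ)) :=
    ⟨inferInstance, inferInstance⟩
  exact ⟨τ.liftNormal _, fun x ↦ τ.liftNormal_commutes _ x⟩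

variable {wL : fieldL p ζ} (hw : (wL : Ω) ^ p = ζ)

include hζ hp2 hw

theorem gamProd_fieldL_ne_zero {I : ℕ} (hI1 : 1 ≤ I) (hI2 : I ≤ halfRank p) :
    gamProd p (zetaL p ζ) (wL ^ I)⁻¹ ≠ 0 :=
  gamProd_ne_zero (isPrimitiveRoot_zetaL hζ) (inv_pow_pow_ne_one hζ hp2 hw hI1 hI2)

/-- The elements `γ_I` are independent modulo `p`-th powers of `L`. -/
theorem dvd_of_prod_gam_eq_pow (hV : ¬ p ∣ hPlus ζ) {e : Fin (halfRank p) → ℕ} {a : fieldL p ζ}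
    (h : ∏ i : Fin (halfRank p), gamProd p (zetaL p ζ) (wL ^ ((i : ℕ) + 1))⁻¹ ^ e i = a ^ p)
    (k : Fin (halfRank p)) : p ∣ e k := by
  have hr := halfRank_eq hp2
  obtain ⟨τ, hτ⟩ := exists_isKummerDual hζ hp2 hV
  have hL := finiteDimensional_fieldL hζ hp2
  set A := AlgebraicClosure (fieldL p ζ)
  choose σ hσ using fun i ↦ exists_lifts (τ i) hL
  choose y hy using fun i : Fin (halfRank p) ↦ IsAlgClosed.exists_pow_nat_eq
    (algebraMap (fieldL p ζ) A (gamProd p (zetaL p ζ) (wL ^ ((i : ℕ) + 1))⁻¹)) hp.out.pos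
  -- This commutator fixes `L` and moves only the root of index `k`, by `ζ ^ (k + 1)`. A product of
  -- the roots lying in `L` up to a root of unity is fixed by it, so `p ∣ (k + 1) * e k`.
  set c := σ k.succ * σ 0 * (σ k.succ)⁻¹ * (σ 0)⁻¹
  set z := algebraMap (fieldL p ζ) A (zetaL p ζ)
  have hz : IsPrimitiveRoot z p :=
    (isPrimitiveRoot_zetaL hζ).map_of_injective (algebraMap (fieldL p ζ) A).injective
  have hcL : ∀ x, c (algebraMap (fieldL p ζ) A x) = algebraMap (fieldL p ζ) A x := fun x ↦
    lift_commutator_algebraMap hσ hζ hp2 hV 0 k.succ x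
  have hcy : ∀ i, c (y i) = z ^ (if i = k then (k : ℕ) + 1 else 0) * y i := by
    intro i
    rw [lift_commutator_apply hζ hp2 hτ hσ hw (by omega) (by omega) (hy i) hV (Fin.succ_pos k)]
    by_cases hik : i = k
    · subst hik
      rw [if_pos ⟨rfl, by simp⟩, if_pos rfl]
    · have : ¬ (k : ℕ) = i := fun h ↦ hik (Fin.ext h.symm)
      simp [hik, this]
  have hy0 : ∀ i, y i ≠ 0 := fun i h0 ↦ by
    have h1 := hy i
    rw [h0, zero_pow hp.out.ne_zero, eq_comm, map_eq_zero] at h1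
    exact gamProd_fieldL_ne_zero hζ hp2 hw (by omega) (by omega) h1
  have hprod0 : ∏ i, y i ^ e i ≠ 0 := Finset.prod_ne_zero_iff.mpr fun i _ ↦ pow_ne_zero _ (hy0 i)
  have h1 : (∏ i, y i ^ e i) ^ p = algebraMap (fieldL p ζ) A a ^ p := by
    rw [← map_pow, ← h, map_prod, ← Finset.prod_pow]
    refine Finset.prod_congr rfl fun i _ ↦ ?_
    rw [map_pow, ← hy, pow_right_comm]
  have ha0 : algebraMap (fieldL p ζ) A a ≠ 0 := fun h0 ↦ by
    rw [h0, zero_pow hp.out.ne_zero] at h1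
    exact pow_ne_zero _ hprod0 h1
  obtain ⟨m, hm⟩ := exists_eq_pow_mul_of_pow_eq hz ha0 h1
  have h2 : c (∏ i, y i ^ e i) = ∏ i, y i ^ e i := by
    rw [hm, map_mul, map_pow, hcL, hcL]
  have h3 : c (∏ i, y i ^ e i) = z ^ (((k : ℕ) + 1) * e k) * ∏ i, y i ^ e i := by
    rw [map_prod]
    simp only [map_pow, hcy, mul_pow]
    rw [Finset.prod_mul_distrib, Finset.prod_eq_single k]
    · rw [if_pos rfl, ← pow_mul]
    · intro i _ hik
      rw [if_neg hik, pow_zero, one_pow]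
    · simp
  have h4 : z ^ (((k : ℕ) + 1) * e k) = 1 := by
    rw [h2] at h3
    exact mul_right_cancel₀ hprod0 (by rw [← h3, one_mul])
  rw [hz.pow_eq_one_iff_dvd, hp.out.dvd_mul] at h4
  exact h4.resolve_left (Nat.not_dvd_of_pos_of_lt (by omega) (by omega))

/-- `L R_I` is generated over `L` by a `p`-th root of `γ_I`. -/
theorem fieldLR_eq_adjoin {I : ℕ} (hI : I ≤ p) {y : Ω} (hy : y ^ p = gam p ζ (wL : Ω) I) :
    fieldLR p ζ (wL : Ω) I = adjoin (fieldL p ζ) {y} := by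
  have hL : ∀ x : Ω, x ∈ fieldL p ζ → x ∈ adjoin (fieldL p ζ) {y} := fun x hx ↦
    (adjoin (fieldL p ζ) {y}).algebraMap_mem ⟨x, hx⟩
  apply le_antisymm
  · rw [fieldLR, adjoin_le_iff]
    suffices h : fieldR p ζ (wL : Ω) I ≤ (adjoin (fieldL p ζ) {y}).restrictScalars (fieldK ζ) from h
    refine sup_le ?_ ?_
    · rw [fieldF, adjoin_le_iff]
      rintro x (hx | hx)
      · have h1 : x ^ p = ((wL : Ω) ^ I)⁻¹ ^ p := by
          rw [hx, inv_pow, ← pow_mul, mul_comm, pow_mul, hw]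
        obtain ⟨m, rfl⟩ := exists_eq_zeta_pow_mul hζ h1
        exact hL _ (mul_mem (pow_mem zeta_mem_fieldL m) (inv_mem (pow_mem wL.2 I)))
      · exact hL _ (mem_fieldL_of_pow_eq_inv hζ hI hx)
    · rw [adjoin_le_iff]
      intro x hx
      obtain ⟨m, rfl⟩ := exists_eq_zeta_pow_mul hζ ((show x ^ p = _ from hx).trans hy.symm)
      exact mul_mem (hL _ (pow_mem zeta_mem_fieldL m)) (mem_adjoin_simple_self _ y)
  · rw [adjoin_simple_le_iff]
    apply subset_adjoin
    exact (le_sup_right : _ ≤ fieldR p ζ (wL : Ω) I) (subset_adjoin _ _ hy)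

theorem fieldRt_eq_adjoin {y : Fin (halfRank p) → Ω}
    (hy : ∀ i, y i ^ p = gam p ζ (wL : Ω) (i + 1)) :
    fieldRt p ζ (wL : Ω) = adjoin (fieldL p ζ) (Set.range y) := by
  have hr := halfRank_eq hp2
  rw [fieldRt, ← Set.iUnion_singleton_eq_range, adjoin_iUnion]
  exact iSup_congr fun i ↦ fieldLR_eq_adjoin hζ hp2 hw (by omega) (hy i)

/-- The Galois group of `L R_I / L`. -/
theorem exists_kummerEquiv_fieldLR (hV : ¬ p ∣ hPlus ζ) (k : Fin (halfRank p)) {y : Ω}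
    (hy : y ^ p = gam p ζ (wL : Ω) (k + 1)) (hyM : y ∈ fieldLR p ζ (wL : Ω) (k + 1)) :
    ∃ κ : Gal((fieldLR p ζ (wL : Ω) (k + 1))/(fieldL p ζ)) ≃* Multiplicative (Unit → ZMod p),
      ∀ σ i, σ ⟨y, hyM⟩ = algebraMap (fieldL p ζ) (fieldLR p ζ (wL : Ω) (k + 1))
        (AddChar.zmodChar p (isPrimitiveRoot_zetaL hζ).pow_eq_one ((κ σ).toAdd i)) * ⟨y, hyM⟩ := by
  have hr := halfRank_eq hp2
  refine exists_kummerEquiv (isPrimitiveRoot_zetaL hζ) (x := fun _ : Unit ↦ y)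
    (t := fun _ ↦ gamProd p (zetaL p ζ) (wL ^ ((k : ℕ) + 1))⁻¹)
    (by rw [Set.range_const]; exact fieldLR_eq_adjoin hζ hp2 hw (by omega) hy)
    (fun _ ↦ by rw [hy, ← coe_gamProd_fieldL]; rfl) (fun _ ↦ hyM)
    (fun _ ↦ gamProd_fieldL_ne_zero hζ hp2 hw (by omega) (by omega)) fun e u h i ↦ ?_
  have h1 := dvd_of_prod_gam_eq_pow hζ hp2 hw hV (e := fun j ↦ if j = k then e () else 0) (a := u)
    (by
      rw [← h, Finset.prod_eq_single k]
      · simp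
      · intro j _ hj
        simp [hj]
      · simp) k
  simpa using h1

/-- The extension `L R_I / L` is unramified outside `p`. -/
theorem isUnramifiedAt_fieldLR [NumberField (fieldL p ζ)] {I : ℕ} (hI1 : 1 ≤ I)
    (hI2 : I ≤ halfRank p) (P : Ideal (𝓞 (fieldLR p ζ (wL : Ω) I))) [P.IsPrime]
    [FiniteDimensional (fieldL p ζ) (fieldLR p ζ (wL : Ω) I)]
    (hP : (p : 𝓞 (fieldLR p ζ (wL : Ω) I)) ∉ P) : Algebra.IsUnramifiedAt (𝓞 (fieldL p ζ)) P := by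
  have hr := halfRank_eq hp2
  have : NumberField (fieldLR p ζ (wL : Ω) I) :=
    NumberField.of_module_finite (fieldL p ζ) (fieldLR p ζ (wL : Ω) I)
  obtain ⟨y, hy⟩ := IsAlgClosed.exists_pow_nat_eq (gam p ζ (wL : Ω) I) hp.out.pos
  have hLR := fieldLR_eq_adjoin hζ hp2 hw (by omega) hy
  have hyM : y ∈ fieldLR p ζ (wL : Ω) I := by
    rw [hLR]
    exact mem_adjoin_simple_self _ y
  have hup : IsPrimitiveRoot ((wL ^ I)⁻¹ ^ p) p := by
    have h1 : (wL ^ I)⁻¹ ^ p = (zetaL p ζ ^ I)⁻¹ := by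
      apply Subtype.ext
      change ((wL : Ω) ^ I)⁻¹ ^ p = (ζ ^ I)⁻¹
      rw [inv_pow, ← pow_mul, mul_comm, pow_mul, hw]
    rw [h1]
    exact ((isPrimitiveRoot_zetaL hζ).pow_of_coprime _
      (Nat.coprime_of_lt_prime (by omega) (by omega) hp.out).symm).inv
  have hyF : y ^ p = algebraMap (fieldL p ζ) Ω (gamProd p (zetaL p ζ) (wL ^ I)⁻¹) := by
    rw [hy, ← coe_gamProd_fieldL]
    rfl
  have hgen := adjoin_kummer_eq_top (ι := Unit) (x := fun _ ↦ y)
    (t := fun _ ↦ gamProd p (zetaL p ζ) (wL ^ I)⁻¹) (by rw [Set.range_const]; exact hLR)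
    (fun _ ↦ hyF) (fun _ ↦ hyM)
  rw [Set.range_const] at hgen
  exact isUnramifiedAt_of_pow_eq_gamProd (isPrimitiveRoot_zetaL hζ) hup (Subtype.ext hyF) hgen P hP

theorem numberField_fieldL : NumberField (fieldL p ζ) := by
  have := isCyclotomicExtension_fieldK hζ
  have : NumberField (fieldK ζ) := IsCyclotomicExtension.numberField {p} ℚ _
  have := finiteDimensional_fieldL hζ hp2
  exact NumberField.of_module_finite (fieldK ζ) (fieldL p ζ)

theorem isElemAbUnramifiedOutside_fieldLR (hV : ¬ p ∣ hPlus ζ) (k : Fin (halfRank p)) :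
    IsElemAbUnramifiedOutside p (L := fieldL p ζ) (F := fieldLR p ζ (wL : Ω) (k + 1)) := by
  have hr := halfRank_eq hp2
  obtain ⟨y, hy⟩ := IsAlgClosed.exists_pow_nat_eq (gam p ζ (wL : Ω) (k + 1)) hp.out.pos
  have hLR := fieldLR_eq_adjoin hζ hp2 hw (by omega) hy
  have hyM : y ∈ fieldLR p ζ (wL : Ω) (k + 1) := by
    rw [hLR]
    exact mem_adjoin_simple_self _ y
  have hM : fieldLR p ζ (wL : Ω) (k + 1) = adjoin (fieldL p ζ) (Set.range fun _ : Unit ↦ y) := by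
    rw [Set.range_const]; exact hLR
  have hx : ∀ i : Unit, (fun _ ↦ y) i ^ p = algebraMap (fieldL p ζ) Ω
      ((fun _ : Unit ↦ gamProd p (zetaL p ζ) (wL ^ ((k : ℕ) + 1))⁻¹) i) :=
    fun _ ↦ by simp only [hy]; rw [← coe_gamProd_fieldL]; rfl
  obtain ⟨κ, -⟩ := exists_kummerEquiv_fieldLR hζ hp2 hw hV k hy hyM
  have hfin := finiteDimensional_kummer hM hx
  have := numberField_fieldL hζ hp2 hw
  refine ⟨hfin, isGalois_kummer (isPrimitiveRoot_zetaL hζ) hM hx, fun σ τ ↦ ?_, fun σ ↦ ?_,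
    fun P _ hP ↦ isUnramifiedAt_fieldLR hζ hp2 hw (by omega) (by omega) P hP⟩
  · apply κ.injective
    rw [map_mul, map_mul, mul_comm]
  · apply κ.injective
    rw [map_pow, map_one, ← ofAdd_toAdd (κ σ), ← ofAdd_nsmul, ← ofAdd_zero]
    congr 1
    funext i
    simp

theorem fieldRt_le_fieldE (hV : ¬ p ∣ hPlus ζ) : fieldRt p ζ (wL : Ω) ≤ fieldE p ζ :=
  iSup_le fun k ↦ le_sSup (isElemAbUnramifiedOutside_fieldLR hζ hp2 hw hV k)

end FermatHeis

/-! ### Restriction maps and composita -/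

namespace FermatHeis

open IntermediateField

section Restriction

variable {L Ω : Type*} [Field L] [Field Ω] [Algebra L Ω] {A B : IntermediateField L Ω}

theorem exists_restrictHom (h : A ≤ B) [Normal L A] :
    ∃ π : Gal(B/L) →* Gal(A/L), ∀ σ, RestrictsTo h σ (π σ) := by
  let _ : Algebra A B := (inclusion h).toRingHom.toAlgebra
  have : IsScalarTower L A B := IsScalarTower.of_algebraMap_eq fun _ ↦ rfl
  exact ⟨AlgEquiv.restrictNormalHom A, fun σ x ↦
    congrArg Subtype.val (σ.restrictNormal_commutes A x)⟩

theorem RestrictsTo.kummer_exponent_eq {p : ℕ} [NeZero p] {z : L} (hz : IsPrimitiveRoot z p)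
    {h : A ≤ B} {σ : Gal(B/L)} {ρ : Gal(A/L)} (hσρ : RestrictsTo h σ ρ) {y : Ω} (hy0 : y ≠ 0)
    (hyA : y ∈ A) (hyB : y ∈ B) {a b : ZMod p}
    (hσ : σ ⟨y, hyB⟩ = algebraMap L B (AddChar.zmodChar p hz.pow_eq_one a) * ⟨y, hyB⟩)
    (hρ : ρ ⟨y, hyA⟩ = algebraMap L A (AddChar.zmodChar p hz.pow_eq_one b) * ⟨y, hyA⟩) :
    b = a := by
  have h1 := hσρ ⟨y, hyA⟩
  rw [hρ] at h1
  have h2 := h1.trans (congrArg Subtype.val hσ)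
  have h3 : algebraMap L Ω (AddChar.zmodChar p hz.pow_eq_one b) * y =
    algebraMap L Ω (AddChar.zmodChar p hz.pow_eq_one a) * y := h2
  have h4 := (algebraMap L Ω).injective (mul_right_cancel₀ hy0 h3)
  exact ZMod.val_injective p (hz.pow_inj (ZMod.val_lt b) (ZMod.val_lt a) h4)

theorem exists_restrictScalars_eq (K : Type*) {L M : Type*} [Field K] [Field L] [Field M]
    [Algebra K L] [Algebra K M] [Algebra L M] [IsScalarTower K L M] (σ : Gal(M/K))
    (h : ∀ x : L, σ (algebraMap L M x) = algebraMap L M x) :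
    ∃ ρ : Gal(M/L), ρ.restrictScalars K = σ :=
  ⟨AlgEquiv.ofRingEquiv (f := σ.toRingEquiv) h, AlgEquiv.ext fun _ ↦ rfl⟩

end Restriction

section Compositum

variable {L Ω : Type*} [Field L] [CharZero L] [Field Ω] [Algebra L Ω] {p : ℕ} [hp : Fact p.Prime]
  {z : L} (hz : IsPrimitiveRoot z p) {ι : Type*} [Fintype ι] {y : ι → Ω} (hy0 : ∀ i, y i ≠ 0)
  {R : IntermediateField L Ω} {A : ι → IntermediateField L Ω} (hA : ∀ i, A i ≤ R)
  (hyA : ∀ i, y i ∈ A i) (hyR : ∀ i, y i ∈ R)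
  {κR : Gal(R/L) ≃* Multiplicative (ι → ZMod p)}
  (hκR : ∀ σ i, σ ⟨y i, hyR i⟩ =
    algebraMap L R (AddChar.zmodChar p hz.pow_eq_one ((κR σ).toAdd i)) * ⟨y i, hyR i⟩)
  {κA : ∀ i, Gal((A i)/L) ≃* Multiplicative (Unit → ZMod p)}
  (hκA : ∀ i σ u, σ ⟨y i, hyA i⟩ =
    algebraMap L (A i) (AddChar.zmodChar p hz.pow_eq_one ((κA i σ).toAdd u)) * ⟨y i, hyA i⟩)

include hz hy0 hyA hyR hκR hκA in
/-- The Galois group of a compositum of independent Kummer extensions of degree `p`. -/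
theorem exists_mulEquiv_pi_gal [∀ i, Normal L (A i)] :
    ∃ e : Gal(R/L) ≃* ((i : ι) → Gal((A i)/L)), (∀ σ i, RestrictsTo (hA i) σ (e σ i)) ∧
      ∀ σ i, e σ i = 1 ↔ (κR σ).toAdd i = 0 := by
  choose res hres using fun i ↦ exists_restrictHom (hA i)
  have key : ∀ σ i u, (κA i (res i σ)).toAdd u = (κR σ).toAdd i := fun σ i u ↦
    (hres i σ).kummer_exponent_eq hz (hy0 i) (hyA i) (hyR i) (hκR σ i) (hκA i _ u)
  have hbij : Function.Bijective (MonoidHom.pi res) := by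
    refine ⟨fun σ σ' h ↦ κR.injective (Multiplicative.toAdd.injective (funext fun i ↦ ?_)),
      fun f ↦ ⟨κR.symm (Multiplicative.ofAdd fun i ↦ (κA i (f i)).toAdd ()), funext fun i ↦
        (κA i).injective (Multiplicative.toAdd.injective (funext fun u ↦ ?_))⟩⟩
    · rw [← key σ i (), ← key σ' i ()]
      exact congrArg (fun g ↦ (κA i g).toAdd ()) (congrFun h i)
    · refine (key _ i u).trans ?_
      rw [MulEquiv.apply_symm_apply]
      rfl
  refine ⟨MulEquiv.ofBijective _ hbij, fun σ i ↦ hres i σ, fun σ i ↦ ?_⟩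
  change res i σ = 1 ↔ _
  rw [← key σ i (), ← (κA i).map_eq_one_iff, ← toAdd_eq_zero]
  exact ⟨fun h ↦ congrFun h (), fun h ↦ funext fun _ ↦ h⟩

end Compositum

/-- Nonzero multiples of the standard basis form a basis. -/
theorem exists_mulEquiv_map_single {F ι G : Type*} [Field F] [DecidableEq ι] [Group G]
    (κ : G ≃* Multiplicative (ι → F)) {d : ι → F} (hd : ∀ i, d i ≠ 0) {c : ι → G}
    (hc : ∀ k, (κ (c k)).toAdd = Pi.single k (d k)) :
    ∃ b : Multiplicative (ι → F) ≃* G, ∀ k, b (Multiplicative.ofAdd (Pi.single k 1)) = c k := by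
  let u : (ι → F) ≃+ (ι → F) :=
    AddEquiv.piCongrRight fun i ↦ DistribMulAction.toAddEquiv₀ F (d i) (hd i)
  refine ⟨u.toMultiplicative.trans κ.symm, fun k ↦ ?_⟩
  rw [MulEquiv.trans_apply, MulEquiv.symm_apply_eq]
  apply Multiplicative.toAdd.injective
  rw [hc]
  funext i
  change d i * (Pi.single k 1 : ι → F) i = _
  by_cases h : i = k
  · subst h; simp
  · simp [h]

end FermatHeis

/-! ### The main theorem -/

set_option maxHeartbeats 1000000 in
open FermatHeis in
theorem proposition4p11 {Ω : Type*} [Field Ω] [CharZero Ω] [IsAlgClosed Ω]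
    (p : ℕ) (hp : p.Prime) (hp2 : p ≠ 2)
    (ζ w : Ω) (hζ : IsPrimitiveRoot ζ p) (hw : w ^ p = ζ)
    -- Vandiver's conjecture for `p`
    (hV : ¬ p ∣ hPlus ζ) :
    -- the restriction maps `N = Gal(E/L) → Gal(R̃/L)` and `Gal(R̃/L) → ∏ Gal(L R_I / L)`
    ∃ (hRE : fieldRt p ζ w ≤ fieldE p ζ)
      (hIR : ∀ I : Fin (halfRank p), fieldLR p ζ w (I + 1) ≤ fieldRt p ζ w)
      (π : Gal((fieldE p ζ)/(fieldL p ζ)) →* Gal((fieldRt p ζ w)/(fieldL p ζ)))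
      (e : Gal((fieldRt p ζ w)/(fieldL p ζ)) ≃*
        ((I : Fin (halfRank p)) → Gal((fieldLR p ζ w (I + 1))/(fieldL p ζ)))),
      (∀ σ, RestrictsTo hRE σ (π σ)) ∧
      (∀ σ (I : Fin (halfRank p)), RestrictsTo (hIR I) σ (e σ I)) ∧
      -- each `N_I` is `ℤ/p`, and `N_H` is `(ℤ/p)^r`
      (∀ I : Fin (halfRank p), Nonempty
        (Gal((fieldLR p ζ w (I + 1))/(fieldL p ζ)) ≃* Multiplicative (ZMod p))) ∧
      Nonempty (Gal((fieldRt p ζ w)/(fieldL p ζ)) ≃*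
        Multiplicative (Fin (halfRank p) → ZMod p)) ∧
      -- the generators `τ₀, …, τᵣ` of `Gal(L/K)` exist, and for all sections `s`:
      (∃ τ, IsKummerDual p ζ τ) ∧
      ∀ τ, IsKummerDual p ζ τ → ∀ s, IsGalSection p ζ s →
        ∃ (a : Fin (halfRank p + 1) → Gal((fieldE p ζ)/(fieldL p ζ)))
          (c : Fin (halfRank p + 1) → Fin (halfRank p + 1) →
            Gal((fieldE p ζ)/(fieldL p ζ))),
          (∀ i, (a i).restrictScalars (fieldK ζ) = s (τ i) ^ p) ∧
          (∀ j k, j < k → (c j k).restrictScalars (fieldK ζ) =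
            s (τ k) * s (τ j) * (s (τ k))⁻¹ * (s (τ j))⁻¹) ∧
          -- the `c₀ₖ` for `1 ≤ k ≤ r` map to a basis
          (∃ b : Multiplicative (Fin (halfRank p) → ZMod p) ≃*
              Gal((fieldRt p ζ w)/(fieldL p ζ)),
            ∀ k : Fin (halfRank p),
              b (Multiplicative.ofAdd (Pi.single k 1)) = π (c 0 k.succ)) ∧
          (∀ i, π (a i) = 1) ∧
          (∀ j k, j < k → j ≠ 0 → π (c j k) = 1) ∧
          (∀ k I : Fin (halfRank p), e (π (c 0 k.succ)) I ≠ 1 ↔ k = I) := by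
  have := Fact.mk hp
  have hr := halfRank_eq hp2
  obtain ⟨wL, rfl⟩ : ∃ wL : fieldL p ζ, (wL : Ω) = w :=
    ⟨⟨w, mem_fieldL_of_pow_eq_zeta hζ hp2 hw⟩, rfl⟩
  have hRE : fieldRt p ζ (wL : Ω) ≤ fieldE p ζ := fieldRt_le_fieldE hζ hp2 hw hV
  have hIR (I : Fin (halfRank p)) : fieldLR p ζ (wL : Ω) (I + 1) ≤ fieldRt p ζ (wL : Ω) :=
    le_iSup (fun I : Fin (halfRank p) ↦ fieldLR p ζ (wL : Ω) (I + 1)) I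
  have hzL := isPrimitiveRoot_zetaL hζ
  choose y hy using fun i : Fin (halfRank p) ↦
    IsAlgClosed.exists_pow_nat_eq (gam p ζ (wL : Ω) (i + 1)) hp.pos
  have hyA (i : Fin (halfRank p)) : y i ∈ fieldLR p ζ (wL : Ω) (i + 1) := by
    rw [fieldLR_eq_adjoin hζ hp2 hw (by omega) (hy i)]
    exact IntermediateField.mem_adjoin_simple_self _ _
  have hyR (i : Fin (halfRank p)) : y i ∈ fieldRt p ζ (wL : Ω) := hIR i (hyA i)
  have hyE (i : Fin (halfRank p)) : y i ∈ fieldE p ζ := hRE (hyR i)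
  have hyt (i : Fin (halfRank p)) : y i ^ p =
      algebraMap (fieldL p ζ) Ω (gamProd p (zetaL p ζ) (wL ^ ((i : ℕ) + 1))⁻¹) := by
    rw [hy, ← coe_gamProd_fieldL]
    rfl
  have ht (i : Fin (halfRank p)) : gamProd p (zetaL p ζ) (wL ^ ((i : ℕ) + 1))⁻¹ ≠ 0 :=
    gamProd_fieldL_ne_zero hζ hp2 hw (by omega) (by omega)
  have hy0 (i : Fin (halfRank p)) : y i ≠ 0 := fun h ↦ by
    have h1 := hyt i
    rw [h, zero_pow hp.ne_zero, eq_comm, map_eq_zero] at h1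
    exact ht i h1
  have hMR := fieldRt_eq_adjoin hζ hp2 hw hy
  obtain ⟨κR, hκR⟩ := exists_kummerEquiv hzL hMR hyt hyR ht
    fun _ _ h ↦ dvd_of_prod_gam_eq_pow hζ hp2 hw hV h
  choose κA hκA using fun k ↦ exists_kummerEquiv_fieldLR hζ hp2 hw hV k (hy k) (hyA k)
  have hnA (k : Fin (halfRank p)) :
      Normal (fieldL p ζ) (fieldLR p ζ (wL : Ω) ((k : ℕ) + 1)) :=
    (isElemAbUnramifiedOutside_fieldLR hζ hp2 hw hV k).galois.to_normal
  have hnR : Normal (fieldL p ζ) (fieldRt p ζ (wL : Ω)) := (isGalois_kummer hzL hMR hyt).to_normal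
  obtain ⟨π, hπ⟩ := exists_restrictHom hRE
  obtain ⟨e, he, he1⟩ := exists_mulEquiv_pi_gal hzL hy0 hIR hyA hyR hκR hκA
  refine ⟨hRE, hIR, π, e, hπ, he, fun I ↦ ⟨(κA I).trans
    (AddEquiv.piUnique fun _ : Unit ↦ ZMod p).toMultiplicative⟩, ⟨κR⟩,
    exists_isKummerDual hζ hp2 hV, fun τ hτ s hs ↦ ?_⟩
  have hσ (i x) : s (τ i) (algebraMap (fieldL p ζ) (fieldE p ζ) x) =
      algebraMap (fieldL p ζ) (fieldE p ζ) (τ i x) := hs (τ i) x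
  -- `Gal(L/K)` is abelian of exponent `p`, so these `p`-th powers and commutators fix `L` and come
  -- from `Gal(E/L)`.
  choose a ha using fun i ↦ exists_restrictScalars_eq (fieldK ζ) (s (τ i) ^ p)
    (lift_pow_algebraMap (σ := fun i ↦ s (τ i)) hσ hζ hp2 hV i)
  choose c hc using fun j k ↦ exists_restrictScalars_eq (fieldK ζ)
    (s (τ k) * s (τ j) * (s (τ k))⁻¹ * (s (τ j))⁻¹)
    (lift_commutator_algebraMap (σ := fun i ↦ s (τ i)) hσ hζ hp2 hV j k)
  have hyE' (i : Fin (halfRank p)) : (⟨y i, hyE i⟩ : fieldE p ζ) ^ p =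
      algebraMap (fieldL p ζ) (fieldE p ζ) (gamProd p (zetaL p ζ) (wL ^ ((i : ℕ) + 1))⁻¹) :=
    Subtype.ext (hyt i)
  -- The coordinates of `π σ` can be read off in `E`, from the action of `σ` on the roots `y i`.
  have hκ {σ : Gal((fieldE p ζ)/(fieldL p ζ))} {i : Fin (halfRank p)} {n : ℕ}
      (h : σ ⟨y i, hyE i⟩ =
        algebraMap (fieldL p ζ) (fieldE p ζ) (zetaL p ζ) ^ n * ⟨y i, hyE i⟩) :
      (κR (π σ)).toAdd i = n := by
    refine (hπ σ).kummer_exponent_eq hzL (hy0 i) (hyR i) (hyE i) ?_ (hκR _ i)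
    rw [h, AddChar.zmodChar_apply', map_pow]
  have hκa (i) : κR (π (a i)) = 1 := by
    refine Multiplicative.toAdd.injective (funext fun I ↦ ?_)
    rw [hκ (n := 0), Nat.cast_zero]
    · rfl
    rw [pow_zero, one_mul]
    exact (DFunLike.congr_fun (ha i) _).trans (lift_pow_apply (σ := fun i ↦ s (τ i)) hζ hp2 hτ hσ
      hw (by omega) (by omega) (hyE' I) i)
  have hκc {j k} (hjk : j < k) (I : Fin (halfRank p)) : (κR (π (c j k))).toAdd I =
      ((if j = 0 ∧ (k : ℕ) = (I : ℕ) + 1 then (I : ℕ) + 1 else 0 : ℕ) : ZMod p) :=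
    hκ ((DFunLike.congr_fun (hc j k) _).trans (lift_commutator_apply (σ := fun i ↦ s (τ i)) hζ hp2
      hτ hσ hw (by omega) (by omega) (hyE' I) hV hjk))
  have hd (k : Fin (halfRank p)) : (((k : ℕ) + 1 : ℕ) : ZMod p) ≠ 0 := by
    rw [Ne, ZMod.natCast_eq_zero_iff]
    exact Nat.not_dvd_of_pos_of_lt (by omega) (by omega)
  -- Index `k` stands for `I = k + 1`, so the commutator is `k + 1` times a basis vector, and `0 < k
  -- + 1 < p`.
  have hκc0 (k : Fin (halfRank p)) :
      (κR (π (c 0 k.succ))).toAdd = Pi.single k (((k : ℕ) + 1 : ℕ) : ZMod p) := by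
    funext I
    rw [hκc (Fin.succ_pos k)]
    by_cases h : I = k
    · subst h
      simp
    · have h1 : ¬ (k : ℕ) = I := fun h1 ↦ h (Fin.ext h1.symm)
      simp [h, h1]
  refine ⟨a, c, ha, fun j k _ ↦ hc j k, exists_mulEquiv_map_single κR hd hκc0,
    fun i ↦ κR.map_eq_one_iff.mp (hκa i), fun j k hjk hj ↦ κR.map_eq_one_iff.mp
      (Multiplicative.toAdd.injective (funext fun I ↦ ?_)), fun k I ↦ ?_⟩
  · rw [hκc hjk, if_neg fun h ↦ hj h.1, Nat.cast_zero]
    rfl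
  · rw [Ne, he1, hκc0]
    by_cases h : I = k
    · subst h
      simpa using hd I
    · simp [h, Ne.symm h]
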